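/- Let $z=f(x,y)$ be a germ at the origin of a smooth surface in Monge form, write $f_{ij}=\partial_x^i\partial_y^j f(0,0)$, and let $z=f^\varepsilon(x,y)$, $f^0=f$, be a one-parameter family of surfaces, smooth in $(\varepsilon,x,y)$. An asymptotic line is a tangent line with at least 3-point contact with the surface. At a hyperbolic point one asymptotic line is left and one is right (according to the sign of the torsion of the asymptotic curves). The left (right) branch of the flecnodal curve consists of the hyperbolic points whose left (right) asymptotic line has at least 4-point contact, and a biflecnode of a branch is a point where this line has at least 5-point contact (simple if exactly 5). A hyperbonode (ellipnode) is a hyperbolic (elliptic) point at which, in Monge form, the quadratic part divides the cubic part; the ellipnodes are the real points common to the two complex conjugate branches of the flecnodal curve belonging to the complex conjugate asymptotic directions. "Generic family" in (a) and (c) means: the pair formed by the 5-jets at the origin of $f^0$ and of $\partial_\varepsilon f^\varepsilon|_{\varepsilon=0}$ lies in a certain open set of pairs, dense in the set of pairs whose first jet satisfies the conditions under consideration. Suppose $f_{20}=f_{02}=0$, $f_{11}\neq0$ and $f_{30}=f_{03}=0$. Put $u=3f_{21}^2-2f_{31}f_{11}$ and $v=3f_{12}^2-2f_{13}f_{11}$.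 (a) Suppose $4f_{40}f_{04}f_{11}^2-uv=0$. If $(f_{40},u)\neq(0,0)$ and $(f_{04},v)\neq(0,0)$, then the left and right branches of the flecnodal curve are smooth at the origin, which is a hyperbonode, and tangent to each other there. In a generic family, two hyperbonodes are born or die at $\varepsilon=0$ (bi-hyperbonode): near the origin, for small $\varepsilon$, the two branches are smooth curves; for one sign of $\varepsilon$ there is no hyperbonode; for $\varepsilon=0$ the origin is the only one, and the branches are tangent there; for the other sign there are exactly two, and the branches cross transversely at both. (b) Suppose $f_{40}=0$, $f_{50}\neq0$ and $uv\neq0$. Then in every family, for small $\varepsilon$, both branches are smooth near the origin, there is near the origin exactly one hyperbonode, at which the branches cross transversely, and exactly one biflecnode of the branch whose asymptotic line at the origin is the $x$-axis for $\varepsilon=0$; this biflecnode is simple, both points move smoothly with $\varepsilon$, and both are at the origin at $\varepsilon=0$ (flec-hyperbonode). For every such 5-jet of $f$ there is an open dense set of 5-jets such that, if the 5-jet of $\partial_\varepsilon f^\varepsilon|_{\varepsilon=0}$ belongs to it, the biflecnode crosses the other branch with nonzero speed at $\varepsilon=0$. (c) Suppose instead $f_{20}=f_{02}\neq0$, $f_{11}=0$,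 $f_{30}=f_{03}=f_{21}=f_{12}=0$ and $(f_{40}-3f_{22})(f_{04}-3f_{22})-(f_{31}-3f_{13})(f_{13}-3f_{31})=0$. If the four numbers $f_{40}-3f_{22}$, $f_{04}-3f_{22}$, $f_{31}-3f_{13}$, $f_{13}-3f_{31}$ are not all zero, then the origin is an ellipnode at which the two complex conjugate branches of the flecnodal curve are smooth and have the same complex tangent line (if $f$ is real analytic, the two complex branches in $\mathbb C^2$ of the complexified surface are smooth holomorphic curves tangent at the origin). In a generic family, two ellipnodes are born or die at $\varepsilon=0$ (bi-ellipnode): near the origin, for small $\varepsilon$, for one sign of $\varepsilon$ there is no ellipnode; for $\varepsilon=0$ the origin is the only one, and the conjugate branches are tangent there; for the other sign there are exactly two, and the conjugate branches are transverse at both. -/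

import Mathlib

open Filter Topology
open scoped ContDiff

namespace Flecnodal

section Forms

variable {𝕜 : Type*} [NontriviallyNormedField 𝕜]

/-- Partial derivative in the first variable `x`. -/
noncomputable def dX (f : 𝕜 × 𝕜 → 𝕜) : 𝕜 × 𝕜 → 𝕜 := fun q => fderiv 𝕜 f q (1, 0)

/-- Partial derivative in the second variable `y`. -/
noncomputable def dY (f : 𝕜 × 𝕜 → 𝕜) : 𝕜 × 𝕜 → 𝕜 := fun q => fderiv 𝕜 f q (0, 1)

/-- The partial derivative `f_{ij} = ∂^{i+j} f / ∂x^i ∂y^j`, as a function. -/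
noncomputable def pd (i j : ℕ) (f : 𝕜 × 𝕜 → 𝕜) : 𝕜 × 𝕜 → 𝕜 := dX^[i] (dY^[j] f)

/-- Second derivative at `t = 0` of `t ↦ f (q + t u)`. It vanishes iff the tangent line of the
surface `z = f (x, y)` over `q + 𝕜 u` has at least 3-point contact with the surface, that is,
iff `u` is an asymptotic direction. -/
noncomputable def quad (f : 𝕜 × 𝕜 → 𝕜) (q u : 𝕜 × 𝕜) : 𝕜 :=
  pd 2 0 f q * u.1 ^ 2 + 2 * pd 1 1 f q * u.1 * u.2 + pd 0 2 f q * u.2 ^ 2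

/-- Third derivative at `t = 0` of `t ↦ f (q + t u)`. -/
noncomputable def cubic (f : 𝕜 × 𝕜 → 𝕜) (q u : 𝕜 × 𝕜) : 𝕜 :=
  pd 3 0 f q * u.1 ^ 3 + 3 * pd 2 1 f q * u.1 ^ 2 * u.2 + 3 * pd 1 2 f q * u.1 * u.2 ^ 2
    + pd 0 3 f q * u.2 ^ 3

/-- Fourth derivative at `t = 0` of `t ↦ f (q + t u)`. -/
noncomputable def quartic (f : 𝕜 × 𝕜 → 𝕜) (q u : 𝕜 × 𝕜) : 𝕜 :=
  pd 4 0 f q * u.1 ^ 4 + 4 * pd 3 1 f q * u.1 ^ 3 * u.2 + 6 * pd 2 2 f q * u.1 ^ 2 * u.2 ^ 2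
    + 4 * pd 1 3 f q * u.1 * u.2 ^ 3 + pd 0 4 f q * u.2 ^ 4

/-- Fifth derivative at `t = 0` of `t ↦ f (q + t u)`. -/
noncomputable def quintic (f : 𝕜 × 𝕜 → 𝕜) (q u : 𝕜 × 𝕜) : 𝕜 :=
  pd 5 0 f q * u.1 ^ 5 + 5 * pd 4 1 f q * u.1 ^ 4 * u.2 + 10 * pd 3 2 f q * u.1 ^ 3 * u.2 ^ 2
    + 10 * pd 2 3 f q * u.1 ^ 2 * u.2 ^ 3 + 5 * pd 1 4 f q * u.1 * u.2 ^ 4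
    + pd 0 5 f q * u.2 ^ 5

/-- Near `q` the set `C` is a smooth (regular) curve through `q` with tangent line `T` there
(over `ℂ`: a smooth holomorphic curve). -/
def IsSmoothCurveAt (C : Set (𝕜 × 𝕜)) (q : 𝕜 × 𝕜) (T : Submodule 𝕜 (𝕜 × 𝕜)) : Prop :=
  ∃ g : 𝕜 × 𝕜 → 𝕜, (∀ᶠ p in 𝓝 q, ContDiffAt 𝕜 ∞ g p) ∧ g q = 0 ∧ fderiv 𝕜 g q ≠ 0 ∧
    (∀ᶠ p in 𝓝 q, p ∈ C ↔ g p = 0) ∧ T = LinearMap.ker (fderiv 𝕜 g q).toLinearMap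

/-- `C` and `D` are smooth curves at `q` with the same tangent line. -/
def TangentAt (C D : Set (𝕜 × 𝕜)) (q : 𝕜 × 𝕜) : Prop :=
  ∃ T, IsSmoothCurveAt C q T ∧ IsSmoothCurveAt D q T

/-- `C` and `D` are smooth curves at `q` with different tangent lines. -/
def TransverseAt (C D : Set (𝕜 × 𝕜)) (q : 𝕜 × 𝕜) : Prop :=
  ∃ T₁ T₂, IsSmoothCurveAt C q T₁ ∧ IsSmoothCurveAt D q T₂ ∧ T₁ ≠ T₂

end Forms

/-- The point of the surface `z = f (x, y)` over `q` is hyperbolic. -/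
def IsHyperbolic (f : ℝ × ℝ → ℝ) (q : ℝ × ℝ) : Prop :=
  pd 2 0 f q * pd 0 2 f q - pd 1 1 f q ^ 2 < 0

/-- The point of the surface `z = f (x, y)` over `q` is elliptic. -/
def IsElliptic (f : ℝ × ℝ → ℝ) (q : ℝ × ℝ) : Prop :=
  0 < pd 2 0 f q * pd 0 2 f q - pd 1 1 f q ^ 2

/-- Node: in Monge form at the point, the quadratic part divides the cubic part. -/
def IsNode (f : ℝ × ℝ → ℝ) (q : ℝ × ℝ) : Prop :=
  ∃ a b : ℝ, ∀ u : ℝ × ℝ, cubic f q u = (a * u.1 + b * u.2) * quad f q u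

/-- Hyperbolic node. -/
def IsHyperbonode (f : ℝ × ℝ → ℝ) (q : ℝ × ℝ) : Prop := IsHyperbolic f q ∧ IsNode f q

/-- Elliptic node. -/
def IsEllipnode (f : ℝ × ℝ → ℝ) (q : ℝ × ℝ) : Prop := IsElliptic f q ∧ IsNode f q

/-- The value `D²f(u, Ju)`, where `J` is the rotation by a right angle. For a curve on the surface
with planar velocity field `u`, asymptotic at each of its points, and `u' = a u + b J u`, the
determinant of the first three derivatives of the space curve is `b² |u|² D²f(u, Ju)`. Hence the
asymptotic line of direction `u` is right if this value is positive and left if it is negative. -/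
noncomputable def twist (f : ℝ × ℝ → ℝ) (q u : ℝ × ℝ) : ℝ :=
  pd 1 1 f q * (u.1 ^ 2 - u.2 ^ 2) + (pd 0 2 f q - pd 2 0 f q) * u.1 * u.2

/-- The right (`s = 1`) or left (`s = -1`) branch of the flecnodal curve, seen in the `(x, y)`-plane:
hyperbolic points whose right (left) asymptotic line has at least 4-point contact. -/
def branch (s : ℝ) (f : ℝ × ℝ → ℝ) : Set (ℝ × ℝ) :=
  {q | IsHyperbolic f q ∧ ∃ u, quad f q u = 0 ∧ 0 < s * twist f q u ∧ cubic f q u = 0}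

/-- The right branch of the flecnodal curve. -/
abbrev rightBranch (f : ℝ × ℝ → ℝ) : Set (ℝ × ℝ) := branch 1 f

/-- The left branch of the flecnodal curve. -/
abbrev leftBranch (f : ℝ × ℝ → ℝ) : Set (ℝ × ℝ) := branch (-1) f

/-- The biflecnodes of a branch: its asymptotic line has at least 5-point contact. -/
def biflecnodes (s : ℝ) (f : ℝ × ℝ → ℝ) : Set (ℝ × ℝ) :=
  {q | IsHyperbolic f q ∧
    ∃ u, quad f q u = 0 ∧ 0 < s * twist f q u ∧ cubic f q u = 0 ∧ quartic f q u = 0}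

/-- The simple biflecnodes of a branch: its asymptotic line has exactly 5-point contact. -/
def simpleBiflecnodes (s : ℝ) (f : ℝ × ℝ → ℝ) : Set (ℝ × ℝ) :=
  {q | IsHyperbolic f q ∧
    ∃ u, quad f q u = 0 ∧ 0 < s * twist f q u ∧ cubic f q u = 0 ∧ quartic f q u = 0 ∧
      quintic f q u ≠ 0}

/-! ### The complex conjugate branches in the elliptic domain -/

/-- At an elliptic point, one of the two complex conjugate asymptotic slopes `p`, the roots of
`f₂₀ + 2 f₁₁ p + f₀₂ p²`. -/
noncomputable def ellSlope (f : ℝ × ℝ → ℝ) (q : ℝ × ℝ) : ℂ :=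
  (-((pd 1 1 f q : ℝ) : ℂ) + Complex.I * (Real.sqrt (pd 2 0 f q * pd 0 2 f q - pd 1 1 f q ^ 2) : ℂ))
    / ((pd 0 2 f q : ℝ) : ℂ)

/-- The cubic form on the complex asymptotic direction `(1, p)`. One complex flecnodal branch is the
zero locus of this complex-valued function, the other that of its complex conjugate. -/
noncomputable def ellCubic (f : ℝ × ℝ → ℝ) (q : ℝ × ℝ) : ℂ :=
  ((pd 3 0 f q : ℝ) : ℂ) + 3 * ((pd 2 1 f q : ℝ) : ℂ) * ellSlope f q
    + 3 * ((pd 1 2 f q : ℝ) : ℂ) * ellSlope f q ^ 2 + ((pd 0 3 f q : ℝ) : ℂ) * ellSlope f q ^ 3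

/-- The complex-linear extension to `ℂ × ℂ` of the differential of a complex-valued function on the
real plane. -/
noncomputable def complexDiff (G : ℝ × ℝ → ℂ) (q : ℝ × ℝ) : ℂ × ℂ →ₗ[ℂ] ℂ :=
  fderiv ℝ G q (1, 0) • LinearMap.fst ℂ ℂ ℂ + fderiv ℝ G q (0, 1) • LinearMap.snd ℂ ℂ ℂ

/-- The complex tangent line in `ℂ × ℂ`, at the real point `q`, of the complex curve `G = 0`. -/
noncomputable def complexTangent (G : ℝ × ℝ → ℂ) (q : ℝ × ℝ) : Submodule ℂ (ℂ × ℂ) :=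
  LinearMap.ker (complexDiff G q)

/-- The two complex conjugate flecnodal branches pass through `q`, are smooth there, and have the
same complex tangent line. -/
def ConjBranchesTangentAt (f : ℝ × ℝ → ℝ) (q : ℝ × ℝ) : Prop :=
  IsElliptic f q ∧ ellCubic f q = 0 ∧ complexDiff (ellCubic f) q ≠ 0 ∧
    complexTangent (ellCubic f) q = complexTangent (fun p => star (ellCubic f p)) q

/-- The two complex conjugate flecnodal branches pass through `q`, are smooth there, and have
different complex tangent lines. -/
def ConjBranchesTransverseAt (f : ℝ × ℝ → ℝ) (q : ℝ × ℝ) : Prop :=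
  IsElliptic f q ∧ ellCubic f q = 0 ∧ complexDiff (ellCubic f) q ≠ 0 ∧
    complexTangent (ellCubic f) q ≠ complexTangent (fun p => star (ellCubic f p)) q

/-- For a holomorphic `Φ` (the complexification of a real analytic `f`): the complex flecnodal branch
of the asymptotic slopes `p` in the upper (`s = 1`) or lower (`s = -1`) half-plane. -/
def complexBranch (s : ℝ) (Φ : ℂ × ℂ → ℂ) : Set (ℂ × ℂ) :=
  {q | ∃ p : ℂ, 0 < s * p.im ∧ quad Φ q (1, p) = 0 ∧ cubic Φ q (1, p) = 0}

/-! ### Jets and families -/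

/-- 5-jets at the origin of functions of two variables, given by the partial derivatives. -/
abbrev Jet : Type := {s : ℕ × ℕ // s.1 + s.2 ≤ 5} → ℝ

/-- The 5-jet of `f` at the origin. -/
noncomputable def jet (f : ℝ × ℝ → ℝ) : Jet := fun s => pd s.1.1 s.1.2 f 0

/-- The partial derivative of order `(i, j)` prescribed by a 5-jet (used for `i + j ≤ 5` only). -/
def Jet.c (J : Jet) (i j : ℕ) : ℝ := if h : i + j ≤ 5 then J ⟨(i, j), h⟩ else 0

/-- `f` is smooth near the origin. -/
def SmoothGerm (f : ℝ × ℝ → ℝ) : Prop := ∀ᶠ q in 𝓝 (0 : ℝ × ℝ), ContDiffAt ℝ ∞ f q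

/-- `F ε (x, y)` is smooth in `(ε, x, y)` near the origin. -/
def SmoothFamily (F : ℝ → ℝ × ℝ → ℝ) : Prop :=
  ∀ᶠ s in 𝓝 (0 : ℝ × (ℝ × ℝ)), ContDiffAt ℝ ∞ (fun s : ℝ × (ℝ × ℝ) => F s.1 s.2) s

/-- The velocity `∂F/∂ε` of a family at `ε = 0`. -/
noncomputable def velocity (F : ℝ → ℝ × ℝ → ℝ) : ℝ × ℝ → ℝ := fun q => deriv (fun ε => F ε q) 0

/-- The origin is a hyperbonode whose asymptotic lines are the coordinate axes. -/
def HyperbonodeJet (J : Jet) : Prop :=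
  J.c 2 0 = 0 ∧ J.c 0 2 = 0 ∧ J.c 1 1 ≠ 0 ∧ J.c 3 0 = 0 ∧ J.c 0 3 = 0

/-- `3 f₂₁² - 2 f₃₁ f₁₁`. -/
def Jet.u (J : Jet) : ℝ := 3 * J.c 2 1 ^ 2 - 2 * J.c 3 1 * J.c 1 1

/-- `3 f₁₂² - 2 f₁₃ f₁₁`. -/
def Jet.v (J : Jet) : ℝ := 3 * J.c 1 2 ^ 2 - 2 * J.c 1 3 * J.c 1 1

/-- The condition for a bi-hyperbonode. -/
def BiHyperbonodeJet (J : Jet) : Prop :=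
  HyperbonodeJet J ∧ 4 * J.c 4 0 * J.c 0 4 * J.c 1 1 ^ 2 - J.u * J.v = 0

/-- The conditions for a flec-hyperbonode. -/
def FlecHyperbonodeJet (J : Jet) : Prop :=
  HyperbonodeJet J ∧ J.c 4 0 = 0 ∧ J.c 5 0 ≠ 0 ∧ J.u * J.v ≠ 0

/-- The origin is an ellipnode, in normalized coordinates. -/
def EllipnodeJet (J : Jet) : Prop :=
  J.c 2 0 = J.c 0 2 ∧ J.c 0 2 ≠ 0 ∧ J.c 1 1 = 0 ∧
    J.c 3 0 = 0 ∧ J.c 0 3 = 0 ∧ J.c 2 1 = 0 ∧ J.c 1 2 = 0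

/-- The condition for a bi-ellipnode. -/
def BiEllipnodeJet (J : Jet) : Prop :=
  EllipnodeJet J ∧
    (J.c 4 0 - 3 * J.c 2 2) * (J.c 0 4 - 3 * J.c 2 2)
      - (J.c 3 1 - 3 * J.c 1 3) * (J.c 1 3 - 3 * J.c 3 1) = 0

/-- `P` holds for every generic smooth family whose member at `ε = 0` satisfies the jet condition `S`:
there is an open set of pairs (5-jet of the function at `ε = 0`, 5-jet of the velocity), dense in
the set of all pairs whose first jet satisfies `S`, such that `P` holds for all families whose
pair lies in it. -/
def ForGenericFamily (S : Jet → Prop) (P : (ℝ → ℝ × ℝ → ℝ) → Prop) : Prop :=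
  ∃ G : Set (Jet × Jet), IsOpen G ∧
    {s : Jet × Jet | S s.1} ⊆ closure (G ∩ {s : Jet × Jet | S s.1}) ∧
    ∀ F : ℝ → ℝ × ℝ → ℝ, SmoothFamily F → S (jet (F 0)) → (jet (F 0), jet (velocity F)) ∈ G → P F

/-- Bi-hyperbonode transition at `ε = 0`: in every small neighbourhood `W` of the origin, for small
`ε`, the left and right branches are smooth curves; on one side of `ε = 0` there is no hyperbonode,
on the other side there are exactly two, at each of which the two branches cross transversely;
for `ε = 0` the origin is the only one, and the branches are tangent there. -/
def BiHyperbonodeTransition (F : ℝ → ℝ × ℝ → ℝ) : Prop :=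
  ∃ σ : ℝ, (σ = 1 ∨ σ = -1) ∧ ∃ U ∈ 𝓝 (0 : ℝ × ℝ), ∀ W ∈ 𝓝 (0 : ℝ × ℝ), W ⊆ U →
    ∀ᶠ ε in 𝓝 (0 : ℝ),
      (∀ q ∈ W, q ∈ leftBranch (F ε) → ∃ T, IsSmoothCurveAt (leftBranch (F ε)) q T) ∧
      (∀ q ∈ W, q ∈ rightBranch (F ε) → ∃ T, IsSmoothCurveAt (rightBranch (F ε)) q T) ∧
      (σ * ε < 0 → {q ∈ W | IsHyperbonode (F ε) q} = ∅) ∧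
      (ε = 0 → {q ∈ W | IsHyperbonode (F ε) q} = {0} ∧
        TangentAt (leftBranch (F ε)) (rightBranch (F ε)) 0) ∧
      (0 < σ * ε → ∃ q₁ q₂, q₁ ≠ q₂ ∧ {q ∈ W | IsHyperbonode (F ε) q} = {q₁, q₂} ∧
        TransverseAt (leftBranch (F ε)) (rightBranch (F ε)) q₁ ∧
        TransverseAt (leftBranch (F ε)) (rightBranch (F ε)) q₂)

/-- Bi-ellipnode transition at `ε = 0`: in every small neighbourhood `W` of the origin, for small `ε`,
on one side of `ε = 0` there is no ellipnode, on the other side there are exactly two, at each of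
which the complex conjugate branches cross transversely; for `ε = 0` the origin is the only one,
and the complex conjugate branches are tangent there. -/
def BiEllipnodeTransition (F : ℝ → ℝ × ℝ → ℝ) : Prop :=
  ∃ σ : ℝ, (σ = 1 ∨ σ = -1) ∧ ∃ U ∈ 𝓝 (0 : ℝ × ℝ), ∀ W ∈ 𝓝 (0 : ℝ × ℝ), W ⊆ U →
    ∀ᶠ ε in 𝓝 (0 : ℝ),
      (σ * ε < 0 → {q ∈ W | IsEllipnode (F ε) q} = ∅) ∧
      (ε = 0 → {q ∈ W | IsEllipnode (F ε) q} = {0} ∧ ConjBranchesTangentAt (F ε) 0) ∧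
      (0 < σ * ε → ∃ q₁ q₂, q₁ ≠ q₂ ∧ {q ∈ W | IsEllipnode (F ε) q} = {q₁, q₂} ∧
        ConjBranchesTransverseAt (F ε) q₁ ∧ ConjBranchesTransverseAt (F ε) q₂)

/-- In the family, a hyperbonode `h ε` (transverse crossing of the two branches) and a simple
biflecnode `b ε` of the branch `s`, both unique near the origin and moving smoothly with `ε`,
overlap at the origin at `ε = 0`. -/
def HyperbonodeBiflecnodeOverlap (F : ℝ → ℝ × ℝ → ℝ) (s : ℝ) (h b : ℝ → ℝ × ℝ) : Prop :=
  (∀ᶠ ε in 𝓝 (0 : ℝ), ContDiffAt ℝ ∞ h ε) ∧ (∀ᶠ ε in 𝓝 (0 : ℝ), ContDiffAt ℝ ∞ b ε) ∧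
  h 0 = 0 ∧ b 0 = 0 ∧
  ∃ U ∈ 𝓝 (0 : ℝ × ℝ), ∀ᶠ ε in 𝓝 (0 : ℝ),
    (∀ q ∈ U, q ∈ leftBranch (F ε) → ∃ T, IsSmoothCurveAt (leftBranch (F ε)) q T) ∧
    (∀ q ∈ U, q ∈ rightBranch (F ε) → ∃ T, IsSmoothCurveAt (rightBranch (F ε)) q T) ∧
    {q ∈ U | IsHyperbonode (F ε) q} = {h ε} ∧
    TransverseAt (leftBranch (F ε)) (rightBranch (F ε)) (h ε) ∧
    {q ∈ U | q ∈ biflecnodes s (F ε)} = {b ε} ∧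
    b ε ∈ simpleBiflecnodes s (F ε)

/-- At `ε = 0` the moving point `b ε` crosses, with nonzero speed, the branch `s` of the flecnodal
curve: for a smooth family `g ε = 0` of regular local equations of that branch, `g ε (b ε)` changes
sign at `ε = 0`, with nonzero derivative. -/
def CrossesBranch (F : ℝ → ℝ × ℝ → ℝ) (s : ℝ) (b : ℝ → ℝ × ℝ) : Prop :=
  ∃ g : ℝ → ℝ × ℝ → ℝ, SmoothFamily g ∧ fderiv ℝ (g 0) 0 ≠ 0 ∧
    (∀ᶠ r in 𝓝 (0 : ℝ × (ℝ × ℝ)), r.2 ∈ branch s (F r.1) ↔ g r.1 r.2 = 0) ∧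
    g 0 (b 0) = 0 ∧ deriv (fun ε => g ε (b ε)) 0 ≠ 0

end Flecnodal

namespace Flecnodal

section Smooth

variable {𝕜 : Type*} [RCLike 𝕜] {E : Type*} [NormedAddCommGroup E] [NormedSpace 𝕜 E]

/-- `f` is smooth in a neighbourhood of `x`. -/
def SmoothNear (f : E → 𝕜) (x : E) : Prop := ∀ᶠ y in 𝓝 x, ContDiffAt 𝕜 ∞ f y

/-- The derivative of `f` along the constant vector field `v`. -/
noncomputable def lineD (v : E) (f : E → 𝕜) : E → 𝕜 := fun s => fderiv 𝕜 f s v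

variable {f g : E → 𝕜} {x v w : E}

theorem SmoothNear.contDiffAt (hf : SmoothNear f x) : ContDiffAt 𝕜 ∞ f x := hf.self_of_nhds

theorem SmoothNear.differentiableAt (hf : SmoothNear f x) : DifferentiableAt 𝕜 f x :=
  hf.contDiffAt.differentiableAt (by simp)

theorem SmoothNear.continuousAt (hf : SmoothNear f x) : ContinuousAt f x :=
  hf.contDiffAt.continuousAt

theorem SmoothNear.eventually_differentiableAt (hf : SmoothNear f x) :
    ∀ᶠ y in 𝓝 x, DifferentiableAt 𝕜 f y :=
  hf.mono fun _ h => h.differentiableAt (by simp)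

theorem SmoothNear.eventually (hf : SmoothNear f x) : ∀ᶠ y in 𝓝 x, SmoothNear f y :=
  eventually_eventually_nhds.2 hf

theorem SmoothNear.congr (hf : SmoothNear f x) (h : f =ᶠ[𝓝 x] g) : SmoothNear g x := by
  filter_upwards [hf, h.eventuallyEq_nhds] with y hy h'
  exact hy.congr_of_eventuallyEq h'.symm

theorem SmoothNear.const (c : 𝕜) : SmoothNear (fun _ : E => c) x :=
  Eventually.of_forall fun _ => contDiffAt_const

theorem SmoothNear.add (hf : SmoothNear f x) (hg : SmoothNear g x) :
    SmoothNear (fun s => f s + g s) x := by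
  filter_upwards [hf, hg] with y hy h'; exact hy.add h'

theorem SmoothNear.sub (hf : SmoothNear f x) (hg : SmoothNear g x) :
    SmoothNear (fun s => f s - g s) x := by
  filter_upwards [hf, hg] with y hy h'; exact hy.sub h'

theorem SmoothNear.mul (hf : SmoothNear f x) (hg : SmoothNear g x) :
    SmoothNear (fun s => f s * g s) x := by
  filter_upwards [hf, hg] with y hy h'; exact hy.mul h'

theorem SmoothNear.neg (hf : SmoothNear f x) : SmoothNear (fun s => -f s) x := by
  filter_upwards [hf] with y hy; exact hy.neg

theorem SmoothNear.pow (hf : SmoothNear f x) (n : ℕ) : SmoothNear (fun s => f s ^ n) x := by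
  filter_upwards [hf] with y hy; exact hy.pow n

theorem SmoothNear.div (hf : SmoothNear f x) (hg : SmoothNear g x) (h0 : g x ≠ 0) :
    SmoothNear (fun s => f s / g s) x := by
  filter_upwards [hf, hg, hg.continuousAt.eventually_ne h0] with y hy h' h0
  exact hy.div h' h0

theorem SmoothNear.lineD (hf : SmoothNear f x) (v : E) : SmoothNear (lineD v f) x := by
  filter_upwards [hf] with y hy
  exact (hy.fderiv_right (m := ∞) (by simp)).clm_apply contDiffAt_const

theorem lineD_congr (v : E) (h : f =ᶠ[𝓝 x] g) : lineD v f =ᶠ[𝓝 x] lineD v g := by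
  filter_upwards [h.eventuallyEq_nhds] with y hy
  simp only [lineD, hy.fderiv_eq]

theorem SmoothNear.lineD_comm (hf : SmoothNear f x) (v w : E) :
    Flecnodal.lineD v (Flecnodal.lineD w f) =ᶠ[𝓝 x] Flecnodal.lineD w (Flecnodal.lineD v f) := by
  filter_upwards [hf] with y hy
  have hd : DifferentiableAt 𝕜 (fderiv 𝕜 f) y :=
    (hy.fderiv_right (m := 1) (by norm_cast)).differentiableAt (by simp)
  have key : ∀ a b : E, Flecnodal.lineD a (Flecnodal.lineD b f) y
      = fderiv 𝕜 (fderiv 𝕜 f) y a b := by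
    intro a b
    change fderiv 𝕜 (fun z => fderiv 𝕜 f z b) y a = _
    rw [fderiv_clm_apply hd (differentiableAt_const b)]
    simp
  rw [key, key]
  exact (hy.isSymmSndFDerivAt (by simpa using by norm_cast)).eq v w

theorem SmoothNear.lineD_iterate (hf : SmoothNear f x) (v : E) (n : ℕ) :
    SmoothNear ((Flecnodal.lineD v)^[n] f) x := by
  induction n with
  | zero => exact hf
  | succ n ih => rw [Function.iterate_succ_apply']; exact ih.lineD v

theorem SmoothNear.lineD_comm_iterate (hf : SmoothNear f x) (v w : E) (n : ℕ) :
    Flecnodal.lineD w ((Flecnodal.lineD v)^[n] f)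
      =ᶠ[𝓝 x] (Flecnodal.lineD v)^[n] (Flecnodal.lineD w f) := by
  induction n with
  | zero => rfl
  | succ n ih =>
    rw [Function.iterate_succ_apply', Function.iterate_succ_apply']
    exact ((hf.lineD_iterate v n).lineD_comm w v).trans (lineD_congr v ih)

theorem lineD_iterate_congr (v : E) (n : ℕ) (h : f =ᶠ[𝓝 x] g) :
    (lineD v)^[n] f =ᶠ[𝓝 x] (lineD v)^[n] g := by
  induction n with
  | zero => exact h
  | succ n ih =>
    rw [Function.iterate_succ_apply', Function.iterate_succ_apply']
    exact lineD_congr v ih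

theorem lineD_add_dir (v w : E) (f : E → 𝕜) (s : E) :
    lineD (v + w) f s = lineD v f s + lineD w f s := by simp [lineD]

theorem lineD_smul_dir (c : 𝕜) (v : E) (f : E → 𝕜) (s : E) :
    lineD (c • v) f s = c * lineD v f s := by simp [lineD]

theorem lineD_const (v : E) (c : 𝕜) (s : E) : lineD v (fun _ => c) s = 0 := by
  simp [lineD]

theorem lineD_add (v : E) (hf : DifferentiableAt 𝕜 f x) (hg : DifferentiableAt 𝕜 g x) :
    lineD v (fun s => f s + g s) x = lineD v f x + lineD v g x := by
  simp only [lineD]; rw [fderiv_fun_add hf hg]; simp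

theorem lineD_sub (v : E) (hf : DifferentiableAt 𝕜 f x) (hg : DifferentiableAt 𝕜 g x) :
    lineD v (fun s => f s - g s) x = lineD v f x - lineD v g x := by
  simp only [lineD]; rw [fderiv_fun_sub hf hg]; simp

theorem lineD_neg (v : E) : lineD v (fun s => -f s) x = -lineD v f x := by
  simp only [lineD]; rw [fderiv_fun_neg]; simp

theorem lineD_mul (v : E) (hf : DifferentiableAt 𝕜 f x) (hg : DifferentiableAt 𝕜 g x) :
    lineD v (fun s => f s * g s) x = lineD v f x * g x + f x * lineD v g x := by
  simp only [lineD]; rw [fderiv_fun_mul hf hg]; simp; ring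

theorem lineD_lineD_mul (v w : E) (hf : SmoothNear f x) (hg : SmoothNear g x) :
    lineD w (lineD v (fun s => f s * g s)) x =
      lineD w (lineD v f) x * g x + lineD v f x * lineD w g x
        + lineD w f x * lineD v g x + f x * lineD w (lineD v g) x := by
  have h : lineD v (fun s => f s * g s) =ᶠ[𝓝 x]
      fun s => lineD v f s * g s + f s * lineD v g s := by
    filter_upwards [hf.eventually_differentiableAt, hg.eventually_differentiableAt] with y h1 h2
    exact lineD_mul v h1 h2
  rw [(lineD_congr w h).eq_of_nhds,
    lineD_add w ((hf.lineD v).mul hg).differentiableAt (hf.mul (hg.lineD v)).differentiableAt,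
    lineD_mul w (hf.lineD v).differentiableAt hg.differentiableAt,
    lineD_mul w hf.differentiableAt (hg.lineD v).differentiableAt]
  ring

theorem lineD_lineD_add (v w : E) (hf : SmoothNear f x) (hg : SmoothNear g x) :
    lineD w (lineD v (fun s => f s + g s)) x =
      lineD w (lineD v f) x + lineD w (lineD v g) x := by
  have h : lineD v (fun s => f s + g s) =ᶠ[𝓝 x] fun s => lineD v f s + lineD v g s := by
    filter_upwards [hf.eventually_differentiableAt, hg.eventually_differentiableAt] with y h1 h2
    exact lineD_add v h1 h2
  rw [(lineD_congr w h).eq_of_nhds,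
    lineD_add w (hf.lineD v).differentiableAt (hg.lineD v).differentiableAt]

end Smooth

section Families

variable {𝕜 : Type*} [RCLike 𝕜]

theorem fderiv_slice {H : 𝕜 × (𝕜 × 𝕜) → 𝕜} {s : 𝕜 × (𝕜 × 𝕜)} (h : DifferentiableAt 𝕜 H s)
    (v : 𝕜 × 𝕜) : fderiv 𝕜 (fun q => H (s.1, q)) s.2 v = lineD (0, v) H s := by
  have h1 : HasFDerivAt (fun q : 𝕜 × 𝕜 => (s.1, q)) (ContinuousLinearMap.inr 𝕜 𝕜 (𝕜 × 𝕜)) s.2 :=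
    hasFDerivAt_prodMk_right s.1 s.2
  have h2 : HasFDerivAt H (fderiv 𝕜 H s) (s.1, s.2) := h.hasFDerivAt
  have h3 : HasFDerivAt (fun q => H (s.1, q)) _ s.2 := h2.comp s.2 h1
  rw [h3.fderiv]
  simp [lineD]

theorem SmoothNear.slice {H : 𝕜 × (𝕜 × 𝕜) → 𝕜} {s : 𝕜 × (𝕜 × 𝕜)} (h : SmoothNear H s) :
    SmoothNear (fun q => H (s.1, q)) s.2 := by
  have : Tendsto (fun q : 𝕜 × 𝕜 => (s.1, q)) (𝓝 s.2) (𝓝 s) :=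
    (Continuous.prodMk_right s.1).tendsto' _ _ rfl
  filter_upwards [this.eventually h] with q hq
  exact ContDiffAt.comp (g := H) q hq (contDiffAt_const.prodMk contDiffAt_id)

theorem eventually_slice_eq {F : 𝕜 → 𝕜 × 𝕜 → 𝕜} {H : 𝕜 × (𝕜 × 𝕜) → 𝕜} {s : 𝕜 × (𝕜 × 𝕜)}
    (h : ∀ᶠ r in 𝓝 s, F r.1 r.2 = H r) : F s.1 =ᶠ[𝓝 s.2] fun q => H (s.1, q) := by
  have : Tendsto (fun q : 𝕜 × 𝕜 => (s.1, q)) (𝓝 s.2) (𝓝 s) :=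
    (Continuous.prodMk_right s.1).tendsto' _ _ rfl
  exact this.eventually h

theorem eventually_slice_fderiv {F : 𝕜 → 𝕜 × 𝕜 → 𝕜} {H : 𝕜 × (𝕜 × 𝕜) → 𝕜} {s : 𝕜 × (𝕜 × 𝕜)}
    (hH : SmoothNear H s) (h : ∀ᶠ r in 𝓝 s, F r.1 r.2 = H r) (v : 𝕜 × 𝕜) :
    ∀ᶠ r in 𝓝 s, fderiv 𝕜 (F r.1) r.2 v = lineD (0, v) H r := by
  filter_upwards [hH.eventually_differentiableAt, eventually_eventually_nhds.2 h] with r h1 h2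
  rw [(eventually_slice_eq h2).fderiv_eq, fderiv_slice h1]

/-- The partial derivatives of a function of `(ε, (x, y))` in `x` and `y`. -/
noncomputable def ptl (i j : ℕ) (H : 𝕜 × (𝕜 × 𝕜) → 𝕜) : 𝕜 × (𝕜 × 𝕜) → 𝕜 :=
  (lineD (0, (1, 0)))^[i] ((lineD (0, (0, 1)))^[j] H)

variable {H : 𝕜 × (𝕜 × 𝕜) → 𝕜} {s : 𝕜 × (𝕜 × 𝕜)}

theorem SmoothNear.ptl (hH : SmoothNear H s) (i j : ℕ) : SmoothNear (ptl i j H) s :=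
  (hH.lineD_iterate _ j).lineD_iterate _ i

theorem eventually_pd_eq_ptl {F : 𝕜 → 𝕜 × 𝕜 → 𝕜} (hH : SmoothNear H s)
    (h : ∀ᶠ r in 𝓝 s, F r.1 r.2 = H r) (i j : ℕ) :
    ∀ᶠ r in 𝓝 s, pd i j (F r.1) r.2 = ptl i j H r := by
  have hj : ∀ j, ∀ᶠ r in 𝓝 s, dY^[j] (F r.1) r.2 = (lineD (0, (0, 1)))^[j] H r := by
    intro j
    induction j with
    | zero => exact h
    | succ j ih =>
      simp only [Function.iterate_succ_apply']
      exact eventually_slice_fderiv (F := fun ε => dY^[j] (F ε)) (hH.lineD_iterate _ j) ih (0, 1)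
  induction i with
  | zero => exact hj j
  | succ i ih =>
    simp only [pd, Flecnodal.ptl, Function.iterate_succ_apply'] at ih ⊢
    exact eventually_slice_fderiv (F := fun ε => dX^[i] (dY^[j] (F ε))) (hH.ptl i j) ih (1, 0)

theorem lineD_x_ptl (i j : ℕ) (H : 𝕜 × (𝕜 × 𝕜) → 𝕜) :
    lineD (0, (1, 0)) (ptl i j H) = ptl (i + 1) j H := by
  simp only [ptl, Function.iterate_succ_apply']

theorem SmoothNear.lineD_y_ptl (hH : SmoothNear H s) (i j : ℕ) :
    Flecnodal.lineD (0, (0, 1)) (Flecnodal.ptl i j H) =ᶠ[𝓝 s] Flecnodal.ptl i (j + 1) H := by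
  simp only [Flecnodal.ptl, Function.iterate_succ_apply']
  exact (hH.lineD_iterate _ j).lineD_comm_iterate _ _ i

theorem SmoothNear.lineD_ptl (hH : SmoothNear H s) (v : 𝕜 × (𝕜 × 𝕜)) (i j : ℕ) :
    Flecnodal.lineD v (Flecnodal.ptl i j H) =ᶠ[𝓝 s] Flecnodal.ptl i j (Flecnodal.lineD v H) := by
  refine ((hH.lineD_iterate _ j).lineD_comm_iterate _ v i).trans ?_
  exact lineD_iterate_congr _ i (hH.lineD_comm_iterate _ v j)

theorem lineD_decomp (a b : 𝕜) (f : 𝕜 × (𝕜 × 𝕜) → 𝕜) (s : 𝕜 × (𝕜 × 𝕜)) :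
    lineD (0, (a, b)) f s = a * lineD (0, (1, 0)) f s + b * lineD (0, (0, 1)) f s := by
  rw [← lineD_smul_dir, ← lineD_smul_dir, ← lineD_add_dir]
  congr 1; simp

end Families

section RealFamilies

variable {F : ℝ → ℝ × ℝ → ℝ}

theorem SmoothFamily.smoothNear (hF : SmoothFamily F) :
    SmoothNear (fun s : ℝ × (ℝ × ℝ) => F s.1 s.2) 0 := hF

theorem SmoothGerm.smoothFamily {f : ℝ × ℝ → ℝ} (hf : SmoothGerm f) :
    SmoothFamily (fun _ => f) := by
  have : Tendsto (fun s : ℝ × (ℝ × ℝ) => s.2) (𝓝 0) (𝓝 0) := continuous_snd.tendsto' _ _ rfl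
  filter_upwards [this.eventually hf] with s hs
  exact ContDiffAt.comp (g := f) s hs contDiffAt_snd

/-- The partial derivatives of a family as functions of `(ε, (x, y))`. -/
noncomputable def famPd (F : ℝ → ℝ × ℝ → ℝ) (i j : ℕ) : ℝ × (ℝ × ℝ) → ℝ :=
  fun s => pd i j (F s.1) s.2

theorem SmoothFamily.famPd_eq (hF : SmoothFamily F) (i j : ℕ) :
    famPd F i j =ᶠ[𝓝 0] ptl i j (fun s => F s.1 s.2) :=
  eventually_pd_eq_ptl hF.smoothNear (Eventually.of_forall fun _ => rfl) i j

theorem SmoothFamily.smoothNear_famPd (hF : SmoothFamily F) (i j : ℕ) :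
    SmoothNear (famPd F i j) 0 :=
  (hF.smoothNear.ptl i j).congr (hF.famPd_eq i j).symm

theorem SmoothFamily.lineD_x (hF : SmoothFamily F) (i j : ℕ) :
    lineD (0, (1, 0)) (famPd F i j) =ᶠ[𝓝 0] famPd F (i + 1) j := by
  refine (lineD_congr _ (hF.famPd_eq i j)).trans ?_
  rw [lineD_x_ptl]; exact (hF.famPd_eq _ _).symm

theorem SmoothFamily.lineD_y (hF : SmoothFamily F) (i j : ℕ) :
    lineD (0, (0, 1)) (famPd F i j) =ᶠ[𝓝 0] famPd F i (j + 1) :=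
  ((lineD_congr _ (hF.famPd_eq i j)).trans (hF.smoothNear.lineD_y_ptl i j)).trans
    (hF.famPd_eq _ _).symm

theorem SmoothFamily.lineD_eps (hF : SmoothFamily F) (i j : ℕ) :
    lineD (1, 0) (famPd F i j) 0 = pd i j (velocity F) 0 := by
  have hD := hF.smoothNear.lineD ((1, 0) : ℝ × (ℝ × ℝ))
  have h1 := ((lineD_congr (1, 0) (hF.famPd_eq i j)).trans
    (hF.smoothNear.lineD_ptl (1, 0) i j)).eq_of_nhds
  rw [h1]
  have h2 : ∀ᶠ r in 𝓝 (0 : ℝ × (ℝ × ℝ)), velocity F r.2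
      = lineD (1, 0) (fun s : ℝ × (ℝ × ℝ) => F s.1 s.2) (0, r.2) := by
    have : Tendsto (fun s : ℝ × (ℝ × ℝ) => ((0 : ℝ), s.2)) (𝓝 0) (𝓝 0) :=
      (by fun_prop : Continuous fun s : ℝ × (ℝ × ℝ) => ((0 : ℝ), s.2)).tendsto' _ _ rfl
    filter_upwards [this.eventually hF.smoothNear.eventually_differentiableAt] with r hr
    have h1 : HasFDerivAt (fun ε : ℝ => (ε, r.2)) (ContinuousLinearMap.inl ℝ ℝ (ℝ × ℝ)) 0 :=
      hasFDerivAt_prodMk_left 0 r.2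
    have h3 : HasFDerivAt (fun ε => F ε r.2) _ 0 :=
      HasFDerivAt.comp (g := fun s : ℝ × (ℝ × ℝ) => F s.1 s.2) 0 hr.hasFDerivAt h1
    simp only [velocity]
    rw [h3.hasDerivAt.deriv]
    simp [lineD]
  have h3 : velocity F =ᶠ[𝓝 0]
      (fun ε q => lineD (1, 0) (fun s : ℝ × (ℝ × ℝ) => F s.1 s.2) (ε, q)) 0 := by
    have : Tendsto (fun q : ℝ × ℝ => ((0 : ℝ), q)) (𝓝 0) (𝓝 0) :=
      (Continuous.prodMk_right (0 : ℝ)).tendsto' _ _ rfl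
    filter_upwards [this.eventually h2] with q hq using hq
  have h4 := (eventually_pd_eq_ptl (F := fun ε q =>
    lineD (1, 0) (fun s : ℝ × (ℝ × ℝ) => F s.1 s.2) (ε, q)) hD
    (Eventually.of_forall fun _ => rfl) i j).self_of_nhds
  rw [← h4]
  have congr_dY : ∀ (j : ℕ) (a b : ℝ × ℝ → ℝ), a =ᶠ[𝓝 0] b → dY^[j] a =ᶠ[𝓝 0] dY^[j] b :=
    fun j a b h => lineD_iterate_congr (0, 1) j h
  have congr_dX : ∀ (j : ℕ) (a b : ℝ × ℝ → ℝ), a =ᶠ[𝓝 0] b → dX^[j] a =ᶠ[𝓝 0] dX^[j] b :=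
    fun j a b h => lineD_iterate_congr (1, 0) j h
  exact (congr_dX i _ _ (congr_dY j _ _ h3)).symm.eq_of_nhds

end RealFamilies

section Implicit

theorem isInvertible_of_det_ne_zero (L : ℝ × ℝ →L[ℝ] ℝ × ℝ)
    (h : (L (1, 0)).1 * (L (0, 1)).2 - (L (0, 1)).1 * (L (1, 0)).2 ≠ 0) : L.IsInvertible := by
  set a := (L (1, 0)).1 with ha
  set c := (L (1, 0)).2 with hc
  set b := (L (0, 1)).1 with hb
  set d := (L (0, 1)).2 with hd
  have hL : ∀ x y : ℝ, L (x, y) = (a * x + b * y, c * x + d * y) := by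
    intro x y
    have : ((x, y) : ℝ × ℝ) = x • (1, 0) + y • (0, 1) := by simp
    rw [this, map_add, map_smul, map_smul]
    ext <;> simp [ha, hb, hc, hd] <;> ring
  let M : ℝ × ℝ →L[ℝ] ℝ × ℝ := (a * d - b * c)⁻¹ •
    (d • ContinuousLinearMap.fst ℝ ℝ ℝ - b • ContinuousLinearMap.snd ℝ ℝ ℝ).prod
      (a • ContinuousLinearMap.snd ℝ ℝ ℝ - c • ContinuousLinearMap.fst ℝ ℝ ℝ)
  have hM : ∀ x y : ℝ, M (x, y)
      = ((a * d - b * c)⁻¹ * (d * x - b * y), (a * d - b * c)⁻¹ * (a * y - c * x)) := by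
    intro x y; simp [M]
  have hi : (a * d - b * c)⁻¹ * (a * d - b * c) = 1 := inv_mul_cancel₀ h
  refine ⟨ContinuousLinearEquiv.equivOfInverse L M ?_ ?_, rfl⟩
  · rintro ⟨x, y⟩
    rw [hL, hM]
    exact Prod.ext (by linear_combination x * hi) (by linear_combination y * hi)
  · rintro ⟨x, y⟩
    rw [hM, hL]
    exact Prod.ext (by linear_combination x * hi) (by linear_combination y * hi)

variable {H₁ H₂ : ℝ × (ℝ × ℝ) → ℝ}

/-- Jacobian determinant of `(H₁, H₂)` in the last two variables. -/
noncomputable def jac (H₁ H₂ : ℝ × (ℝ × ℝ) → ℝ) (s : ℝ × (ℝ × ℝ)) : ℝ :=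
  lineD (0, (1, 0)) H₁ s * lineD (0, (0, 1)) H₂ s
    - lineD (0, (0, 1)) H₁ s * lineD (0, (1, 0)) H₂ s

theorem SmoothNear.jac {s : ℝ × (ℝ × ℝ)} (h₁ : SmoothNear H₁ s) (h₂ : SmoothNear H₂ s) :
    SmoothNear (jac H₁ H₂) s :=
  ((h₁.lineD _).mul (h₂.lineD _)).sub ((h₁.lineD _).mul (h₂.lineD _))

theorem isInvertible_of_jac_ne_zero {s : ℝ × (ℝ × ℝ)} (h₁ : DifferentiableAt ℝ H₁ s)
    (h₂ : DifferentiableAt ℝ H₂ s) (hJ : jac H₁ H₂ s ≠ 0) :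
    (fderiv ℝ (fun r => (H₁ r, H₂ r)) s ∘L .inr ℝ ℝ (ℝ × ℝ)).IsInvertible := by
  apply isInvertible_of_det_ne_zero
  rw [DifferentiableAt.fderiv_prodMk h₁ h₂]
  simpa [jac, lineD] using hJ

theorem exists_implicit (h₁ : SmoothNear H₁ 0) (h₂ : SmoothNear H₂ 0) (z₁ : H₁ 0 = 0)
    (z₂ : H₂ 0 = 0) (hJ : jac H₁ H₂ 0 ≠ 0) :
    ∃ ψ : ℝ → ℝ × ℝ, (∀ᶠ t in 𝓝 (0 : ℝ), ContDiffAt ℝ ∞ ψ t) ∧ ψ 0 = 0 ∧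
      ∀ᶠ v in 𝓝 (0 : ℝ × (ℝ × ℝ)), (H₁ v = 0 ∧ H₂ v = 0) ↔ v.2 = ψ v.1 := by
  have hsm : ∀ s, SmoothNear H₁ s → SmoothNear H₂ s →
      ContDiffAt ℝ ∞ (fun r => (H₁ r, H₂ r)) s :=
    fun s a b => a.contDiffAt.prodMk b.contDiffAt
  have hne : (∞ : WithTop ℕ∞) ≠ 0 := by simp
  set f := fun r => (H₁ r, H₂ r) with hf
  have hinv : ∀ s, SmoothNear H₁ s → SmoothNear H₂ s → jac H₁ H₂ s ≠ 0 →
      (fderiv ℝ f s ∘L .inr ℝ ℝ (ℝ × ℝ)).IsInvertible :=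
    fun s a b hj => isInvertible_of_jac_ne_zero a.differentiableAt b.differentiableAt hj
  set ψ := (hsm 0 h₁ h₂).implicitFunction hne (hinv 0 h₁ h₂ hJ) with hψ
  have hψ0 : ψ 0 = 0 := (hsm 0 h₁ h₂).implicitFunction_apply_self hne (hinv 0 h₁ h₂ hJ)
  have hf0 : f 0 = 0 := by simp [hf, z₁, z₂]
  have hiff : ∀ᶠ v in 𝓝 (0 : ℝ × (ℝ × ℝ)), f v = f 0 ↔ ψ v.1 = v.2 :=
    (hsm 0 h₁ h₂).eventually_apply_eq_iff_implicitFunction hne (hinv 0 h₁ h₂ hJ)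
  have hval : ∀ᶠ t in 𝓝 (0 : ℝ), f (t, ψ t) = f 0 :=
    (hsm 0 h₁ h₂).eventually_apply_implicitFunction hne (hinv 0 h₁ h₂ hJ)
  have hcd : ContDiffAt ℝ ∞ ψ 0 :=
    (hsm 0 h₁ h₂).contDiffAt_implicitFunction hne (hinv 0 h₁ h₂ hJ)
  have hcont : ∀ᶠ t in 𝓝 (0 : ℝ), ContinuousAt ψ t :=
    ((hcd.of_le (m := 1) (by norm_cast)).eventually (by simp)).mono fun t ht => ht.continuousAt
  have htend : Tendsto (fun t => (t, ψ t)) (𝓝 0) (𝓝 (0 : ℝ × (ℝ × ℝ))) := by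
    have : ContinuousAt (fun t => (t, ψ t)) 0 := continuousAt_id.prodMk hcd.continuousAt
    have h := this.tendsto
    simp only [hψ0] at h
    exact h
  have hloc : ∀ᶠ t in 𝓝 (0 : ℝ), SmoothNear H₁ (t, ψ t) ∧ SmoothNear H₂ (t, ψ t) ∧
      jac H₁ H₂ (t, ψ t) ≠ 0 :=
    htend.eventually (h₁.eventually.and (h₂.eventually.and
      ((h₁.jac h₂).continuousAt.eventually_ne hJ)))
  refine ⟨ψ, ?_, hψ0, ?_⟩
  · filter_upwards [hval.eventually_nhds, hcont, hloc] with t hv hc ⟨a, b, hj⟩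
    refine ((hsm _ a b).contDiffAt_implicitFunction hne (hinv _ a b hj)).congr_of_eventuallyEq ?_
    have e1 := (hsm _ a b).eventually_apply_eq_iff_implicitFunction hne (hinv _ a b hj)
    have e2 : Tendsto (fun τ => (τ, ψ τ)) (𝓝 t) (𝓝 (t, ψ t)) := continuousAt_id.prodMk hc
    filter_upwards [e2.eventually e1, hv] with τ h1 h2
    exact (h1.1 (h2.trans hv.self_of_nhds.symm)).symm
  · filter_upwards [hiff] with v hv
    rw [hf0] at hv
    simpa [hf, Prod.ext_iff, eq_comm] using hv

end Implicit

section Curves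

variable {𝕜 : Type*} [RCLike 𝕜]

theorem eventually_slice {H : 𝕜 × (𝕜 × 𝕜) → Prop} {s : 𝕜 × (𝕜 × 𝕜)} (h : ∀ᶠ r in 𝓝 s, H r) :
    ∀ᶠ q in 𝓝 s.2, H (s.1, q) := by
  have : Tendsto (fun q : 𝕜 × 𝕜 => (s.1, q)) (𝓝 s.2) (𝓝 s) :=
    (Continuous.prodMk_right s.1).tendsto' _ _ rfl
  exact this.eventually h

/-- The zero sets of the members of a smooth family of functions with nonzero gradient are smooth
curves. -/
theorem eventually_isSmoothCurveAt {g : 𝕜 × (𝕜 × 𝕜) → 𝕜} {C : 𝕜 → Set (𝕜 × 𝕜)}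
    (hg : SmoothNear g 0) (hC : ∀ᶠ s in 𝓝 (0 : 𝕜 × (𝕜 × 𝕜)), s.2 ∈ C s.1 ↔ g s = 0)
    (hne : lineD (0, (1, 0)) g 0 ≠ 0 ∨ lineD (0, (0, 1)) g 0 ≠ 0) :
    ∀ᶠ s in 𝓝 (0 : 𝕜 × (𝕜 × 𝕜)), s.2 ∈ C s.1 →
      IsSmoothCurveAt (C s.1) s.2
        (LinearMap.ker (fderiv 𝕜 (fun q => g (s.1, q)) s.2).toLinearMap) := by
  have hne' : ∀ᶠ s in 𝓝 (0 : 𝕜 × (𝕜 × 𝕜)),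
      lineD (0, (1, 0)) g s ≠ 0 ∨ lineD (0, (0, 1)) g s ≠ 0 := by
    rcases hne with h | h
    · exact ((hg.lineD _).continuousAt.eventually_ne h).mono fun _ h => Or.inl h
    · exact ((hg.lineD _).continuousAt.eventually_ne h).mono fun _ h => Or.inr h
  filter_upwards [hg.eventually, eventually_eventually_nhds.2 hC, hne'] with s h1 h2 h3 hs
  refine ⟨fun q => g (s.1, q), h1.slice, h2.self_of_nhds.1 hs, fun h0 => ?_,
    eventually_slice h2, rfl⟩
  rw [← fderiv_slice h1.differentiableAt, ← fderiv_slice h1.differentiableAt, h0] at h3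
  simp at h3

theorem linearMap_apply_pair (L : 𝕜 × 𝕜 →ₗ[𝕜] 𝕜) (x y : 𝕜) :
    L (x, y) = x * L (1, 0) + y * L (0, 1) := by
  have : ((x, y) : 𝕜 × 𝕜) = x • (1, 0) + y • (0, 1) := by simp
  rw [this, map_add, map_smul, map_smul]; simp

theorem ker_eq_of_det_eq_zero {A B : 𝕜 × 𝕜 →ₗ[𝕜] 𝕜} (hA : A (1, 0) ≠ 0 ∨ A (0, 1) ≠ 0)
    (hB : B (1, 0) ≠ 0 ∨ B (0, 1) ≠ 0) (h : A (1, 0) * B (0, 1) = A (0, 1) * B (1, 0)) :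
    LinearMap.ker A = LinearMap.ker B := by
  have aux : ∀ a b c d x y : 𝕜, (a ≠ 0 ∨ b ≠ 0) → a * d = b * c → x * a + y * b = 0 →
      x * c + y * d = 0 := by
    intro a b c d x y hab hd h0
    rcases hab with ha | hb
    · have : a * (x * c + y * d) = 0 := by linear_combination c * h0 + y * hd
      exact (mul_eq_zero.1 this).resolve_left ha
    · have : b * (x * c + y * d) = 0 := by linear_combination d * h0 - x * hd
      exact (mul_eq_zero.1 this).resolve_left hb
  ext ⟨x, y⟩
  simp only [LinearMap.mem_ker]
  rw [linearMap_apply_pair A, linearMap_apply_pair B]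
  exact ⟨aux _ _ _ _ x y hA h, aux _ _ _ _ x y hB (by linear_combination -h)⟩

theorem ker_ne_of_det_ne_zero {A B : 𝕜 × 𝕜 →ₗ[𝕜] 𝕜}
    (h : A (1, 0) * B (0, 1) - A (0, 1) * B (1, 0) ≠ 0) :
    LinearMap.ker A ≠ LinearMap.ker B := by
  intro hk
  have hm : ((A (0, 1), -A (1, 0)) : 𝕜 × 𝕜) ∈ LinearMap.ker A := by
    simp only [LinearMap.mem_ker]
    rw [linearMap_apply_pair]; ring
  rw [hk] at hm
  simp only [LinearMap.mem_ker] at hm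
  rw [linearMap_apply_pair] at hm
  exact h (by linear_combination -hm)

end Curves

section Fold

theorem exists_fold_interval {e m : ℝ → ℝ} {d : ℝ} (hd : 0 < d)
    (he : ∀ᶠ t in 𝓝 (0 : ℝ), HasDerivAt e (m t) t) (hm0 : m 0 = 0) (hm : HasDerivAt m d 0) :
    ∃ δ > 0, ContinuousOn e (Set.Icc (-δ) δ) ∧ StrictAntiOn e (Set.Icc (-δ) 0) ∧
      StrictMonoOn e (Set.Icc 0 δ) := by
  have hsign : ∀ᶠ t in 𝓝[≠] (0 : ℝ), 0 < t⁻¹ * m t := by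
    have := (hasDerivAt_iff_tendsto_slope_zero.1 hm).eventually (lt_mem_nhds hd)
    filter_upwards [this] with t ht
    simpa [hm0] using ht
  rw [eventually_nhdsWithin_iff] at hsign
  obtain ⟨δ, hδ, hball⟩ := Metric.eventually_nhds_iff.1 (he.and hsign)
  have hin : ∀ t, |t| ≤ δ / 2 → HasDerivAt e (m t) t ∧ (t ≠ 0 → 0 < t⁻¹ * m t) := by
    intro t ht
    have := hball (y := t) (by rw [Real.dist_eq, sub_zero]; linarith)
    exact ⟨this.1, this.2⟩
  have hcont : ContinuousOn e (Set.Icc (-(δ / 2)) (δ / 2)) := fun t ht =>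
    (hin t (abs_le.2 ht)).1.continuousAt.continuousWithinAt
  refine ⟨δ / 2, by linarith, hcont, ?_, ?_⟩
  · apply strictAntiOn_of_deriv_neg (convex_Icc _ _)
      (hcont.mono (Set.Icc_subset_Icc le_rfl (by linarith)))
    intro t ht
    rw [interior_Icc] at ht
    have h := hin t (abs_le.2 ⟨ht.1.le, by linarith [ht.2]⟩)
    rw [h.1.deriv]
    have := h.2 ht.2.ne
    rcases pos_and_pos_or_neg_and_neg_of_mul_pos this with h' | h'
    · exact absurd (inv_pos.1 h'.1) (by linarith [ht.2])
    · exact h'.2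
  · apply strictMonoOn_of_deriv_pos (convex_Icc _ _)
      (hcont.mono (Set.Icc_subset_Icc (by linarith) le_rfl))
    intro t ht
    rw [interior_Icc] at ht
    have h := hin t (abs_le.2 ⟨by linarith [ht.1], ht.2.le⟩)
    rw [h.1.deriv]
    have := h.2 ht.1.ne'
    rcases pos_and_pos_or_neg_and_neg_of_mul_pos this with h' | h'
    · exact h'.2
    · exact absurd (inv_lt_zero.1 h'.1) (by linarith [ht.1])

/-- Zeros of a one-parameter family of maps of the plane with a fold at the origin for the parameter
value `0`. -/
def FoldTransition (Z D : ℝ × (ℝ × ℝ) → Prop) : Prop :=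
  ∃ σ : ℝ, (σ = 1 ∨ σ = -1) ∧ ∃ U ∈ 𝓝 (0 : ℝ × ℝ), ∀ W ∈ 𝓝 (0 : ℝ × ℝ), W ⊆ U →
    ∀ᶠ ε in 𝓝 (0 : ℝ),
      (σ * ε < 0 → {q ∈ W | Z (ε, q)} = ∅) ∧
      (ε = 0 → {q ∈ W | Z (ε, q)} = {0}) ∧
      (0 < σ * ε → ∃ q₁ q₂, q₁ ≠ q₂ ∧ {q ∈ W | Z (ε, q)} = {q₁, q₂} ∧ D (ε, q₁) ∧ D (ε, q₂))

theorem foldTransition_of_curve {Z D : ℝ × (ℝ × ℝ) → Prop} {x e m : ℝ → ℝ} {d : ℝ} (hd : d ≠ 0)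
    (hx0 : x 0 = 0) (he0 : e 0 = 0) (hx : ContinuousAt x 0)
    (hZ : ∀ᶠ s in 𝓝 (0 : ℝ × (ℝ × ℝ)), Z s ↔ s.2.1 = x s.2.2 ∧ s.1 = e s.2.2)
    (he : ∀ᶠ t in 𝓝 (0 : ℝ), HasDerivAt e (m t) t) (hm0 : m 0 = 0) (hm : HasDerivAt m d 0)
    (hD : ∀ᶠ t in 𝓝[≠] (0 : ℝ), D (e t, (x t, t))) : FoldTransition Z D := by
  obtain ⟨σ, hσ, hσd⟩ : ∃ σ : ℝ, (σ = 1 ∨ σ = -1) ∧ 0 < σ * d := by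
    rcases lt_or_gt_of_ne hd with h | h
    · exact ⟨-1, Or.inr rfl, by linarith⟩
    · exact ⟨1, Or.inl rfl, by linarith⟩
  have hσ2 : σ * σ = 1 := by rcases hσ with h | h <;> rw [h] <;> norm_num
  set E : ℝ → ℝ := fun t => σ * e t with hE
  obtain ⟨δ, hδ, hcont, hanti, hmono⟩ := exists_fold_interval (e := E) (m := fun t => σ * m t)
    hσd (he.mono fun t ht => ht.const_mul σ) (by simp [hm0]) (hm.const_mul σ)
  have hE0 : E 0 = 0 := by simp [hE, he0]
  have hposl : ∀ t, -δ ≤ t → t < 0 → 0 < E t := fun t h1 h2 => by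
    rw [← hE0]; exact hanti ⟨h1, h2.le⟩ ⟨by linarith, le_rfl⟩ h2
  have hposr : ∀ t, t ≤ δ → 0 < t → 0 < E t := fun t h1 h2 => by
    rw [← hE0]; exact hmono ⟨le_rfl, hδ.le⟩ ⟨h2.le, h1⟩ h2
  have hnn : ∀ t, |t| ≤ δ → 0 ≤ E t := fun t h => by
    rcases lt_trichotomy t 0 with h' | h' | h'
    · exact (hposl t (abs_le.1 h).1 h').le
    · rw [h', hE0]
    · exact (hposr t (abs_le.1 h).2 h').le
  rw [nhds_prod_eq, Prod.zero_eq_mk] at hZ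
  obtain ⟨pa, hpa, pb, hpb, hab⟩ := eventually_prod_iff.1 hZ
  have hsnd : ∀ᶠ q in 𝓝 (0 : ℝ × ℝ), |q.2| ≤ δ := by
    have : Tendsto (fun q : ℝ × ℝ => |q.2|) (𝓝 0) (𝓝 0) :=
      (by fun_prop : Continuous fun q : ℝ × ℝ => |q.2|).tendsto' _ _ (by simp)
    exact (this.eventually (gt_mem_nhds hδ)).mono fun _ h => h.le
  refine ⟨σ, hσ, {q | pb q ∧ |q.2| ≤ δ}, hpb.and hsnd, fun W hW hWU => ?_⟩
  have htend : Tendsto (fun t => (x t, t)) (𝓝 0) (𝓝 (0 : ℝ × ℝ)) := by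
    have : ContinuousAt (fun t => (x t, t)) 0 := hx.prodMk continuousAt_id
    have h := this.tendsto
    simp only [hx0] at h
    exact h
  rw [eventually_nhdsWithin_iff] at hD
  obtain ⟨η, hη, hball⟩ := Metric.eventually_nhds_iff.1 ((htend.eventually hW).and hD)
  set κ := min (η / 2) δ with hκ
  have hκ0 : 0 < κ := lt_min (by linarith) hδ
  have hκδ : κ ≤ δ := min_le_right _ _
  have hκη : κ < η := lt_of_le_of_lt (min_le_left _ _) (by linarith)
  have hin : ∀ t, |t| ≤ κ → (x t, t) ∈ W ∧ (t ≠ 0 → D (e t, (x t, t))) := fun t ht =>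
    hball (y := t) (by rw [Real.dist_eq, sub_zero]; linarith)
  have hlim : ∀ᶠ ε in 𝓝 (0 : ℝ), σ * ε < min (E (-κ)) (E κ) := by
    have : Tendsto (fun ε : ℝ => σ * ε) (𝓝 0) (𝓝 0) :=
      (continuous_const.mul continuous_id).tendsto' _ _ (by simp)
    exact this.eventually (gt_mem_nhds
      (lt_min (hposl _ (by linarith) (by linarith)) (hposr _ hκδ hκ0)))
  have hEe : ∀ t ε : ℝ, ε = e t ↔ E t = σ * ε := by
    intro t ε
    constructor
    · rintro rfl; rfl
    · intro h
      have := congrArg (σ * ·) h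
      simp only [hE, ← mul_assoc, hσ2, one_mul] at this
      exact this.symm
  filter_upwards [hpa, hlim] with ε hε hεlt
  have hset : ∀ q ∈ W, Z (ε, q) ↔ q.1 = x q.2 ∧ E q.2 = σ * ε := fun q hq => by
    rw [hab hε (hWU hq).1, hEe]
  refine ⟨fun hneg => ?_, fun h0 => ?_, fun hpos => ?_⟩
  · ext q
    simp only [Set.mem_ofPred_eq, Set.mem_empty_iff_false, iff_false, not_and]
    intro hq hz
    have := hnn q.2 (hWU hq).2
    rw [((hset q hq).1 hz).2] at this
    linarith
  · ext q
    simp only [Set.mem_ofPred_eq, Set.mem_singleton_iff]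
    constructor
    · rintro ⟨hq, hz⟩
      have h := (hset q hq).1 hz
      rw [h0, mul_zero] at h
      have hq2 : q.2 = 0 := by
        rcases lt_trichotomy q.2 0 with h' | h' | h'
        · exact absurd h.2 (hposl _ (abs_le.1 (hWU hq).2).1 h').ne'
        · exact h'
        · exact absurd h.2 (hposr _ (abs_le.1 (hWU hq).2).2 h').ne'
      exact Prod.ext (by rw [h.1, hq2, hx0]; rfl) hq2
    · rintro rfl
      have hW0 := mem_of_mem_nhds hW
      exact ⟨hW0, (hset 0 hW0).2 ⟨by simp [hx0], by simp [hE0, h0]⟩⟩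
  · obtain ⟨t₁, ht₁, hE₁⟩ : ∃ t ∈ Set.Icc (-κ) 0, E t = σ * ε := by
      have := intermediate_value_Icc' (f := E) (a := -κ) (b := 0) (by linarith)
        (hcont.mono (Set.Icc_subset_Icc (by linarith) hδ.le))
      exact this ⟨by rw [hE0]; exact hpos.le, (hεlt.le.trans (min_le_left _ _))⟩
    obtain ⟨t₂, ht₂, hE₂⟩ : ∃ t ∈ Set.Icc 0 κ, E t = σ * ε := by
      have := intermediate_value_Icc (f := E) (a := 0) (b := κ) hκ0.le
        (hcont.mono (Set.Icc_subset_Icc (by linarith) hκδ))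
      exact this ⟨by rw [hE0]; exact hpos.le, (hεlt.le.trans (min_le_right _ _))⟩
    have hn₁ : t₁ ≠ 0 := by rintro rfl; rw [hE0] at hE₁; linarith
    have hn₂ : t₂ ≠ 0 := by rintro rfl; rw [hE0] at hE₂; linarith
    have hl₁ : t₁ < 0 := lt_of_le_of_ne ht₁.2 hn₁
    have hl₂ : 0 < t₂ := lt_of_le_of_ne ht₂.1 hn₂.symm
    have hi₁ := hin t₁ (abs_le.2 ⟨ht₁.1, by linarith⟩)
    have hi₂ := hin t₂ (abs_le.2 ⟨by linarith, ht₂.2⟩)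
    refine ⟨(x t₁, t₁), (x t₂, t₂), fun h => ?_, ?_, ?_, ?_⟩
    · have := congrArg Prod.snd h
      simp only at this; linarith
    · ext q
      simp only [Set.mem_ofPred_eq, Set.mem_insert_iff, Set.mem_singleton_iff]
      constructor
      · rintro ⟨hq, hz⟩
        have h := (hset q hq).1 hz
        have hb := abs_le.1 (hWU hq).2
        rcases le_total q.2 0 with h' | h'
        · left
          have : q.2 = t₁ := hanti.injOn ⟨hb.1, h'⟩ ⟨by linarith [ht₁.1], hl₁.le⟩
            (h.2.trans hE₁.symm)
          exact Prod.ext (by rw [h.1, this]) this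
        · right
          have : q.2 = t₂ := hmono.injOn ⟨h', hb.2⟩ ⟨hl₂.le, by linarith [ht₂.2]⟩
            (h.2.trans hE₂.symm)
          exact Prod.ext (by rw [h.1, this]) this
      · rintro (rfl | rfl)
        · exact ⟨hi₁.1, (hset _ hi₁.1).2 ⟨rfl, hE₁⟩⟩
        · exact ⟨hi₂.1, (hset _ hi₂.1).2 ⟨rfl, hE₂⟩⟩
    · rw [(hEe t₁ ε).2 hE₁]; exact hi₁.2 hn₁
    · rw [(hEe t₂ ε).2 hE₂]; exact hi₂.2 hn₂

theorem hasDerivAt_comp_curve {H : ℝ × (ℝ × ℝ) → ℝ} {c : ℝ → ℝ × (ℝ × ℝ)} {t e' x' y' : ℝ}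
    (hH : DifferentiableAt ℝ H (c t)) (hc : HasDerivAt c (e', (x', y')) t) :
    HasDerivAt (fun t => H (c t)) (e' * lineD (1, 0) H (c t) + x' * lineD (0, (1, 0)) H (c t)
      + y' * lineD (0, (0, 1)) H (c t)) t := by
  have h := hH.hasFDerivAt.comp_hasDerivAt t hc
  have hdec : ((e', (x', y')) : ℝ × (ℝ × ℝ))
      = e' • (1, 0) + (x' • (0, (1, 0)) + y' • (0, (0, 1))) := by simp
  refine h.congr_deriv ?_
  rw [hdec, map_add, map_add, map_smul, map_smul, map_smul]
  simp only [lineD, smul_eq_mul]; ring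

theorem foldTransition_of_jac {g₁ g₂ : ℝ × (ℝ × ℝ) → ℝ} (h₁ : SmoothNear g₁ 0)
    (h₂ : SmoothNear g₂ 0) (z₁ : g₁ 0 = 0) (z₂ : g₂ 0 = 0) (hJ : jac g₁ g₂ 0 = 0)
    (hx : lineD (0, (1, 0)) g₁ 0 ≠ 0)
    (hR : lineD (1, 0) g₁ 0 * lineD (0, (1, 0)) g₂ 0
      - lineD (0, (1, 0)) g₁ 0 * lineD (1, 0) g₂ 0 ≠ 0)
    (hQ : lineD (0, (-lineD (0, (0, 1)) g₁ 0, lineD (0, (1, 0)) g₁ 0)) (jac g₁ g₂) 0 ≠ 0) :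
    FoldTransition (fun s => g₁ s = 0 ∧ g₂ s = 0) (fun s => jac g₁ g₂ s ≠ 0) := by
  let P : ℝ × (ℝ × ℝ) →L[ℝ] ℝ × (ℝ × ℝ) :=
    ((ContinuousLinearMap.fst ℝ ℝ ℝ).comp (ContinuousLinearMap.snd ℝ ℝ (ℝ × ℝ))).prod
      (((ContinuousLinearMap.snd ℝ ℝ ℝ).comp (ContinuousLinearMap.snd ℝ ℝ (ℝ × ℝ))).prod
        (ContinuousLinearMap.fst ℝ ℝ (ℝ × ℝ)))
  have hP : ∀ y e x, P (y, (e, x)) = (e, (x, y)) := fun _ _ _ => rfl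
  have hPt : Tendsto P (𝓝 0) (𝓝 0) := P.continuous.tendsto' _ _ (map_zero _)
  have hPs : ∀ g : ℝ × (ℝ × ℝ) → ℝ, SmoothNear g 0 → SmoothNear (fun v => g (P v)) 0 := by
    intro g hg
    filter_upwards [hPt.eventually hg] with v hv
    exact ContDiffAt.comp (g := g) v hv P.contDiff.contDiffAt
  have hPl : ∀ (g : ℝ × (ℝ × ℝ) → ℝ) (v : ℝ × (ℝ × ℝ)), SmoothNear g 0 →
      lineD v (fun r => g (P r)) 0 = lineD (P v) g 0 := by
    intro g v hg
    have hd : HasFDerivAt g (fderiv ℝ g 0) (P 0) := by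
      rw [map_zero]; exact hg.differentiableAt.hasFDerivAt
    have : HasFDerivAt (fun r => g (P r)) _ 0 := hd.comp 0 P.hasFDerivAt
    simp only [lineD]
    rw [this.fderiv]; rfl
  obtain ⟨ψ, hψs, hψ0, hψ⟩ := exists_implicit (hPs _ h₁) (hPs _ h₂)
    (by rw [map_zero, z₁]) (by rw [map_zero, z₂]) (by
      unfold jac
      rw [hPl g₁ (0, (1, 0)) h₁, hPl g₂ (0, (1, 0)) h₂, hPl g₁ (0, (0, 1)) h₁,
        hPl g₂ (0, (0, 1)) h₂]
      exact hR)
  set e : ℝ → ℝ := fun t => (ψ t).1 with he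
  set x : ℝ → ℝ := fun t => (ψ t).2 with hxdef
  have hψd : ∀ᶠ t in 𝓝 (0 : ℝ), HasDerivAt ψ (deriv e t, deriv x t) t := by
    filter_upwards [hψs] with t ht
    have hd := ht.differentiableAt (by simp)
    exact (hd.fst.hasDerivAt).prodMk (hd.snd.hasDerivAt)
  set c : ℝ → ℝ × (ℝ × ℝ) := fun t => (e t, (x t, t)) with hc
  have hcd : ∀ᶠ t in 𝓝 (0 : ℝ), HasDerivAt c (deriv e t, (deriv x t, 1)) t := by
    filter_upwards [hψd] with t ht
    exact ht.fst.prodMk (ht.snd.prodMk (hasDerivAt_id t))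
  have hc0 : c 0 = 0 := by simp [hc, he, hxdef, hψ0]
  have hct : Tendsto c (𝓝 0) (𝓝 0) := by
    have := hcd.self_of_nhds.continuousAt.tendsto
    rwa [hc0] at this
  have hflip : ∀ᶠ s in 𝓝 (0 : ℝ × (ℝ × ℝ)),
      (g₁ s = 0 ∧ g₂ s = 0) ↔ s.2.1 = x s.2.2 ∧ s.1 = e s.2.2 := by
    have : Tendsto (fun s : ℝ × (ℝ × ℝ) => (s.2.2, (s.1, s.2.1))) (𝓝 0) (𝓝 0) :=
      (by fun_prop : Continuous fun s : ℝ × (ℝ × ℝ) => (s.2.2, (s.1, s.2.1))).tendsto' _ _ rfl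
    filter_upwards [this.eventually hψ] with s hs
    rw [hP] at hs
    rw [hs, Prod.ext_iff]
    exact and_comm
  have hgc : ∀ᶠ t in 𝓝 (0 : ℝ), g₁ (c t) = 0 ∧ g₂ (c t) = 0 :=
    (hct.eventually hflip).mono fun t ht => ht.2 ⟨rfl, rfl⟩
  set R : ℝ × (ℝ × ℝ) → ℝ := fun s => lineD (1, 0) g₁ s * lineD (0, (1, 0)) g₂ s
      - lineD (0, (1, 0)) g₁ s * lineD (1, 0) g₂ s with hRdef
  have hRs : SmoothNear R 0 := ((h₁.lineD _).mul (h₂.lineD _)).sub ((h₁.lineD _).mul (h₂.lineD _))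
  have hR0 : ∀ᶠ t in 𝓝 (0 : ℝ), R (c t) ≠ 0 := hct.eventually (hRs.continuousAt.eventually_ne hR)
  have hchain : ∀ g, SmoothNear g 0 → (∀ᶠ t in 𝓝 (0 : ℝ), g (c t) = 0) → ∀ᶠ t in 𝓝 (0 : ℝ),
      deriv e t * lineD (1, 0) g (c t) + deriv x t * lineD (0, (1, 0)) g (c t)
        + 1 * lineD (0, (0, 1)) g (c t) = 0 := by
    intro g hg hz
    filter_upwards [hcd, hct.eventually hg.eventually_differentiableAt, hz.eventually_nhds]
      with t h1 h2 h3
    have h4 := hasDerivAt_comp_curve h2 h1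
    have h5 : HasDerivAt (fun t => g (c t)) 0 t :=
      (hasDerivAt_const t (0 : ℝ)).congr_of_eventuallyEq h3
    exact h4.unique h5
  have hek : ∀ᶠ t in 𝓝 (0 : ℝ), deriv e t * R (c t) = jac g₁ g₂ (c t) := by
    filter_upwards [hchain g₁ h₁ (hgc.mono fun _ h => h.1), hchain g₂ h₂ (hgc.mono fun _ h => h.2)]
      with t e1 e2
    simp only [hRdef, jac]
    linear_combination lineD (0, (1, 0)) g₂ (c t) * e1 - lineD (0, (1, 0)) g₁ (c t) * e2
  have he' : ∀ᶠ t in 𝓝 (0 : ℝ), deriv e t = jac g₁ g₂ (c t) / R (c t) := by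
    filter_upwards [hek, hR0] with t h1 h2
    rw [eq_div_iff h2, h1]
  have he'0 : deriv e 0 = 0 := by
    rw [he'.self_of_nhds, hc0, hJ, zero_div]
  have hx'0 : deriv x 0 * lineD (0, (1, 0)) g₁ 0 = -lineD (0, (0, 1)) g₁ 0 := by
    have := (hchain g₁ h₁ (hgc.mono fun _ h => h.1)).self_of_nhds
    rw [he'0, hc0] at this
    linear_combination this
  have hRd : DifferentiableAt ℝ (fun t => R (c t)) 0 := by
    have h1 : DifferentiableAt ℝ R (c 0) := by rw [hc0]; exact hRs.differentiableAt
    exact DifferentiableAt.comp (g := R) 0 h1 hcd.self_of_nhds.differentiableAt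
  have hm : HasDerivAt (fun t => jac g₁ g₂ (c t) / R (c t))
      (lineD (0, (-lineD (0, (0, 1)) g₁ 0, lineD (0, (1, 0)) g₁ 0)) (jac g₁ g₂) 0
        / (lineD (0, (1, 0)) g₁ 0 * R 0)) 0 := by
    have h1 : DifferentiableAt ℝ (jac g₁ g₂) (c 0) := by
      rw [hc0]; exact (h₁.jac h₂).differentiableAt
    have h2 := (hasDerivAt_comp_curve h1 hcd.self_of_nhds).div hRd.hasDerivAt
      (by rw [hc0]; exact hR)
    refine h2.congr_deriv ?_
    rw [hc0, hJ, he'0, lineD_decomp (-lineD (0, (0, 1)) g₁ 0) (lineD (0, (1, 0)) g₁ 0), ← hx'0]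
    have hR' : R 0 ≠ 0 := hR
    field_simp
    ring
  refine foldTransition_of_curve (m := fun t => jac g₁ g₂ (c t) / R (c t))
    (div_ne_zero hQ (mul_ne_zero hx hR)) (by simp [hψ0]) (by simp [he, hψ0])
    hψs.self_of_nhds.continuousAt.snd hflip ?_ (by rw [hc0, hJ, zero_div]) hm ?_
  · filter_upwards [hψd, he'] with t h1 h2
    rw [← h2]; exact h1.fst
  · have h3 : ∀ᶠ t in 𝓝[≠] (0 : ℝ), jac g₁ g₂ (c t) / R (c t) ≠ 0 := by
      have := hm.eventually_ne (c := 0) (div_ne_zero hQ (mul_ne_zero hx hR))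
      exact this
    filter_upwards [h3] with t ht h0
    exact ht (by rw [show jac g₁ g₂ (c t) = 0 from h0, zero_div])

end Fold

section Pointwise

variable {f : ℝ × ℝ → ℝ} {q : ℝ × ℝ} {K p r σ : ℝ}

/-- The asymptotic directions at `q` are `(1, p)` and `(r, 1)`, and the first is right (left) if
`σ = 1` (`σ = -1`). -/
structure SlopesAt (f : ℝ × ℝ → ℝ) (q : ℝ × ℝ) (σ K p r : ℝ) : Prop where
  h20 : pd 2 0 f q = -(K * p)
  h02 : pd 0 2 f q = -(K * r)
  h11 : 2 * pd 1 1 f q = K * (1 + p * r)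
  pos : 0 < σ * K
  lt_one : p * r < 1

namespace SlopesAt

theorem ne_zero (h : SlopesAt f q σ K p r) : K ≠ 0 := by
  rintro rfl; simpa using h.pos

theorem isHyperbolic (h : SlopesAt f q σ K p r) : IsHyperbolic f q := by
  have hK := h.ne_zero
  have e : pd 2 0 f q * pd 0 2 f q - pd 1 1 f q ^ 2 = -(K * (1 - p * r) / 2) ^ 2 := by
    rw [h.h20, h.h02, show pd 1 1 f q = K * (1 + p * r) / 2 by linear_combination h.h11 / 2]
    ring
  have : 0 < (K * (1 - p * r) / 2) ^ 2 := by
    have : K * (1 - p * r) / 2 ≠ 0 :=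
      div_ne_zero (mul_ne_zero hK (by linarith [h.lt_one])) two_ne_zero
    positivity
  unfold IsHyperbolic
  linarith

theorem quad_eq (h : SlopesAt f q σ K p r) (u : ℝ × ℝ) :
    quad f q u = K * (u.2 - p * u.1) * (u.1 - r * u.2) := by
  unfold quad; rw [h.h20, h.h02, h.h11]; ring

theorem twist_eq (h : SlopesAt f q σ K p r) (u : ℝ × ℝ) : twist f q u =
    K * ((1 + p * r) / 2 * (u.1 ^ 2 - u.2 ^ 2) + (p - r) * u.1 * u.2) := by
  unfold twist
  rw [h.h20, h.h02, show pd 1 1 f q = K * (1 + p * r) / 2 by linear_combination h.h11 / 2]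
  ring

theorem direction_iff (h : SlopesAt f q σ K p r) (u : ℝ × ℝ) :
    (quad f q u = 0 ∧ 0 < σ * twist f q u) ↔ ∃ t : ℝ, t ≠ 0 ∧ u = (t, t * p) := by
  have hK := h.pos
  have hpr : 0 < 1 - p * r := by linarith [h.lt_one]
  rw [h.quad_eq, h.twist_eq]
  constructor
  · rintro ⟨hq, ht⟩
    rcases mul_eq_zero.1 hq with h1 | h1
    · have h2 : u.2 = u.1 * p := by
        have := (mul_eq_zero.1 h1).resolve_left h.ne_zero; linarith
      refine ⟨u.1, fun h0 => ?_, Prod.ext rfl h2⟩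
      rw [h2, h0] at ht; simp at ht
    · exfalso
      have h2 : u.1 = r * u.2 := by linarith
      rw [h2] at ht
      have : σ * (K * ((1 + p * r) / 2 * ((r * u.2) ^ 2 - u.2 ^ 2) + (p - r) * (r * u.2) * u.2))
          = -((σ * K) * ((1 - p * r) * (1 + r ^ 2) * u.2 ^ 2) / 2) := by ring
      rw [this] at ht
      have : 0 ≤ (σ * K) * ((1 - p * r) * (1 + r ^ 2) * u.2 ^ 2) := by positivity
      linarith
  · rintro ⟨t, ht, rfl⟩
    refine ⟨by simp only; ring, ?_⟩
    have : σ * (K * ((1 + p * r) / 2 * (t ^ 2 - (t * p) ^ 2) + (p - r) * t * (t * p)))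
        = (σ * K) * ((1 - p * r) * (1 + p ^ 2) * t ^ 2) / 2 := by ring
    simp only
    rw [this]
    have : 0 < t ^ 2 := by positivity
    positivity

theorem direction_iff_neg (h : SlopesAt f q σ K p r) (u : ℝ × ℝ) :
    (quad f q u = 0 ∧ 0 < -σ * twist f q u) ↔ ∃ t : ℝ, t ≠ 0 ∧ u = (t * r, t) := by
  have hK := h.pos
  have hpr : 0 < 1 - p * r := by linarith [h.lt_one]
  rw [h.quad_eq, h.twist_eq]
  constructor
  · rintro ⟨hq, ht⟩
    rcases mul_eq_zero.1 hq with h1 | h1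
    · exfalso
      have h2 : u.2 = p * u.1 := by
        have := (mul_eq_zero.1 h1).resolve_left h.ne_zero; linarith
      rw [h2] at ht
      have : -σ * (K * ((1 + p * r) / 2 * (u.1 ^ 2 - (p * u.1) ^ 2) + (p - r) * u.1 * (p * u.1)))
          = -((σ * K) * ((1 - p * r) * (1 + p ^ 2) * u.1 ^ 2) / 2) := by ring
      rw [this] at ht
      have : 0 ≤ (σ * K) * ((1 - p * r) * (1 + p ^ 2) * u.1 ^ 2) := by positivity
      linarith
    · have h2 : u.1 = u.2 * r := by linarith
      refine ⟨u.2, fun h0 => ?_, Prod.ext h2 rfl⟩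
      rw [h2, h0] at ht; simp at ht
  · rintro ⟨t, ht, rfl⟩
    refine ⟨by simp only; ring, ?_⟩
    have : -σ * (K * ((1 + p * r) / 2 * ((t * r) ^ 2 - t ^ 2) + (p - r) * (t * r) * t))
        = (σ * K) * ((1 - p * r) * (1 + r ^ 2) * t ^ 2) / 2 := by ring
    simp only
    rw [this]
    have : 0 < t ^ 2 := by positivity
    positivity

end SlopesAt

theorem cubic_smul (f : ℝ × ℝ → ℝ) (q : ℝ × ℝ) (t a b : ℝ) :
    cubic f q (t * a, t * b) = t ^ 3 * cubic f q (a, b) := by unfold cubic; ring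

theorem quartic_smul (f : ℝ × ℝ → ℝ) (q : ℝ × ℝ) (t a b : ℝ) :
    quartic f q (t * a, t * b) = t ^ 4 * quartic f q (a, b) := by unfold quartic; ring

namespace SlopesAt

theorem exists_direction_iff (h : SlopesAt f q σ K p r) {Q : ℝ × ℝ → Prop}
    (hQ : ∀ t : ℝ, t ≠ 0 → (Q (t, t * p) ↔ Q (1, p))) :
    (∃ u, quad f q u = 0 ∧ 0 < σ * twist f q u ∧ Q u) ↔ Q (1, p) := by
  constructor
  · rintro ⟨u, h1, h2, h3⟩
    obtain ⟨t, ht, rfl⟩ := (h.direction_iff u).1 ⟨h1, h2⟩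
    exact (hQ t ht).1 h3
  · intro hq
    have := (h.direction_iff (1, p)).2 ⟨1, one_ne_zero, by simp⟩
    exact ⟨(1, p), this.1, this.2, hq⟩

theorem mem_branch (h : SlopesAt f q σ K p r) : q ∈ branch σ f ↔ cubic f q (1, p) = 0 := by
  have hs : ∀ t : ℝ, t ≠ 0 → (cubic f q (t, t * p) = 0 ↔ cubic f q (1, p) = 0) := fun t ht => by
    have := cubic_smul f q t 1 p
    rw [mul_one] at this
    simp [this, ht]
  have := h.exists_direction_iff (Q := fun u => cubic f q u = 0) hs
  exact ⟨fun hq => this.1 hq.2, fun hq => ⟨h.isHyperbolic, this.2 hq⟩⟩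

theorem mem_branch_neg (h : SlopesAt f q σ K p r) :
    q ∈ branch (-σ) f ↔ cubic f q (r, 1) = 0 := by
  constructor
  · rintro ⟨-, u, h1, h2, h3⟩
    obtain ⟨t, ht, rfl⟩ := (h.direction_iff_neg u).1 ⟨h1, h2⟩
    have := cubic_smul f q t r 1
    rw [mul_one] at this
    rw [this] at h3
    exact (mul_eq_zero.1 h3).resolve_left (pow_ne_zero _ ht)
  · intro hq
    have := (h.direction_iff_neg (r, 1)).2 ⟨1, one_ne_zero, by simp⟩
    exact ⟨h.isHyperbolic, (r, 1), this.1, this.2, hq⟩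

theorem mem_biflecnodes (h : SlopesAt f q σ K p r) :
    q ∈ biflecnodes σ f ↔ cubic f q (1, p) = 0 ∧ quartic f q (1, p) = 0 := by
  have := h.exists_direction_iff (Q := fun u => cubic f q u = 0 ∧ quartic f q u = 0)
    fun t ht => by
      have h3 := cubic_smul f q t 1 p
      have h4 := quartic_smul f q t 1 p
      rw [mul_one] at h3 h4
      simp [h3, h4, ht]
  exact ⟨fun hq => this.1 hq.2, fun hq => ⟨h.isHyperbolic, this.2 hq⟩⟩

theorem mem_simpleBiflecnodes (h : SlopesAt f q σ K p r) (h3 : cubic f q (1, p) = 0)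
    (h4 : quartic f q (1, p) = 0) (h5 : quintic f q (1, p) ≠ 0) :
    q ∈ simpleBiflecnodes σ f := by
  have := (h.direction_iff (1, p)).2 ⟨1, one_ne_zero, by simp⟩
  exact ⟨h.isHyperbolic, (1, p), this.1, this.2, h3, h4, h5⟩

theorem isNode_iff (h : SlopesAt f q σ K p r) :
    IsNode f q ↔ cubic f q (1, p) = 0 ∧ cubic f q (r, 1) = 0 := by
  constructor
  · rintro ⟨a, b, hab⟩
    rw [hab, hab, h.quad_eq, h.quad_eq]
    constructor <;> simp
  · rintro ⟨h1, h2⟩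
    have hK := h.ne_zero
    have hpr := h.lt_one
    have hd : (1 + p * r) ^ 2 - p * r ≠ 0 := by nlinarith [sq_nonneg (p * r + 1)]
    have hd3 : 1 - (p * r) ^ 3 ≠ 0 := by
      have : 1 - (p * r) ^ 3 = (1 - p * r) * ((1 + p * r) ^ 2 - p * r) := by ring
      rw [this]
      exact mul_ne_zero (by linarith) hd
    set m := 3 * pd 2 1 f q / K with hm
    set n := 3 * pd 1 2 f q / K with hn
    have hm' : 3 * pd 2 1 f q = K * m := by rw [hm]; field_simp
    have hn' : 3 * pd 1 2 f q = K * n := by rw [hn]; field_simp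
    set D := (1 + p * r) ^ 2 - p * r with hD
    set a := ((1 + p * r) * m + p * n) / D with ha
    set b := ((1 + p * r) * n + r * m) / D with hb
    have ea : a * D = (1 + p * r) * m + p * n := by rw [ha]; field_simp
    have eb : b * D = (1 + p * r) * n + r * m := by rw [hb]; field_simp
    have e1 : a * (1 + p * r) - b * p = m := by
      apply mul_right_cancel₀ hd
      linear_combination (1 + p * r) * ea - p * eb - m * hD
    have e2 : b * (1 + p * r) - a * r = n := by
      apply mul_right_cancel₀ hd
      linear_combination (1 + p * r) * eb - r * ea - n * hD
    set R₀ := pd 3 0 f q + K * p * a with hR₀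
    set R₃ := pd 0 3 f q + K * r * b with hR₃
    have key : ∀ u : ℝ × ℝ, cubic f q u
        = (a * u.1 + b * u.2) * quad f q u + R₀ * u.1 ^ 3 + R₃ * u.2 ^ 3 := by
      intro u
      rw [h.quad_eq]
      unfold cubic
      rw [hm', hn', ← e1, ← e2, hR₀, hR₃]
      ring
    rw [key, h.quad_eq] at h1 h2
    simp only at h1 h2
    have f1 : R₀ + R₃ * p ^ 3 = 0 := by linear_combination h1
    have f2 : R₀ * r ^ 3 + R₃ = 0 := by linear_combination h2
    have z₀ : R₀ = 0 := by
      have : R₀ * (1 - (p * r) ^ 3) = 0 := by linear_combination f1 - p ^ 3 * f2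
      exact (mul_eq_zero.1 this).resolve_right hd3
    have z₃ : R₃ = 0 := by rw [z₀] at f2; linarith
    refine ⟨a, b, fun u => ?_⟩
    rw [key, z₀, z₃]; ring

end SlopesAt

end Pointwise

section Slopes

variable {σ : ℝ} {A B C K p r : ℝ × (ℝ × ℝ) → ℝ}

/-- Smooth slopes of the two asymptotic directions `(1, p)` and `(r, 1)` of the quadratic form
`A u₁² + 2 B u₁ u₂ + C u₂²`, whose matrix depends smoothly on a point near the origin, where the
directions are the coordinate axes. -/
structure SmoothSlopes (σ : ℝ) (A B C K p r : ℝ × (ℝ × ℝ) → ℝ) : Prop where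
  smoothA : SmoothNear A 0
  smoothB : SmoothNear B 0
  smoothC : SmoothNear C 0
  smoothK : SmoothNear K 0
  smoothp : SmoothNear p 0
  smoothr : SmoothNear r 0
  p_zero : p 0 = 0
  r_zero : r 0 = 0
  hA : ∀ᶠ s in 𝓝 0, A s = -(K s * p s)
  hC : ∀ᶠ s in 𝓝 0, C s = -(K s * r s)
  hB : ∀ᶠ s in 𝓝 0, 2 * B s = K s * (1 + p s * r s)
  pos : ∀ᶠ s in 𝓝 0, 0 < σ * K s
  lt_one : ∀ᶠ s in 𝓝 0, p s * r s < 1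

theorem SmoothNear.sqrt {D : ℝ × (ℝ × ℝ) → ℝ} (hD : SmoothNear D 0) (h0 : D 0 ≠ 0) :
    SmoothNear (fun s => Real.sqrt (D s)) 0 := by
  filter_upwards [hD, hD.continuousAt.eventually_ne h0] with s h1 h2
  exact h1.sqrt h2

theorem exists_smoothSlopes (hσ : σ = 1 ∨ σ = -1) (sA : SmoothNear A 0) (sB : SmoothNear B 0)
    (sC : SmoothNear C 0) (A0 : A 0 = 0) (C0 : C 0 = 0) (B0 : 0 < σ * B 0) :
    ∃ K p r, SmoothSlopes σ A B C K p r := by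
  have hσ2 : σ * σ = 1 := by rcases hσ with h | h <;> rw [h] <;> norm_num
  have hB0 : B 0 ≠ 0 := by intro h; rw [h] at B0; simp at B0
  have sD : SmoothNear (fun s => B s * B s - A s * C s) 0 := (sB.mul sB).sub (sA.mul sC)
  have hD0 : B 0 * B 0 - A 0 * C 0 ≠ 0 := by
    rw [A0, zero_mul, sub_zero]; exact mul_ne_zero hB0 hB0
  have hDpos : ∀ᶠ s in 𝓝 0, 0 < B s * B s - A s * C s := by
    apply sD.continuousAt.eventually (lt_mem_nhds _)
    simp only
    rw [A0, zero_mul, sub_zero]; exact mul_self_pos.2 hB0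
  set K : ℝ × (ℝ × ℝ) → ℝ := fun s => B s + σ * Real.sqrt (B s * B s - A s * C s) with hK
  have sK : SmoothNear K 0 := sB.add ((SmoothNear.const σ).mul (sD.sqrt hD0))
  have hKpos : ∀ᶠ s in 𝓝 0, 0 < σ * K s := by
    filter_upwards [((SmoothNear.const σ).mul sB).continuousAt.eventually (lt_mem_nhds B0)]
      with s hs
    have : σ * K s = σ * B s + Real.sqrt (B s * B s - A s * C s) := by
      simp only [hK, mul_add, ← mul_assoc, hσ2, one_mul]
    rw [this]
    have := Real.sqrt_nonneg (B s * B s - A s * C s)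
    linarith
  have hKne : ∀ᶠ s in 𝓝 0, K s ≠ 0 := hKpos.mono fun s hs h => by rw [h] at hs; simp at hs
  have hquad : ∀ᶠ s in 𝓝 0, K s * K s - 2 * B s * K s + A s * C s = 0 := by
    filter_upwards [hDpos] with s hs
    have := Real.mul_self_sqrt hs.le
    simp only [hK]
    linear_combination σ * σ * this + (B s * B s - A s * C s) * hσ2
  have sp : SmoothNear (fun s => -A s / K s) 0 := sA.neg.div sK hKne.self_of_nhds
  have sr : SmoothNear (fun s => -C s / K s) 0 := sC.neg.div sK hKne.self_of_nhds
  refine ⟨K, fun s => -A s / K s, fun s => -C s / K s, sA, sB, sC, sK, sp, sr,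
    by simp [A0], by simp [C0], ?_, ?_, ?_, hKpos, ?_⟩
  · filter_upwards [hKne] with s h; field_simp
  · filter_upwards [hKne] with s h; field_simp
  · filter_upwards [hKne, hquad] with s h h'
    field_simp
    linear_combination -h'
  · exact (sp.mul sr).continuousAt.eventually (gt_mem_nhds (by simp [A0]))

namespace SmoothSlopes

theorem symm (h : SmoothSlopes σ A B C K p r) : SmoothSlopes σ C B A K r p where
  smoothA := h.smoothC
  smoothB := h.smoothB
  smoothC := h.smoothA
  smoothK := h.smoothK
  smoothp := h.smoothr
  smoothr := h.smoothp
  p_zero := h.r_zero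
  r_zero := h.p_zero
  hA := h.hC
  hC := h.hA
  hB := h.hB.mono fun s hs => by rw [hs]; ring
  pos := h.pos
  lt_one := h.lt_one.mono fun s hs => by rwa [mul_comm]

theorem K_zero (h : SmoothSlopes σ A B C K p r) : K 0 = 2 * B 0 := by
  have := h.hB.self_of_nhds
  rw [h.p_zero] at this
  linarith

theorem B_ne_zero (h : SmoothSlopes σ A B C K p r) : B 0 ≠ 0 := fun h0 => by
  have := h.pos.self_of_nhds
  rw [h.K_zero, h0] at this
  simp at this

theorem lineD_K (h : SmoothSlopes σ A B C K p r) (v : ℝ × (ℝ × ℝ)) :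
    lineD v K 0 = 2 * lineD v B 0 := by
  have e := (lineD_congr v h.hB).eq_of_nhds
  have h1 : SmoothNear (fun s => 1 + p s * r s) 0 :=
    (SmoothNear.const 1).add (h.smoothp.mul h.smoothr)
  rw [lineD_mul v (SmoothNear.const 2).differentiableAt h.smoothB.differentiableAt,
    lineD_mul v h.smoothK.differentiableAt h1.differentiableAt,
    lineD_add v (SmoothNear.const 1).differentiableAt (h.smoothp.mul h.smoothr).differentiableAt,
    lineD_mul v h.smoothp.differentiableAt h.smoothr.differentiableAt, lineD_const, lineD_const,
    h.p_zero, h.r_zero] at e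
  linarith

theorem lineD_p (h : SmoothSlopes σ A B C K p r) (v : ℝ × (ℝ × ℝ)) :
    lineD v p 0 = -lineD v A 0 / (2 * B 0) := by
  have e := (lineD_congr v h.hA).eq_of_nhds
  rw [lineD_neg, lineD_mul v h.smoothK.differentiableAt h.smoothp.differentiableAt, h.p_zero,
    h.K_zero] at e
  have := h.B_ne_zero
  rw [e]; field_simp; ring

theorem lineD_lineD_p (h : SmoothSlopes σ A B C K p r) (v w : ℝ × (ℝ × ℝ)) :
    lineD w (lineD v p) 0 = -lineD w (lineD v A) 0 / (2 * B 0)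
      + (lineD v B 0 * lineD w A 0 + lineD w B 0 * lineD v A 0) / (2 * B 0 ^ 2) := by
  have hA' : A =ᶠ[𝓝 0] fun s => (-1) * (K s * p s) := h.hA.mono fun s hs => by rw [hs]; ring
  have e := (lineD_congr w (lineD_congr v hA')).eq_of_nhds
  rw [lineD_lineD_mul v w (SmoothNear.const (-1)) (h.smoothK.mul h.smoothp),
    lineD_lineD_mul v w h.smoothK h.smoothp] at e
  have c1 : ∀ v : ℝ × (ℝ × ℝ), lineD v (fun _ : ℝ × (ℝ × ℝ) => (-1 : ℝ)) = fun _ => 0 :=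
    fun v => funext fun s => lineD_const v _ s
  simp only [c1, lineD_const, h.p_zero, h.lineD_K, h.lineD_p, h.K_zero] at e
  have := h.B_ne_zero
  have e2 : 2 * B 0 * lineD w (lineD v p) 0 = -lineD w (lineD v A) 0
      - 2 * lineD v B 0 * (-lineD w A 0 / (2 * B 0))
      - (2 * lineD w B 0) * (-lineD v A 0 / (2 * B 0)) := by linear_combination e
  have e3 : lineD w (lineD v p) 0 = (2 * B 0 * lineD w (lineD v p) 0) / (2 * B 0) := by
    field_simp
  rw [e3, e2]; field_simp; ring

end SmoothSlopes

end Slopes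

section Horner

variable {c p h : ℝ × (ℝ × ℝ) → ℝ}

theorem lineD_add_mul_of_zero (v : ℝ × (ℝ × ℝ)) (sc : SmoothNear c 0) (sp : SmoothNear p 0)
    (sh : SmoothNear h 0) (p0 : p 0 = 0) :
    lineD v (fun s => c s + p s * h s) 0 = lineD v c 0 + lineD v p 0 * h 0 := by
  rw [lineD_add v sc.differentiableAt (sp.mul sh).differentiableAt,
    lineD_mul v sp.differentiableAt sh.differentiableAt, p0]
  ring

theorem lineD_lineD_add_mul_of_zero (v w : ℝ × (ℝ × ℝ)) (sc : SmoothNear c 0)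
    (sp : SmoothNear p 0) (sh : SmoothNear h 0) (p0 : p 0 = 0) :
    lineD w (lineD v (fun s => c s + p s * h s)) 0 = lineD w (lineD v c) 0
      + lineD w (lineD v p) 0 * h 0 + lineD v p 0 * lineD w h 0 + lineD w p 0 * lineD v h 0 := by
  rw [lineD_lineD_add v w sc (sp.mul sh), lineD_lineD_mul v w sp sh, p0]
  ring

theorem lineD_const_mul (v : ℝ × (ℝ × ℝ)) (k : ℝ) (sh : SmoothNear h 0) :
    lineD v (fun s => k * h s) 0 = k * lineD v h 0 := by
  rw [lineD_mul v (SmoothNear.const k).differentiableAt sh.differentiableAt, lineD_const]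
  ring

end Horner

section BranchFunctions

/-- A smooth family of functions that behave like the partial derivatives of a smooth function along
the commuting directions `e` and `e'`. -/
structure PdFamily (P : ℕ → ℕ → ℝ × (ℝ × ℝ) → ℝ) (e e' : ℝ × (ℝ × ℝ)) : Prop where
  smooth : ∀ i j, SmoothNear (P i j) 0
  fst : ∀ i j, lineD e (P i j) =ᶠ[𝓝 0] P (i + 1) j
  snd : ∀ i j, lineD e' (P i j) =ᶠ[𝓝 0] P i (j + 1)

theorem SmoothFamily.pdFamily {F : ℝ → ℝ × ℝ → ℝ} (hF : SmoothFamily F) :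
    PdFamily (famPd F) (0, (1, 0)) (0, (0, 1)) :=
  ⟨hF.smoothNear_famPd, hF.lineD_x, hF.lineD_y⟩

variable {P : ℕ → ℕ → ℝ × (ℝ × ℝ) → ℝ} {e e' : ℝ × (ℝ × ℝ)} {σ : ℝ}
  {K p r : ℝ × (ℝ × ℝ) → ℝ}

theorem PdFamily.swap (h : PdFamily P e e') : PdFamily (fun i j => P j i) e' e :=
  ⟨fun i j => h.smooth j i, fun i j => h.snd j i, fun i j => h.fst j i⟩

theorem PdFamily.lineD_comb (h : PdFamily P e e') (a b : ℝ) (i j : ℕ) :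
    lineD (a • e + b • e') (P i j) 0 = a * P (i + 1) j 0 + b * P i (j + 1) 0 := by
  rw [lineD_add_dir, lineD_smul_dir, lineD_smul_dir, (h.fst i j).eq_of_nhds,
    (h.snd i j).eq_of_nhds]

theorem PdFamily.lineD_comb_fst (h : PdFamily P e e') (a b : ℝ) (i j : ℕ) :
    lineD (a • e + b • e') (lineD e (P i j)) 0
      = a * P (i + 2) j 0 + b * P (i + 1) (j + 1) 0 := by
  rw [(lineD_congr _ (h.fst i j)).eq_of_nhds, h.lineD_comb]

theorem PdFamily.lineD_comb_snd (h : PdFamily P e e') (a b : ℝ) (i j : ℕ) :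
    lineD (a • e + b • e') (lineD e' (P i j)) 0
      = a * P (i + 1) (j + 1) 0 + b * P i (j + 2) 0 := by
  rw [(lineD_congr _ (h.snd i j)).eq_of_nhds, h.lineD_comb]

/-- The cubic form on the direction `(1, p)`. -/
def branchFn (P : ℕ → ℕ → ℝ × (ℝ × ℝ) → ℝ) (p : ℝ × (ℝ × ℝ) → ℝ) : ℝ × (ℝ × ℝ) → ℝ :=
  fun s => P 3 0 s + p s * (3 * P 2 1 s + p s * (3 * P 1 2 s + p s * P 0 3 s))

/-- The quartic form on the direction `(1, p)`. -/
def flecFn (P : ℕ → ℕ → ℝ × (ℝ × ℝ) → ℝ) (p : ℝ × (ℝ × ℝ) → ℝ) : ℝ × (ℝ × ℝ) → ℝ :=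
  fun s => P 4 0 s
    + p s * (4 * P 3 1 s + p s * (6 * P 2 2 s + p s * (4 * P 1 3 s + p s * P 0 4 s)))

theorem PdFamily.smooth_const_mul (h : PdFamily P e e') (k : ℝ) (i j : ℕ) :
    SmoothNear (fun s => k * P i j s) 0 := (SmoothNear.const k).mul (h.smooth i j)

theorem PdFamily.smooth_inner₂ (h : PdFamily P e e') (sp : SmoothNear p 0) :
    SmoothNear (fun s => 3 * P 1 2 s + p s * P 0 3 s) 0 :=
  (h.smooth_const_mul 3 1 2).add (sp.mul (h.smooth 0 3))

theorem PdFamily.smooth_inner₁ (h : PdFamily P e e') (sp : SmoothNear p 0) :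
    SmoothNear (fun s => 3 * P 2 1 s + p s * (3 * P 1 2 s + p s * P 0 3 s)) 0 :=
  (h.smooth_const_mul 3 2 1).add (sp.mul (h.smooth_inner₂ sp))

theorem PdFamily.smooth_branchFn (h : PdFamily P e e') (sp : SmoothNear p 0) :
    SmoothNear (branchFn P p) 0 :=
  (h.smooth 3 0).add (sp.mul (h.smooth_inner₁ sp))

theorem PdFamily.smooth_flec_inner (h : PdFamily P e e') (sp : SmoothNear p 0) :
    SmoothNear (fun s => 4 * P 3 1 s + p s * (6 * P 2 2 s + p s * (4 * P 1 3 s + p s * P 0 4 s)))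
      0 :=
  (h.smooth_const_mul 4 3 1).add (sp.mul ((h.smooth_const_mul 6 2 2).add
    (sp.mul ((h.smooth_const_mul 4 1 3).add (sp.mul (h.smooth 0 4))))))

theorem PdFamily.smooth_flecFn (h : PdFamily P e e') (sp : SmoothNear p 0) :
    SmoothNear (flecFn P p) 0 :=
  (h.smooth 4 0).add (sp.mul (h.smooth_flec_inner sp))

theorem PdFamily.lineD_branchFn (h : PdFamily P e e')
    (hs : SmoothSlopes σ (P 2 0) (P 1 1) (P 0 2) K p r) (v : ℝ × (ℝ × ℝ)) :
    lineD v (branchFn P p) 0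
      = lineD v (P 3 0) 0 - 3 * P 2 1 0 * lineD v (P 2 0) 0 / (2 * P 1 1 0) := by
  unfold branchFn
  rw [lineD_add_mul_of_zero v (h.smooth 3 0) hs.smoothp (h.smooth_inner₁ hs.smoothp) hs.p_zero,
    hs.lineD_p, hs.p_zero]
  ring

theorem PdFamily.lineD_flecFn (h : PdFamily P e e')
    (hs : SmoothSlopes σ (P 2 0) (P 1 1) (P 0 2) K p r) (v : ℝ × (ℝ × ℝ)) :
    lineD v (flecFn P p) 0
      = lineD v (P 4 0) 0 - 4 * P 3 1 0 * lineD v (P 2 0) 0 / (2 * P 1 1 0) := by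
  unfold flecFn
  rw [lineD_add_mul_of_zero v (h.smooth 4 0) hs.smoothp (h.smooth_flec_inner hs.smoothp) hs.p_zero,
    hs.lineD_p, hs.p_zero]
  ring

/-- The second derivative along two directions `v`, `w` of the cubic form on an asymptotic direction
with slope `0` at the origin, in terms of the derivatives of the coefficients. -/
noncomputable def hessForm (b c21 c12 d30 d20 v20 w20 v11 w11 v21 w21 : ℝ) : ℝ :=
  d30 + (-d20 / (2 * b) + (v11 * w20 + w11 * v20) / (2 * b ^ 2)) * (3 * c21)
    + -v20 / (2 * b) * (3 * w21 + -w20 / (2 * b) * (3 * c12))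
    + -w20 / (2 * b) * (3 * v21 + -v20 / (2 * b) * (3 * c12))

theorem PdFamily.lineD_lineD_branchFn (h : PdFamily P e e')
    (hs : SmoothSlopes σ (P 2 0) (P 1 1) (P 0 2) K p r) (v w : ℝ × (ℝ × ℝ)) :
    lineD w (lineD v (branchFn P p)) 0 = hessForm (P 1 1 0) (P 2 1 0) (P 1 2 0)
      (lineD w (lineD v (P 3 0)) 0) (lineD w (lineD v (P 2 0)) 0)
      (lineD v (P 2 0) 0) (lineD w (P 2 0) 0) (lineD v (P 1 1) 0) (lineD w (P 1 1) 0)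
      (lineD v (P 2 1) 0) (lineD w (P 2 1) 0) := by
  have h1 : ∀ v : ℝ × (ℝ × ℝ),
      lineD v (fun s => 3 * P 2 1 s + p s * (3 * P 1 2 s + p s * P 0 3 s)) 0
        = 3 * lineD v (P 2 1) 0 + -lineD v (P 2 0) 0 / (2 * P 1 1 0) * (3 * P 1 2 0) := by
    intro v
    rw [lineD_add_mul_of_zero v (h.smooth_const_mul 3 2 1) hs.smoothp (h.smooth_inner₂ hs.smoothp)
      hs.p_zero, lineD_const_mul v 3 (h.smooth 2 1), hs.lineD_p, hs.p_zero]
    ring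
  unfold branchFn hessForm
  rw [lineD_lineD_add_mul_of_zero v w (h.smooth 3 0) hs.smoothp (h.smooth_inner₁ hs.smoothp)
    hs.p_zero, h1, h1, hs.lineD_p, hs.lineD_p, hs.lineD_lineD_p, hs.p_zero]
  ring

/-- The `y`-derivative of the equation of the branch with asymptotic direction `(1, 0)`. -/
noncomputable def gradY (c : ℕ → ℕ → ℝ) : ℝ := c 3 1 - 3 * c 2 1 * c 2 1 / (2 * c 1 1)

/-- Mixed second derivative along `(1, 0)` and `(a, b)` of the equation of that branch. -/
noncomputable def hessX (c : ℕ → ℕ → ℝ) (a b : ℝ) : ℝ :=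
  hessForm (c 1 1) (c 2 1) (c 1 2) (a * c 5 0 + b * c 4 1) (a * c 4 0 + b * c 3 1)
    (c 3 0) (a * c 3 0 + b * c 2 1) (c 2 1) (a * c 2 1 + b * c 1 2)
    (c 3 1) (a * c 3 1 + b * c 2 2)

/-- Mixed second derivative along `(0, 1)` and `(a, b)` of the equation of that branch. -/
noncomputable def hessY (c : ℕ → ℕ → ℝ) (a b : ℝ) : ℝ :=
  hessForm (c 1 1) (c 2 1) (c 1 2) (a * c 4 1 + b * c 3 2) (a * c 3 1 + b * c 2 2)
    (c 2 1) (a * c 3 0 + b * c 2 1) (c 1 2) (a * c 2 1 + b * c 1 2)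
    (c 2 2) (a * c 3 1 + b * c 2 2)

theorem PdFamily.lineD_fst_branchFn (h : PdFamily P e e')
    (hs : SmoothSlopes σ (P 2 0) (P 1 1) (P 0 2) K p r) (z : P 3 0 0 = 0) :
    lineD e (branchFn P p) 0 = P 4 0 0 := by
  rw [h.lineD_branchFn hs, (h.fst 3 0).eq_of_nhds, (h.fst 2 0).eq_of_nhds, z]; ring

theorem PdFamily.lineD_snd_branchFn (h : PdFamily P e e')
    (hs : SmoothSlopes σ (P 2 0) (P 1 1) (P 0 2) K p r) :
    lineD e' (branchFn P p) 0 = gradY (fun i j => P i j 0) := by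
  rw [h.lineD_branchFn hs, (h.snd 3 0).eq_of_nhds, (h.snd 2 0).eq_of_nhds]; rfl

theorem PdFamily.lineD_comb_fst_branchFn (h : PdFamily P e e')
    (hs : SmoothSlopes σ (P 2 0) (P 1 1) (P 0 2) K p r) (a b : ℝ) :
    lineD (a • e + b • e') (lineD e (branchFn P p)) 0 = hessX (fun i j => P i j 0) a b := by
  rw [h.lineD_lineD_branchFn hs]
  simp only [h.lineD_comb_fst, h.lineD_comb, (h.fst _ _).eq_of_nhds]
  rfl

theorem PdFamily.lineD_comb_snd_branchFn (h : PdFamily P e e')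
    (hs : SmoothSlopes σ (P 2 0) (P 1 1) (P 0 2) K p r) (a b : ℝ) :
    lineD (a • e + b • e') (lineD e' (branchFn P p)) 0 = hessY (fun i j => P i j 0) a b := by
  rw [h.lineD_lineD_branchFn hs]
  simp only [h.lineD_comb_snd, h.lineD_comb, (h.snd _ _).eq_of_nhds]
  rfl

theorem lineD_jac {g₁ g₂ : ℝ × (ℝ × ℝ) → ℝ} (h₁ : SmoothNear g₁ 0) (h₂ : SmoothNear g₂ 0)
    (w : ℝ × (ℝ × ℝ)) : lineD w (jac g₁ g₂) 0 =
      lineD w (lineD (0, (1, 0)) g₁) 0 * lineD (0, (0, 1)) g₂ 0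
        + lineD (0, (1, 0)) g₁ 0 * lineD w (lineD (0, (0, 1)) g₂) 0
        - (lineD w (lineD (0, (0, 1)) g₁) 0 * lineD (0, (1, 0)) g₂ 0
        + lineD (0, (0, 1)) g₁ 0 * lineD w (lineD (0, (1, 0)) g₂) 0) := by
  unfold jac
  rw [lineD_sub w ((h₁.lineD _).mul (h₂.lineD _)).differentiableAt
      ((h₁.lineD _).mul (h₂.lineD _)).differentiableAt,
    lineD_mul w (h₁.lineD _).differentiableAt (h₂.lineD _).differentiableAt,
    lineD_mul w (h₁.lineD _).differentiableAt (h₂.lineD _).differentiableAt]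

/-- The derivative, along the common tangent line of the two branches, of the Jacobian of their
equations. -/
noncomputable def foldNum (c : ℕ → ℕ → ℝ) : ℝ :=
  hessX c (-gradY c) (c 4 0) * c 0 4
    + c 4 0 * hessX (fun i j => c j i) (c 4 0) (-gradY c)
    - (hessY c (-gradY c) (c 4 0) * gradY (fun i j => c j i)
      + gradY c * hessY (fun i j => c j i) (c 4 0) (-gradY c))

/-- The condition on the velocity `V` for the parameter to vary at the double zero. -/
noncomputable def speedNum (c V : ℕ → ℕ → ℝ) : ℝ :=
  (V 3 0 - 3 * c 2 1 * V 2 0 / (2 * c 1 1)) * gradY (fun i j => c j i)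
    - c 4 0 * (V 0 3 - 3 * c 1 2 * V 0 2 / (2 * c 1 1))

end BranchFunctions

section Chart

variable {F : ℝ → ℝ × ℝ → ℝ} {σ : ℝ} {K p r : ℝ × (ℝ × ℝ) → ℝ}

/-- Smooth asymptotic slopes of the members of a family. -/
abbrev FamilySlopes (F : ℝ → ℝ × ℝ → ℝ) (σ : ℝ) (K p r : ℝ × (ℝ × ℝ) → ℝ) : Prop :=
  SmoothSlopes σ (famPd F 2 0) (famPd F 1 1) (famPd F 0 2) K p r

theorem FamilySlopes.slopesAt (hs : FamilySlopes F σ K p r) :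
    ∀ᶠ s in 𝓝 (0 : ℝ × (ℝ × ℝ)), SlopesAt (F s.1) s.2 σ (K s) (p s) (r s) := by
  filter_upwards [hs.hA, hs.hB, hs.hC, hs.pos, hs.lt_one] with s h1 h2 h3 h4 h5
  exact ⟨h1, h3, h2, h4, h5⟩

theorem cubic_eq_branchFn (F : ℝ → ℝ × ℝ → ℝ) (p : ℝ × (ℝ × ℝ) → ℝ) (s : ℝ × (ℝ × ℝ)) :
    cubic (F s.1) s.2 (1, p s) = branchFn (famPd F) p s := by
  unfold cubic branchFn famPd; ring

theorem cubic_eq_branchFn_swap (F : ℝ → ℝ × ℝ → ℝ) (r : ℝ × (ℝ × ℝ) → ℝ) (s : ℝ × (ℝ × ℝ)) :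
    cubic (F s.1) s.2 (r s, 1) = branchFn (fun i j => famPd F j i) r s := by
  unfold cubic branchFn famPd; ring

theorem quartic_eq_flecFn (F : ℝ → ℝ × ℝ → ℝ) (p : ℝ × (ℝ × ℝ) → ℝ) (s : ℝ × (ℝ × ℝ)) :
    quartic (F s.1) s.2 (1, p s) = flecFn (famPd F) p s := by
  unfold quartic flecFn famPd; ring

theorem FamilySlopes.mem_branch (hs : FamilySlopes F σ K p r) :
    ∀ᶠ s in 𝓝 (0 : ℝ × (ℝ × ℝ)), s.2 ∈ branch σ (F s.1) ↔ branchFn (famPd F) p s = 0 := by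
  filter_upwards [hs.slopesAt] with s h
  rw [h.mem_branch, cubic_eq_branchFn]

theorem FamilySlopes.mem_branch_neg (hs : FamilySlopes F σ K p r) :
    ∀ᶠ s in 𝓝 (0 : ℝ × (ℝ × ℝ)),
      s.2 ∈ branch (-σ) (F s.1) ↔ branchFn (fun i j => famPd F j i) r s = 0 := by
  filter_upwards [hs.slopesAt] with s h
  rw [h.mem_branch_neg, cubic_eq_branchFn_swap]

theorem FamilySlopes.isHyperbonode_iff (hs : FamilySlopes F σ K p r) :
    ∀ᶠ s in 𝓝 (0 : ℝ × (ℝ × ℝ)), IsHyperbonode (F s.1) s.2 ↔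
      branchFn (famPd F) p s = 0 ∧ branchFn (fun i j => famPd F j i) r s = 0 := by
  filter_upwards [hs.slopesAt] with s h
  rw [IsHyperbonode, h.isNode_iff, cubic_eq_branchFn, cubic_eq_branchFn_swap]
  exact ⟨fun a => a.2, fun a => ⟨h.isHyperbolic, a⟩⟩

theorem FamilySlopes.mem_biflecnodes (hs : FamilySlopes F σ K p r) :
    ∀ᶠ s in 𝓝 (0 : ℝ × (ℝ × ℝ)), s.2 ∈ biflecnodes σ (F s.1) ↔
      branchFn (famPd F) p s = 0 ∧ flecFn (famPd F) p s = 0 := by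
  filter_upwards [hs.slopesAt] with s h
  rw [h.mem_biflecnodes, cubic_eq_branchFn, quartic_eq_flecFn]

theorem FamilySlopes.mem_simpleBiflecnodes (hF : SmoothFamily F) (hs : FamilySlopes F σ K p r)
    (h50 : famPd F 5 0 0 ≠ 0) :
    ∀ᶠ s in 𝓝 (0 : ℝ × (ℝ × ℝ)), branchFn (famPd F) p s = 0 → flecFn (famPd F) p s = 0 →
      s.2 ∈ simpleBiflecnodes σ (F s.1) := by
  have hq : SmoothNear (fun s => famPd F 5 0 s + p s * (5 * famPd F 4 1 s
      + p s * (10 * famPd F 3 2 s + p s * (10 * famPd F 2 3 s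
      + p s * (5 * famPd F 1 4 s + p s * famPd F 0 5 s))))) 0 := by
    have hP := hF.pdFamily
    have sp := hs.smoothp
    exact (hP.smooth 5 0).add (sp.mul ((hP.smooth_const_mul 5 4 1).add (sp.mul
      ((hP.smooth_const_mul 10 3 2).add (sp.mul ((hP.smooth_const_mul 10 2 3).add (sp.mul
        ((hP.smooth_const_mul 5 1 4).add (sp.mul (hP.smooth 0 5))))))))))
  filter_upwards [hs.slopesAt, hq.continuousAt.eventually_ne (y := 0)
    (by simpa [hs.p_zero] using h50)] with s h h5 h1 h2
  refine h.mem_simpleBiflecnodes ?_ ?_ ?_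
  · rw [cubic_eq_branchFn, h1]
  · rw [quartic_eq_flecFn, h2]
  · intro h0
    refine h5 (Eq.trans ?_ h0)
    unfold quintic famPd; ring

theorem TangentAt.symm {C D : Set (ℝ × ℝ)} {q : ℝ × ℝ} (h : TangentAt C D q) : TangentAt D C q := by
  obtain ⟨T, h1, h2⟩ := h
  exact ⟨T, h2, h1⟩

theorem TransverseAt.symm {C D : Set (ℝ × ℝ)} {q : ℝ × ℝ} (h : TransverseAt C D q) :
    TransverseAt D C q := by
  obtain ⟨T₁, T₂, h1, h2, h3⟩ := h
  exact ⟨T₂, T₁, h2, h1, h3.symm⟩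

theorem eventually_transverseAt {g₁ g₂ : ℝ × (ℝ × ℝ) → ℝ} {C₁ C₂ : ℝ → Set (ℝ × ℝ)}
    (h₁ : SmoothNear g₁ 0) (h₂ : SmoothNear g₂ 0)
    (hC₁ : ∀ᶠ s in 𝓝 (0 : ℝ × (ℝ × ℝ)), s.2 ∈ C₁ s.1 ↔ g₁ s = 0)
    (hC₂ : ∀ᶠ s in 𝓝 (0 : ℝ × (ℝ × ℝ)), s.2 ∈ C₂ s.1 ↔ g₂ s = 0)
    (n₁ : lineD (0, (1, 0)) g₁ 0 ≠ 0 ∨ lineD (0, (0, 1)) g₁ 0 ≠ 0)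
    (n₂ : lineD (0, (1, 0)) g₂ 0 ≠ 0 ∨ lineD (0, (0, 1)) g₂ 0 ≠ 0) :
    ∀ᶠ s in 𝓝 (0 : ℝ × (ℝ × ℝ)), (g₁ s = 0 ∧ g₂ s = 0) → jac g₁ g₂ s ≠ 0 →
      TransverseAt (C₁ s.1) (C₂ s.1) s.2 := by
  filter_upwards [eventually_isSmoothCurveAt h₁ hC₁ n₁, eventually_isSmoothCurveAt h₂ hC₂ n₂,
    hC₁, hC₂, h₁.eventually_differentiableAt, h₂.eventually_differentiableAt]
    with s a1 a2 b1 b2 d1 d2 hz hj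
  refine ⟨_, _, a1 (b1.2 hz.1), a2 (b2.2 hz.2), ker_ne_of_det_ne_zero ?_⟩
  simp only [ContinuousLinearMap.coe_coe]
  rw [fderiv_slice d1, fderiv_slice d1, fderiv_slice d2, fderiv_slice d2]
  exact hj

theorem tangentAt_zero {𝕜 : Type*} [RCLike 𝕜] {g₁ g₂ : 𝕜 × (𝕜 × 𝕜) → 𝕜}
    {C₁ C₂ : 𝕜 → Set (𝕜 × 𝕜)}
    (h₁ : SmoothNear g₁ 0) (h₂ : SmoothNear g₂ 0)
    (hC₁ : ∀ᶠ s in 𝓝 (0 : 𝕜 × (𝕜 × 𝕜)), s.2 ∈ C₁ s.1 ↔ g₁ s = 0)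
    (hC₂ : ∀ᶠ s in 𝓝 (0 : 𝕜 × (𝕜 × 𝕜)), s.2 ∈ C₂ s.1 ↔ g₂ s = 0)
    (n₁ : lineD (0, (1, 0)) g₁ 0 ≠ 0 ∨ lineD (0, (0, 1)) g₁ 0 ≠ 0)
    (n₂ : lineD (0, (1, 0)) g₂ 0 ≠ 0 ∨ lineD (0, (0, 1)) g₂ 0 ≠ 0)
    (z₁ : g₁ 0 = 0) (z₂ : g₂ 0 = 0)
    (hj : lineD (0, (1, 0)) g₁ 0 * lineD (0, (0, 1)) g₂ 0
      = lineD (0, (0, 1)) g₁ 0 * lineD (0, (1, 0)) g₂ 0) :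
    TangentAt (C₁ 0) (C₂ 0) 0 := by
  have a1 := (eventually_isSmoothCurveAt h₁ hC₁ n₁).self_of_nhds (hC₁.self_of_nhds.2 z₁)
  have a2 := (eventually_isSmoothCurveAt h₂ hC₂ n₂).self_of_nhds (hC₂.self_of_nhds.2 z₂)
  have e1 := fderiv_slice h₁.differentiableAt
  have e2 := fderiv_slice h₂.differentiableAt
  have hk := ker_eq_of_det_eq_zero (A := (fderiv 𝕜 (fun q => g₁ (0, q)) 0).toLinearMap)
    (B := (fderiv 𝕜 (fun q => g₂ (0, q)) 0).toLinearMap)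
    (by rw [← e1, ← e1] at n₁; exact n₁) (by rw [← e2, ← e2] at n₂; exact n₂)
    (by rw [← e1, ← e1, ← e2, ← e2] at hj; exact hj)
  refine ⟨_, a1, ?_⟩
  change IsSmoothCurveAt _ _ (LinearMap.ker (fderiv 𝕜 (fun q => g₁ (0, q)) 0).toLinearMap)
  rw [hk]
  exact a2

end Chart

section Jets

/-- The partial derivatives at the origin. -/
noncomputable def pd₀ (f : ℝ × ℝ → ℝ) (i j : ℕ) : ℝ := pd i j f 0

theorem jet_c (f : ℝ × ℝ → ℝ) {i j : ℕ} (h : i + j ≤ 5) : (jet f).c i j = pd₀ f i j := by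
  simp [Jet.c, jet, h, pd₀]

theorem continuous_jet_c (i j : ℕ) : Continuous fun J : Jet => J.c i j := by
  unfold Jet.c
  split_ifs
  · exact continuous_apply _
  · exact continuous_const

theorem jet_c_update (J : Jet) {i j : ℕ} (h : i + j ≤ 5) (x : ℝ) (k l : ℕ) :
    Jet.c (Function.update J ⟨(i, j), h⟩ x) k l = if k = i ∧ l = j then x else J.c k l := by
  unfold Jet.c
  by_cases hkl : k = i ∧ l = j
  · obtain ⟨rfl, rfl⟩ := hkl
    simp [h]
  · rw [if_neg hkl]
    split_ifs with h'
    · rw [Function.update_of_ne]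
      intro he
      simp only [Subtype.mk.injEq, Prod.mk.injEq] at he
      exact hkl he
    · rfl

theorem update_self_eq (J : Jet) {i j : ℕ} (h : i + j ≤ 5) {x : ℝ} (hx : x = J.c i j) :
    Function.update J ⟨(i, j), h⟩ x = J := by
  rw [Function.update_eq_self_iff, hx]
  simp [Jet.c, h]

theorem mem_closure_of_curve {X : Type*} [TopologicalSpace X] {A : Set X} {γ : ℝ → X}
    (hγ : Continuous γ) (h : ∀ᶠ t in 𝓝[≠] (0 : ℝ), γ t ∈ A) : γ 0 ∈ closure A :=
  mem_closure_of_tendsto (hγ.continuousAt.tendsto.mono_left nhdsWithin_le_nhds) h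

theorem eventually_affine_ne_zero (d : ℝ) {k : ℝ} (hk : k ≠ 0) :
    ∀ᶠ t in 𝓝[≠] (0 : ℝ), d + k * t ≠ 0 := by
  by_cases hd : d = 0
  · filter_upwards [self_mem_nhdsWithin] with t ht
    rw [hd, zero_add]
    exact mul_ne_zero hk ht
  · apply Filter.Eventually.filter_mono nhdsWithin_le_nhds
    have : ContinuousAt (fun t : ℝ => d + k * t) 0 := by fun_prop
    exact this.eventually_ne (by simpa using hd)

/-- A `2 × 2` matrix of determinant zero is a column times a row. -/
theorem exists_outer_product {a b c d : ℝ} (h : a * d = b * c) :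
    ∃ l m x y : ℝ, a = l * x ∧ b = l * y ∧ c = m * x ∧ d = m * y := by
  by_cases ha : a = 0
  · by_cases hb : b = 0
    · exact ⟨0, 1, c, d, by simp [ha], by simp [hb], by simp, by simp⟩
    · refine ⟨1, d / b, a, b, by simp, by simp, ?_, by field_simp⟩
      rw [ha, zero_mul] at h
      rw [ha, mul_zero]
      exact (mul_eq_zero.1 h.symm).resolve_left hb
  · refine ⟨1, c / a, a, b, by simp, by simp, by field_simp, ?_⟩
    field_simp
    linear_combination h

theorem exists_sign {b : ℝ} (hb : b ≠ 0) : ∃ σ : ℝ, (σ = 1 ∨ σ = -1) ∧ 0 < σ * b := by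
  rcases lt_or_gt_of_ne hb with h | h
  · exact ⟨-1, Or.inr rfl, by linarith⟩
  · exact ⟨1, Or.inl rfl, by linarith⟩

end Jets

section HyperbonodeChart

variable {F : ℝ → ℝ × ℝ → ℝ} {σ : ℝ} {K p r : ℝ × (ℝ × ℝ) → ℝ}

theorem HyperbonodeJet.values {f : ℝ × ℝ → ℝ} (h : HyperbonodeJet (jet f)) :
    pd₀ f 2 0 = 0 ∧ pd₀ f 0 2 = 0 ∧ pd₀ f 1 1 ≠ 0 ∧ pd₀ f 3 0 = 0 ∧ pd₀ f 0 3 = 0 := by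
  simpa [HyperbonodeJet, jet_c] using h

theorem exists_familySlopes (hF : SmoothFamily F) (h20 : pd₀ (F 0) 2 0 = 0)
    (h02 : pd₀ (F 0) 0 2 = 0) (hσ : σ = 1 ∨ σ = -1) (h11 : 0 < σ * pd₀ (F 0) 1 1) :
    ∃ K p r, FamilySlopes F σ K p r :=
  exists_smoothSlopes hσ (hF.smoothNear_famPd 2 0) (hF.smoothNear_famPd 1 1)
    (hF.smoothNear_famPd 0 2) h20 h02 h11

/-- The equation of the branch with asymptotic direction `(1, 0)` at the origin. -/
noncomputable abbrev eqn₁ (F : ℝ → ℝ × ℝ → ℝ) (p : ℝ × (ℝ × ℝ) → ℝ) := branchFn (famPd F) p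

/-- The equation of the branch with asymptotic direction `(0, 1)` at the origin. -/
noncomputable abbrev eqn₂ (F : ℝ → ℝ × ℝ → ℝ) (r : ℝ × (ℝ × ℝ) → ℝ) :=
  branchFn (fun i j => famPd F j i) r

theorem smooth_eqn₁ (hF : SmoothFamily F) (hs : FamilySlopes F σ K p r) :
    SmoothNear (eqn₁ F p) 0 := hF.pdFamily.smooth_branchFn hs.smoothp

theorem smooth_eqn₂ (hF : SmoothFamily F) (hs : FamilySlopes F σ K p r) :
    SmoothNear (eqn₂ F r) 0 := hF.pdFamily.swap.smooth_branchFn hs.smoothr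

theorem eqn₁_zero (hs : FamilySlopes F σ K p r) (z : pd₀ (F 0) 3 0 = 0) : eqn₁ F p 0 = 0 := by
  have : famPd F 3 0 0 = 0 := z
  simp [branchFn, hs.p_zero, this]

theorem eqn₂_zero (hs : FamilySlopes F σ K p r) (z : pd₀ (F 0) 0 3 = 0) : eqn₂ F r 0 = 0 := by
  have : famPd F 0 3 0 = 0 := z
  simp [branchFn, hs.r_zero, this]

theorem dx_eqn₁ (hF : SmoothFamily F) (hs : FamilySlopes F σ K p r) (z : pd₀ (F 0) 3 0 = 0) :
    lineD (0, (1, 0)) (eqn₁ F p) 0 = pd₀ (F 0) 4 0 := hF.pdFamily.lineD_fst_branchFn hs z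

theorem dy_eqn₁ (hF : SmoothFamily F) (hs : FamilySlopes F σ K p r) :
    lineD (0, (0, 1)) (eqn₁ F p) 0 = gradY (pd₀ (F 0)) := hF.pdFamily.lineD_snd_branchFn hs

theorem dx_eqn₂ (hF : SmoothFamily F) (hs : FamilySlopes F σ K p r) :
    lineD (0, (1, 0)) (eqn₂ F r) 0 = gradY (fun i j => pd₀ (F 0) j i) :=
  hF.pdFamily.swap.lineD_snd_branchFn hs.symm

theorem dy_eqn₂ (hF : SmoothFamily F) (hs : FamilySlopes F σ K p r) (z : pd₀ (F 0) 0 3 = 0) :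
    lineD (0, (0, 1)) (eqn₂ F r) 0 = pd₀ (F 0) 0 4 :=
  hF.pdFamily.swap.lineD_fst_branchFn hs.symm z

theorem deps_eqn₁ (hF : SmoothFamily F) (hs : FamilySlopes F σ K p r) :
    lineD (1, 0) (eqn₁ F p) 0 = pd₀ (velocity F) 3 0
      - 3 * pd₀ (F 0) 2 1 * pd₀ (velocity F) 2 0 / (2 * pd₀ (F 0) 1 1) := by
  rw [hF.pdFamily.lineD_branchFn hs, hF.lineD_eps, hF.lineD_eps]; rfl

theorem deps_eqn₂ (hF : SmoothFamily F) (hs : FamilySlopes F σ K p r) :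
    lineD (1, 0) (eqn₂ F r) 0 = pd₀ (velocity F) 0 3
      - 3 * pd₀ (F 0) 1 2 * pd₀ (velocity F) 0 2 / (2 * pd₀ (F 0) 1 1) := by
  rw [hF.pdFamily.swap.lineD_branchFn hs.symm, hF.lineD_eps, hF.lineD_eps]; rfl

theorem lineD_jac_eqn (hF : SmoothFamily F) (hs : FamilySlopes F σ K p r)
    (z₁ : pd₀ (F 0) 3 0 = 0) (z₂ : pd₀ (F 0) 0 3 = 0) :
    lineD (0, (-lineD (0, (0, 1)) (eqn₁ F p) 0, lineD (0, (1, 0)) (eqn₁ F p) 0))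
      (jac (eqn₁ F p) (eqn₂ F r)) 0 = foldNum (pd₀ (F 0)) := by
  rw [dy_eqn₁ hF hs, dx_eqn₁ hF hs z₁, lineD_jac (smooth_eqn₁ hF hs) (smooth_eqn₂ hF hs),
    dx_eqn₁ hF hs z₁, dy_eqn₁ hF hs, dx_eqn₂ hF hs, dy_eqn₂ hF hs z₂]
  have hw : ((0, (-gradY (pd₀ (F 0)), pd₀ (F 0) 4 0)) : ℝ × (ℝ × ℝ))
      = (-gradY (pd₀ (F 0))) • (0, (1, 0)) + (pd₀ (F 0) 4 0) • (0, (0, 1)) := by simp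
  have hw' : ((0, (-gradY (pd₀ (F 0)), pd₀ (F 0) 4 0)) : ℝ × (ℝ × ℝ))
      = (pd₀ (F 0) 4 0) • (0, (0, 1)) + (-gradY (pd₀ (F 0))) • (0, (1, 0)) := by simp
  have a1 := hF.pdFamily.lineD_comb_fst_branchFn hs (-gradY (pd₀ (F 0))) (pd₀ (F 0) 4 0)
  have a2 := hF.pdFamily.lineD_comb_snd_branchFn hs (-gradY (pd₀ (F 0))) (pd₀ (F 0) 4 0)
  have a3 := hF.pdFamily.swap.lineD_comb_fst_branchFn hs.symm (pd₀ (F 0) 4 0)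
    (-gradY (pd₀ (F 0)))
  have a4 := hF.pdFamily.swap.lineD_comb_snd_branchFn hs.symm (pd₀ (F 0) 4 0)
    (-gradY (pd₀ (F 0)))
  rw [← hw] at a1 a2
  rw [← hw'] at a3 a4
  rw [a1, a2, a3, a4]
  rfl

end HyperbonodeChart

section BiHyperbonode

variable {F : ℝ → ℝ × ℝ → ℝ} {σ : ℝ}

theorem BiHyperbonodeJet.det_eq_zero {f : ℝ × ℝ → ℝ} (h : BiHyperbonodeJet (jet f)) :
    pd₀ f 4 0 * pd₀ f 0 4 = gradY (pd₀ f) * gradY (fun i j => pd₀ f j i) := by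
  have h11 := h.1.values.2.2.1
  have h2 : 4 * pd₀ f 4 0 * pd₀ f 0 4 * pd₀ f 1 1 ^ 2
      - (3 * pd₀ f 2 1 ^ 2 - 2 * pd₀ f 3 1 * pd₀ f 1 1)
        * (3 * pd₀ f 1 2 ^ 2 - 2 * pd₀ f 1 3 * pd₀ f 1 1) = 0 := by
    simpa [Jet.u, Jet.v, jet_c] using h.2
  unfold gradY
  field_simp
  linear_combination h2

theorem gradY_ne_zero {f : ℝ × ℝ → ℝ} (h11 : pd₀ f 1 1 ≠ 0) (hu : (jet f).u ≠ 0) :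
    gradY (pd₀ f) ≠ 0 := by
  have hu' : 3 * pd₀ f 2 1 ^ 2 - 2 * pd₀ f 3 1 * pd₀ f 1 1 ≠ 0 := by
    simpa [Jet.u, jet_c] using hu
  intro h
  apply hu'
  unfold gradY at h
  field_simp at h
  linear_combination -h

theorem gradY_swap_ne_zero {f : ℝ × ℝ → ℝ} (h11 : pd₀ f 1 1 ≠ 0) (hv : (jet f).v ≠ 0) :
    gradY (fun i j => pd₀ f j i) ≠ 0 := by
  have hv' : 3 * pd₀ f 1 2 ^ 2 - 2 * pd₀ f 1 3 * pd₀ f 1 1 ≠ 0 := by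
    simpa [Jet.v, jet_c] using hv
  intro h
  apply hv'
  unfold gradY at h
  field_simp at h
  linear_combination -h

theorem tangentAt_left_right {f : ℝ × ℝ → ℝ} (hσ : σ = 1 ∨ σ = -1)
    (h : TangentAt (branch σ f) (branch (-σ) f) 0) : TangentAt (leftBranch f) (rightBranch f) 0 := by
  rcases hσ with rfl | rfl
  · exact h.symm
  · rwa [neg_neg] at h

theorem tangentAt_branches {K p r : ℝ × (ℝ × ℝ) → ℝ} (hF : SmoothFamily F)
    (hs : FamilySlopes F σ K p r) (hJ : BiHyperbonodeJet (jet (F 0)))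
    (h1 : pd₀ (F 0) 4 0 ≠ 0 ∨ gradY (pd₀ (F 0)) ≠ 0)
    (h2 : pd₀ (F 0) 0 4 ≠ 0 ∨ gradY (fun i j => pd₀ (F 0) j i) ≠ 0) :
    TangentAt (branch σ (F 0)) (branch (-σ) (F 0)) 0 := by
  obtain ⟨-, -, -, h30, h03⟩ := hJ.1.values
  refine tangentAt_zero (C₁ := fun ε => branch σ (F ε)) (C₂ := fun ε => branch (-σ) (F ε))
    (smooth_eqn₁ hF hs) (smooth_eqn₂ hF hs) hs.mem_branch hs.mem_branch_neg ?_ ?_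
    (eqn₁_zero hs h30) (eqn₂_zero hs h03) ?_
  · rw [dx_eqn₁ hF hs h30, dy_eqn₁ hF hs]; exact h1
  · rw [dx_eqn₂ hF hs, dy_eqn₂ hF hs h03]; exact h2.symm
  · rw [dx_eqn₁ hF hs h30, dy_eqn₁ hF hs, dx_eqn₂ hF hs, dy_eqn₂ hF hs h03]
    exact hJ.det_eq_zero

/-- At a bi-hyperbonode the two branches are smooth and tangent to each other. -/
theorem biHyperbonode_tangent {f : ℝ × ℝ → ℝ} (hf : SmoothGerm f) (hJ : BiHyperbonodeJet (jet f))
    (h1 : (jet f).c 4 0 ≠ 0 ∨ (jet f).u ≠ 0) (h2 : (jet f).c 0 4 ≠ 0 ∨ (jet f).v ≠ 0) :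
    IsHyperbonode f 0 ∧ TangentAt (leftBranch f) (rightBranch f) 0 := by
  obtain ⟨h20, h02, h11, h30, h03⟩ := hJ.1.values
  obtain ⟨σ, hσ, hpos⟩ := exists_sign h11
  have hF := hf.smoothFamily
  obtain ⟨K, p, r, hs⟩ := exists_familySlopes hF h20 h02 hσ hpos
  have hnode := hs.isHyperbonode_iff.self_of_nhds.2 ⟨eqn₁_zero hs h30, eqn₂_zero hs h03⟩
  refine ⟨hnode, tangentAt_left_right hσ (tangentAt_branches (F := fun _ => f) hF hs hJ ?_ ?_)⟩
  · rw [jet_c f (i := 4) (j := 0) (by norm_num)] at h1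
    exact h1.imp id (gradY_ne_zero h11)
  · rw [jet_c f (i := 0) (j := 4) (by norm_num)] at h2
    exact h2.imp id (gradY_swap_ne_zero h11)

theorem biHyperbonodeTransition_of_fold {g₁ g₂ : ℝ × (ℝ × ℝ) → ℝ} (hσ : σ = 1 ∨ σ = -1)
    (hfold : FoldTransition (fun s => g₁ s = 0 ∧ g₂ s = 0) (fun s => jac g₁ g₂ s ≠ 0))
    (h₁ : ∀ᶠ s in 𝓝 (0 : ℝ × (ℝ × ℝ)), s.2 ∈ branch σ (F s.1) →
      ∃ T, IsSmoothCurveAt (branch σ (F s.1)) s.2 T)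
    (h₂ : ∀ᶠ s in 𝓝 (0 : ℝ × (ℝ × ℝ)), s.2 ∈ branch (-σ) (F s.1) →
      ∃ T, IsSmoothCurveAt (branch (-σ) (F s.1)) s.2 T)
    (hnode : ∀ᶠ s in 𝓝 (0 : ℝ × (ℝ × ℝ)), IsHyperbonode (F s.1) s.2 ↔ g₁ s = 0 ∧ g₂ s = 0)
    (htr : ∀ᶠ s in 𝓝 (0 : ℝ × (ℝ × ℝ)), (g₁ s = 0 ∧ g₂ s = 0) → jac g₁ g₂ s ≠ 0 →
      TransverseAt (branch σ (F s.1)) (branch (-σ) (F s.1)) s.2)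
    (htan : TangentAt (branch σ (F 0)) (branch (-σ) (F 0)) 0) : BiHyperbonodeTransition F := by
  have hloc : ∀ᶠ s in 𝓝 (0 : ℝ × (ℝ × ℝ)),
      (s.2 ∈ leftBranch (F s.1) → ∃ T, IsSmoothCurveAt (leftBranch (F s.1)) s.2 T) ∧
      (s.2 ∈ rightBranch (F s.1) → ∃ T, IsSmoothCurveAt (rightBranch (F s.1)) s.2 T) ∧
      (IsHyperbonode (F s.1) s.2 ↔ g₁ s = 0 ∧ g₂ s = 0) ∧
      ((g₁ s = 0 ∧ g₂ s = 0) → jac g₁ g₂ s ≠ 0 →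
        TransverseAt (leftBranch (F s.1)) (rightBranch (F s.1)) s.2) := by
    filter_upwards [h₁, h₂, hnode, htr] with s a b c d
    rcases hσ with rfl | rfl
    · exact ⟨b, a, c, fun x y => (d x y).symm⟩
    · rw [neg_neg] at b d
      exact ⟨a, b, c, d⟩
  have htan' := tangentAt_left_right hσ htan
  rw [nhds_prod_eq, Prod.zero_eq_mk] at hloc
  obtain ⟨pa, hpa, pb, hpb, hab⟩ := eventually_prod_iff.1 hloc
  obtain ⟨τ, hτ, U, hU, hW⟩ := hfold
  refine ⟨τ, hτ, U ∩ {q | pb q}, inter_mem hU hpb, fun W hWn hWU => ?_⟩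
  filter_upwards [hW W hWn (hWU.trans Set.inter_subset_left), hpa] with ε ⟨c1, c2, c3⟩ hε
  have hq : ∀ q ∈ W, _ := fun q hq => hab hε (hWU hq).2
  have hset : {q ∈ W | IsHyperbonode (F ε) q} = {q ∈ W | g₁ (ε, q) = 0 ∧ g₂ (ε, q) = 0} := by
    ext q
    simp only [Set.mem_ofPred_eq]
    exact and_congr_right fun h => (hq q h).2.2.1
  refine ⟨fun q h => (hq q h).1, fun q h => (hq q h).2.1, ?_, ?_, ?_⟩
  · rw [hset]; exact c1
  · rintro rfl
    rw [hset]; exact ⟨c2 rfl, htan'⟩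
  · intro h
    obtain ⟨q₁, q₂, hne, he, hd1, hd2⟩ := c3 h
    have m1 : q₁ ∈ {q ∈ W | g₁ (ε, q) = 0 ∧ g₂ (ε, q) = 0} := by rw [he]; simp
    have m2 : q₂ ∈ {q ∈ W | g₁ (ε, q) = 0 ∧ g₂ (ε, q) = 0} := by rw [he]; simp
    exact ⟨q₁, q₂, hne, hset.trans he, (hq q₁ m1.1).2.2.2 m1.2 hd1, (hq q₂ m2.1).2.2.2 m2.2 hd2⟩

/-- The pairs of jets for which the bi-hyperbonode transition is guaranteed. -/
def biHyperbonodeGeneric : Set (Jet × Jet) :=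
  {s | s.1.c 1 1 ≠ 0 ∧ s.1.c 4 0 ≠ 0 ∧ s.1.c 0 4 ≠ 0 ∧ foldNum s.1.c ≠ 0 ∧
    speedNum s.1.c s.2.c ≠ 0}

theorem foldNum_jet (f : ℝ × ℝ → ℝ) : foldNum (jet f).c = foldNum (pd₀ f) := by
  simp [foldNum, hessX, hessY, gradY, jet_c]

theorem speedNum_jet (f g : ℝ × ℝ → ℝ) :
    speedNum (jet f).c (jet g).c = speedNum (pd₀ f) (pd₀ g) := by
  simp [speedNum, gradY, jet_c]

theorem biHyperbonodeTransition_of_generic (hF : SmoothFamily F)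
    (hJ : BiHyperbonodeJet (jet (F 0)))
    (hG : (jet (F 0), jet (velocity F)) ∈ biHyperbonodeGeneric) : BiHyperbonodeTransition F := by
  obtain ⟨h20, h02, h11, h30, h03⟩ := hJ.1.values
  obtain ⟨-, h40, h04, hQ, hR⟩ := hG
  simp only [foldNum_jet, speedNum_jet] at hQ hR
  rw [jet_c _ (i := 4) (j := 0) (by norm_num)] at h40
  rw [jet_c _ (i := 0) (j := 4) (by norm_num)] at h04
  obtain ⟨σ, hσ, hpos⟩ := exists_sign h11
  obtain ⟨K, p, r, hs⟩ := exists_familySlopes hF h20 h02 hσ hpos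
  have s₁ := smooth_eqn₁ hF hs
  have s₂ := smooth_eqn₂ hF hs
  have n₁ : lineD (0, (1, 0)) (eqn₁ F p) 0 ≠ 0 := by rw [dx_eqn₁ hF hs h30]; exact h40
  have n₂ : lineD (0, (0, 1)) (eqn₂ F r) 0 ≠ 0 := by rw [dy_eqn₂ hF hs h03]; exact h04
  refine biHyperbonodeTransition_of_fold hσ (g₁ := eqn₁ F p) (g₂ := eqn₂ F r)
    (foldTransition_of_jac s₁ s₂ (eqn₁_zero hs h30) (eqn₂_zero hs h03) ?_ n₁ ?_ ?_)
    ?_ ?_ hs.isHyperbonode_iff ?_ (tangentAt_branches hF hs hJ (Or.inl h40) (Or.inl h04))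
  · rw [jac, dx_eqn₁ hF hs h30, dy_eqn₁ hF hs, dx_eqn₂ hF hs, dy_eqn₂ hF hs h03, hJ.det_eq_zero]
    ring
  · rw [dx_eqn₁ hF hs h30, deps_eqn₁ hF hs, dx_eqn₂ hF hs, deps_eqn₂ hF hs]
    exact hR
  · rw [lineD_jac_eqn hF hs h30 h03]; exact hQ
  · exact (eventually_isSmoothCurveAt (C := fun ε => branch σ (F ε)) s₁ hs.mem_branch
      (Or.inl n₁)).mono fun s h hm => ⟨_, h hm⟩
  · exact (eventually_isSmoothCurveAt (C := fun ε => branch (-σ) (F ε)) s₂ hs.mem_branch_neg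
      (Or.inr n₂)).mono fun s h hm => ⟨_, h hm⟩
  · exact eventually_transverseAt (C₁ := fun ε => branch σ (F ε))
      (C₂ := fun ε => branch (-σ) (F ε)) s₁ s₂ hs.mem_branch hs.mem_branch_neg
      (Or.inl n₁) (Or.inr n₂)

theorem isOpen_biHyperbonodeGeneric : IsOpen biHyperbonodeGeneric := by
  have c1 : ∀ i j, Continuous fun s : Jet × Jet => s.1.c i j :=
    fun i j => (continuous_jet_c i j).comp continuous_fst
  have c2 : ∀ i j, Continuous fun s : Jet × Jet => s.2.c i j :=
    fun i j => (continuous_jet_c i j).comp continuous_snd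
  rw [isOpen_iff_mem_nhds]
  rintro s ⟨h11, h40, h04, hQ, hR⟩
  have a1 : ∀ i j, ContinuousAt (fun s : Jet × Jet => s.1.c i j) s :=
    fun i j => (c1 i j).continuousAt
  have a2 : ∀ i j, ContinuousAt (fun s : Jet × Jet => s.2.c i j) s :=
    fun i j => (c2 i j).continuousAt
  have d1 : 2 * s.1.c 1 1 ≠ 0 := mul_ne_zero two_ne_zero h11
  have d2 : 2 * s.1.c 1 1 ^ 2 ≠ 0 := mul_ne_zero two_ne_zero (pow_ne_zero 2 h11)
  have hQc : ContinuousAt (fun s : Jet × Jet => foldNum s.1.c) s := by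
    unfold foldNum hessX hessY hessForm gradY
    fun_prop (disch := assumption)
  have hRc : ContinuousAt (fun s : Jet × Jet => speedNum s.1.c s.2.c) s := by
    unfold speedNum gradY
    fun_prop (disch := assumption)
  filter_upwards [(a1 1 1).eventually_ne h11, (a1 4 0).eventually_ne h40,
    (a1 0 4).eventually_ne h04, hQc.eventually_ne hQ, hRc.eventually_ne hR] with t b1 b2 b3 b4 b5
  exact ⟨b1, b2, b3, b4, b5⟩

theorem biHyperbonodeJet_mem_closure {J : Jet} (hJ : BiHyperbonodeJet J) (V : Jet) :
    (J, V) ∈ closure {s : Jet × Jet | BiHyperbonodeJet s.1 ∧ s.1.c 4 0 ≠ 0 ∧ s.1.c 0 4 ≠ 0} := by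
  obtain ⟨⟨h20, h02, h11, h30, h03⟩, hdet⟩ := hJ
  obtain ⟨l, m, x, y, e1, e2, e3, e4⟩ : ∃ l m x y : ℝ, J.c 4 0 = l * x ∧
      gradY J.c = l * y ∧ gradY (fun i j => J.c j i) = m * x ∧ J.c 0 4 = m * y := by
    apply exists_outer_product
    unfold Jet.u Jet.v at hdet
    unfold gradY
    field_simp
    linear_combination hdet
  let γ : ℝ → Jet := fun t => Function.update (Function.update (Function.update (Function.update J
    ⟨(4, 0), by norm_num⟩ ((l + t) * (x + t)))
    ⟨(3, 1), by norm_num⟩ (3 * J.c 2 1 * J.c 2 1 / (2 * J.c 1 1) + (l + t) * (y + t)))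
    ⟨(1, 3), by norm_num⟩ (3 * J.c 1 2 * J.c 1 2 / (2 * J.c 1 1) + (m + t) * (x + t)))
    ⟨(0, 4), by norm_num⟩ ((m + t) * (y + t))
  have hγ : Continuous γ := by
    refine (((continuous_const.update _ ?_).update _ ?_).update _ ?_).update _ ?_ <;> fun_prop
  have hγ0 : γ 0 = J := by
    simp only [γ, add_zero]
    rw [← e1, ← e2, ← e3, ← e4, update_self_eq J _ rfl, update_self_eq J, update_self_eq J,
      update_self_eq J _ rfl]
    · unfold gradY; ring
    · unfold gradY; ring
  have hc : ∀ t, γ t ∈ {J' : Jet | BiHyperbonodeJet J'} := by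
    intro t
    simp only [BiHyperbonodeJet, HyperbonodeJet, Jet.u, Jet.v, γ, jet_c_update, Set.mem_ofPred_eq]
    norm_num
    refine ⟨⟨h20, h02, h11, h30, h03⟩, ?_⟩
    field_simp
    ring
  have key : (γ 0, V) ∈ closure {s : Jet × Jet | BiHyperbonodeJet s.1 ∧ s.1.c 4 0 ≠ 0 ∧
      s.1.c 0 4 ≠ 0} := by
    refine mem_closure_of_curve (γ := fun t => (γ t, V)) (by fun_prop) ?_
    filter_upwards [eventually_affine_ne_zero l one_ne_zero, eventually_affine_ne_zero m one_ne_zero,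
      eventually_affine_ne_zero x one_ne_zero, eventually_affine_ne_zero y one_ne_zero]
      with t b1 b2 b3 b4
    rw [one_mul] at b1 b2 b3 b4
    refine ⟨hc t, ?_, ?_⟩
    · simp only [γ, jet_c_update]
      norm_num
      exact ⟨b1, b3⟩
    · simp only [γ, jet_c_update]
      norm_num
      exact ⟨b2, b4⟩
  rwa [hγ0] at key

theorem biHyperbonodeGeneric_dense : {s : Jet × Jet | BiHyperbonodeJet s.1} ⊆
    closure (biHyperbonodeGeneric ∩ {s : Jet × Jet | BiHyperbonodeJet s.1}) := by
  set A₁ := {s : Jet × Jet | BiHyperbonodeJet s.1 ∧ s.1.c 4 0 ≠ 0 ∧ s.1.c 0 4 ≠ 0} with hA₁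
  set A₂ := {s : Jet × Jet | s ∈ A₁ ∧ foldNum s.1.c ≠ 0} with hA₂
  have h01 : {s : Jet × Jet | BiHyperbonodeJet s.1} ⊆ closure A₁ :=
    fun s hs => biHyperbonodeJet_mem_closure hs s.2
  have h12 : A₁ ⊆ closure A₂ := by
    rintro ⟨J, V⟩ ⟨hJ, h40, h04⟩
    let γ : ℝ → Jet := fun t => Function.update J ⟨(0, 5), by norm_num⟩ (J.c 0 5 + t)
    have hγ0 : γ 0 = J := by simp only [γ, add_zero]; exact update_self_eq J _ rfl
    have key : (γ 0, V) ∈ closure A₂ := by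
      refine mem_closure_of_curve (γ := fun t => (γ t, V)) ?_ ?_
      · have : Continuous γ := continuous_const.update _ (by fun_prop)
        fun_prop
      filter_upwards [eventually_affine_ne_zero (foldNum J.c) (pow_ne_zero 2 h40)] with t ht
      refine ⟨⟨?_, ?_, ?_⟩, ?_⟩
      · simpa [γ, BiHyperbonodeJet, HyperbonodeJet, Jet.u, Jet.v, jet_c_update] using hJ
      · simpa [γ, jet_c_update] using h40
      · simpa [γ, jet_c_update] using h04
      · convert ht using 1
        simp only [γ, foldNum, hessX, hessY, hessForm, gradY, jet_c_update]
        norm_num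
        ring
    rwa [hγ0] at key
  have h23 : A₂ ⊆ closure (biHyperbonodeGeneric ∩ {s : Jet × Jet | BiHyperbonodeJet s.1}) := by
    rintro ⟨J, V⟩ ⟨⟨hJ, h40, h04⟩, hQ⟩
    let γ : ℝ → Jet := fun t => Function.update V ⟨(0, 3), by norm_num⟩ (V.c 0 3 + t)
    have hγ0 : γ 0 = V := by simp only [γ, add_zero]; exact update_self_eq V _ rfl
    have key : (J, γ 0) ∈ closure (biHyperbonodeGeneric ∩
        {s : Jet × Jet | BiHyperbonodeJet s.1}) := by
      refine mem_closure_of_curve (γ := fun t => (J, γ t)) ?_ ?_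
      · have : Continuous γ := continuous_const.update _ (by fun_prop)
        fun_prop
      filter_upwards [eventually_affine_ne_zero (speedNum J.c V.c) (neg_ne_zero.2 h40)] with t ht
      refine ⟨⟨hJ.1.2.2.1, h40, h04, hQ, ?_⟩, hJ⟩
      convert ht using 1
      simp only [γ, speedNum, jet_c_update]
      norm_num
      ring
    rwa [hγ0] at key
  exact h01.trans (closure_minimal (h12.trans (closure_minimal h23 isClosed_closure))
    isClosed_closure)

theorem biHyperbonode_generic : ForGenericFamily BiHyperbonodeJet BiHyperbonodeTransition :=
  ⟨biHyperbonodeGeneric, isOpen_biHyperbonodeGeneric, biHyperbonodeGeneric_dense,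
    fun _ hF hJ hG => biHyperbonodeTransition_of_generic hF hJ hG⟩

end BiHyperbonode

section FlecHyperbonode

variable {F : ℝ → ℝ × ℝ → ℝ} {σ : ℝ} {K p r : ℝ × (ℝ × ℝ) → ℝ}

theorem FlecHyperbonodeJet.values {f : ℝ × ℝ → ℝ} (h : FlecHyperbonodeJet (jet f)) :
    pd₀ f 4 0 = 0 ∧ pd₀ f 5 0 ≠ 0 ∧ gradY (pd₀ f) ≠ 0 ∧ gradY (fun i j => pd₀ f j i) ≠ 0 := by
  obtain ⟨h0, h40, h50, huv⟩ := h
  rw [jet_c f (i := 4) (j := 0) (by norm_num)] at h40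
  rw [jet_c f (i := 5) (j := 0) (by norm_num)] at h50
  have h11 := h0.values.2.2.1
  exact ⟨h40, h50, gradY_ne_zero h11 (left_ne_zero_of_mul huv),
    gradY_swap_ne_zero h11 (right_ne_zero_of_mul huv)⟩

/-- The `y`-derivative at the origin of the quartic form on the asymptotic direction `(1, 0)`. -/
noncomputable def flecGradY (c : ℕ → ℕ → ℝ) : ℝ := c 4 1 - 4 * c 3 1 * c 2 1 / (2 * c 1 1)

theorem dx_flecFn (hF : SmoothFamily F) (hs : FamilySlopes F σ K p r) (z : pd₀ (F 0) 3 0 = 0) :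
    lineD (0, (1, 0)) (flecFn (famPd F) p) 0 = pd₀ (F 0) 5 0 := by
  have hP := hF.pdFamily
  have z' : famPd F 3 0 0 = 0 := z
  rw [hP.lineD_flecFn hs, (hP.fst 4 0).eq_of_nhds, (hP.fst 2 0).eq_of_nhds, z', mul_zero,
    zero_div, sub_zero]
  rfl

theorem dy_flecFn (hF : SmoothFamily F) (hs : FamilySlopes F σ K p r) :
    lineD (0, (0, 1)) (flecFn (famPd F) p) 0 = flecGradY (pd₀ (F 0)) := by
  have hP := hF.pdFamily
  rw [hP.lineD_flecFn hs, (hP.snd 4 0).eq_of_nhds, (hP.snd 2 0).eq_of_nhds]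
  rfl

theorem deps_flecFn (hF : SmoothFamily F) (hs : FamilySlopes F σ K p r) :
    lineD (1, 0) (flecFn (famPd F) p) 0 = pd₀ (velocity F) 4 0
      - 4 * pd₀ (F 0) 3 1 * pd₀ (velocity F) 2 0 / (2 * pd₀ (F 0) 1 1) := by
  rw [hF.pdFamily.lineD_flecFn hs, hF.lineD_eps, hF.lineD_eps]; rfl

theorem tendsto_graph {b : ℝ → ℝ × ℝ} (hb : ContinuousAt b 0) (b0 : b 0 = 0) :
    Tendsto (fun ε => (ε, b ε)) (𝓝 0) (𝓝 (0 : ℝ × (ℝ × ℝ))) := by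
  have : ContinuousAt (fun ε => (ε, b ε)) 0 := continuousAt_id.prodMk hb
  have h := this.tendsto
  simp only [b0] at h
  exact h

/-- The hyperbonode and the biflecnode near a flec-hyperbonode, the latter with its equations. -/
theorem exists_hyperbonode_biflecnode (hF : SmoothFamily F) (hσ : σ = 1 ∨ σ = -1)
    (hs : FamilySlopes F σ K p r) (hJ : FlecHyperbonodeJet (jet (F 0))) :
    ∃ h b : ℝ → ℝ × ℝ, HyperbonodeBiflecnodeOverlap F σ h b ∧
      ∀ᶠ ε in 𝓝 (0 : ℝ), eqn₁ F p (ε, b ε) = 0 ∧ flecFn (famPd F) p (ε, b ε) = 0 := by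
  obtain ⟨h20, h02, h11, h30, h03⟩ := hJ.1.values
  obtain ⟨h40, h50, hα, hβ⟩ := hJ.values
  have s₁ := smooth_eqn₁ hF hs
  have s₂ := smooth_eqn₂ hF hs
  have s₃ : SmoothNear (flecFn (famPd F) p) 0 := hF.pdFamily.smooth_flecFn hs.smoothp
  have z₁ : eqn₁ F p 0 = 0 := eqn₁_zero hs h30
  have z₂ : eqn₂ F r 0 = 0 := eqn₂_zero hs h03
  have z₃ : flecFn (famPd F) p 0 = 0 := by
    have : famPd F 4 0 0 = 0 := h40
    simp [flecFn, hs.p_zero, this]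
  have j₁ : jac (eqn₁ F p) (eqn₂ F r) 0 ≠ 0 := by
    rw [jac, dx_eqn₁ hF hs h30, dy_eqn₁ hF hs, dx_eqn₂ hF hs, dy_eqn₂ hF hs h03, h40, zero_mul,
      zero_sub]
    exact neg_ne_zero.2 (mul_ne_zero hα hβ)
  have j₂ : jac (eqn₁ F p) (flecFn (famPd F) p) 0 ≠ 0 := by
    rw [jac, dx_eqn₁ hF hs h30, dy_eqn₁ hF hs, dx_flecFn hF hs h30, dy_flecFn hF hs, h40, zero_mul,
      zero_sub]
    exact neg_ne_zero.2 (mul_ne_zero hα h50)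
  have n₁ : lineD (0, (0, 1)) (eqn₁ F p) 0 ≠ 0 := by rw [dy_eqn₁ hF hs]; exact hα
  have n₂ : lineD (0, (1, 0)) (eqn₂ F r) 0 ≠ 0 := by rw [dx_eqn₂ hF hs]; exact hβ
  obtain ⟨h, hh, h0, hiff⟩ := exists_implicit s₁ s₂ z₁ z₂ j₁
  obtain ⟨b, hb, b0, hiff'⟩ := exists_implicit s₁ s₃ z₁ z₃ j₂
  have hth := tendsto_graph hh.self_of_nhds.continuousAt h0
  have htb := tendsto_graph hb.self_of_nhds.continuousAt b0
  have hb' : ∀ᶠ ε in 𝓝 (0 : ℝ), eqn₁ F p (ε, b ε) = 0 ∧ flecFn (famPd F) p (ε, b ε) = 0 :=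
    (htb.eventually hiff').mono fun ε hε => hε.2 rfl
  have hh' : ∀ᶠ ε in 𝓝 (0 : ℝ), eqn₁ F p (ε, h ε) = 0 ∧ eqn₂ F r (ε, h ε) = 0 :=
    (hth.eventually hiff).mono fun ε hε => hε.2 rfl
  refine ⟨h, b, ⟨hh, hb, h0, b0, ?_⟩, hb'⟩
  have hsm₁ := eventually_isSmoothCurveAt (C := fun ε => branch σ (F ε)) s₁ hs.mem_branch
    (Or.inr n₁)
  have hsm₂ := eventually_isSmoothCurveAt (C := fun ε => branch (-σ) (F ε)) s₂ hs.mem_branch_neg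
    (Or.inl n₂)
  have htr := eventually_transverseAt (C₁ := fun ε => branch σ (F ε))
    (C₂ := fun ε => branch (-σ) (F ε)) s₁ s₂ hs.mem_branch hs.mem_branch_neg
    (Or.inr n₁) (Or.inl n₂)
  have hloc : ∀ᶠ s in 𝓝 (0 : ℝ × (ℝ × ℝ)),
      (s.2 ∈ leftBranch (F s.1) → ∃ T, IsSmoothCurveAt (leftBranch (F s.1)) s.2 T) ∧
      (s.2 ∈ rightBranch (F s.1) → ∃ T, IsSmoothCurveAt (rightBranch (F s.1)) s.2 T) ∧
      (IsHyperbonode (F s.1) s.2 ↔ s.2 = h s.1) ∧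
      (s.2 ∈ biflecnodes σ (F s.1) ↔ s.2 = b s.1) := by
    filter_upwards [hsm₁, hsm₂, hs.isHyperbonode_iff, hiff, hs.mem_biflecnodes, hiff']
      with s a1 a2 a3 a4 a5 a6
    rcases hσ with rfl | rfl
    · exact ⟨fun m => ⟨_, a2 m⟩, fun m => ⟨_, a1 m⟩, a3.trans a4, a5.trans a6⟩
    · rw [neg_neg] at a2
      exact ⟨fun m => ⟨_, a1 m⟩, fun m => ⟨_, a2 m⟩, a3.trans a4, a5.trans a6⟩
  have htrε : ∀ᶠ ε in 𝓝 (0 : ℝ), TransverseAt (leftBranch (F ε)) (rightBranch (F ε)) (h ε) := by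
    filter_upwards [hth.eventually htr, hh',
      hth.eventually ((s₁.jac s₂).continuousAt.eventually_ne j₁)] with ε a1 a2 a3
    have := a1 a2 a3
    rcases hσ with rfl | rfl
    · exact this.symm
    · rwa [neg_neg] at this
  have hsimple : ∀ᶠ ε in 𝓝 (0 : ℝ), b ε ∈ simpleBiflecnodes σ (F ε) := by
    filter_upwards [htb.eventually (hs.mem_simpleBiflecnodes hF h50), hb'] with ε a1 a2
    exact a1 a2.1 a2.2
  rw [nhds_prod_eq, Prod.zero_eq_mk] at hloc
  obtain ⟨pa, hpa, pb, hpb, hab⟩ := eventually_prod_iff.1 hloc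
  have hhU : ∀ᶠ ε in 𝓝 (0 : ℝ), pb (h ε) := by
    have := hh.self_of_nhds.continuousAt.tendsto
    rw [h0] at this
    exact this.eventually hpb
  have hbU : ∀ᶠ ε in 𝓝 (0 : ℝ), pb (b ε) := by
    have := hb.self_of_nhds.continuousAt.tendsto
    rw [b0] at this
    exact this.eventually hpb
  refine ⟨{q | pb q}, hpb, ?_⟩
  filter_upwards [hpa, hhU, hbU, htrε, hsimple] with ε hε a1 a2 a3 a4
  have hq : ∀ q, pb q → _ := fun q hq => hab hε hq
  refine ⟨fun q m => (hq q m).1, fun q m => (hq q m).2.1, ?_, a3, ?_, a4⟩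
  · ext q
    simp only [Set.mem_ofPred_eq, Set.mem_singleton_iff]
    constructor
    · rintro ⟨m, hn⟩; exact (hq q m).2.2.1.1 hn
    · rintro rfl; exact ⟨a1, (hq _ a1).2.2.1.2 rfl⟩
  · ext q
    simp only [Set.mem_ofPred_eq, Set.mem_singleton_iff]
    constructor
    · rintro ⟨m, hn⟩; exact (hq q m).2.2.2.1 hn
    · rintro rfl; exact ⟨a2, (hq _ a2).2.2.2.2 rfl⟩

/-- In every family through a flec-hyperbonode there are one hyperbonode and one biflecnode. -/
theorem flecHyperbonode_overlap (hF : SmoothFamily F) (hJ : FlecHyperbonodeJet (jet (F 0)))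
    (hσ : σ = 1 ∨ σ = -1) (hpos : 0 < σ * (jet (F 0)).c 1 1) :
    ∃ h b : ℝ → ℝ × ℝ, HyperbonodeBiflecnodeOverlap F σ h b := by
  obtain ⟨h20, h02, -, -, -⟩ := hJ.1.values
  rw [jet_c _ (i := 1) (j := 1) (by norm_num)] at hpos
  obtain ⟨K, p, r, hs⟩ := exists_familySlopes hF h20 h02 hσ hpos
  obtain ⟨h, b, ho, -⟩ := exists_hyperbonode_biflecnode hF hσ hs hJ
  exact ⟨h, b, ho⟩

/-- The speed at `ε = 0`, in the direction of `y`, of the biflecnode at a flec-hyperbonode. -/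
noncomputable def flecSpeedY (c V : ℕ → ℕ → ℝ) : ℝ :=
  -(V 3 0 - 3 * c 2 1 * V 2 0 / (2 * c 1 1)) / gradY c

/-- The speed at `ε = 0`, in the direction of `x`, of the biflecnode at a flec-hyperbonode. -/
noncomputable def flecSpeedX (c V : ℕ → ℕ → ℝ) : ℝ :=
  -(V 4 0 - 4 * c 3 1 * V 2 0 / (2 * c 1 1) + flecGradY c * flecSpeedY c V) / c 5 0

/-- The speed with which the biflecnode crosses the other branch. -/
noncomputable def crossNum (c V : ℕ → ℕ → ℝ) : ℝ :=
  V 0 3 - 3 * c 1 2 * V 0 2 / (2 * c 1 1) + gradY (fun i j => c j i) * flecSpeedX c V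
    + c 0 4 * flecSpeedY c V

theorem crossNum_jet (f g : ℝ × ℝ → ℝ) :
    crossNum (jet f).c (jet g).c = crossNum (pd₀ f) (pd₀ g) := by
  simp [crossNum, flecSpeedX, flecSpeedY, flecGradY, gradY, jet_c]

theorem crossesBranch_of_crossNum (hF : SmoothFamily F) (hs : FamilySlopes F σ K p r)
    (hJ : FlecHyperbonodeJet (jet (F 0))) (hV : crossNum (pd₀ (F 0)) (pd₀ (velocity F)) ≠ 0)
    {b : ℝ → ℝ × ℝ} (hb : DifferentiableAt ℝ b 0) (b0 : b 0 = 0)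
    (hz : ∀ᶠ ε in 𝓝 (0 : ℝ), eqn₁ F p (ε, b ε) = 0 ∧ flecFn (famPd F) p (ε, b ε) = 0) :
    CrossesBranch F (-σ) b := by
  obtain ⟨h20, h02, h11, h30, h03⟩ := hJ.1.values
  obtain ⟨h40, h50, hα, hβ⟩ := hJ.values
  have s₁ := smooth_eqn₁ hF hs
  have s₂ := smooth_eqn₂ hF hs
  have s₃ : SmoothNear (flecFn (famPd F) p) 0 := hF.pdFamily.smooth_flecFn hs.smoothp
  set x' := deriv (fun ε => (b ε).1) 0 with hx'
  set y' := deriv (fun ε => (b ε).2) 0 with hy'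
  have hc : HasDerivAt (fun ε => (ε, b ε)) (1, (x', y')) 0 :=
    (hasDerivAt_id (0 : ℝ)).prodMk (hb.fst.hasDerivAt.prodMk hb.snd.hasDerivAt)
  have hc0 : ((0, b 0) : ℝ × (ℝ × ℝ)) = 0 := by rw [b0]; rfl
  have hchain : ∀ g : ℝ × (ℝ × ℝ) → ℝ, SmoothNear g 0 → HasDerivAt (fun ε => g (ε, b ε))
      (lineD (1, 0) g 0 + x' * lineD (0, (1, 0)) g 0 + y' * lineD (0, (0, 1)) g 0) 0 := by
    intro g hg
    have := hasDerivAt_comp_curve (H := g) (c := fun ε => (ε, b ε)) (t := 0)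
      (by rw [hc0]; exact hg.differentiableAt) hc
    rw [hc0, one_mul] at this
    exact this
  have hvan : ∀ g : ℝ × (ℝ × ℝ) → ℝ, SmoothNear g 0 → (∀ᶠ ε in 𝓝 (0 : ℝ), g (ε, b ε) = 0) →
      lineD (1, 0) g 0 + x' * lineD (0, (1, 0)) g 0 + y' * lineD (0, (0, 1)) g 0 = 0 :=
    fun g hg h0 => (hchain g hg).unique ((hasDerivAt_const 0 (0 : ℝ)).congr_of_eventuallyEq h0)
  have e₁ := hvan _ s₁ (hz.mono fun _ h => h.1)
  have e₃ := hvan _ s₃ (hz.mono fun _ h => h.2)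
  rw [deps_eqn₁ hF hs, dx_eqn₁ hF hs h30, dy_eqn₁ hF hs, h40] at e₁
  rw [deps_flecFn hF hs, dx_flecFn hF hs h30, dy_flecFn hF hs] at e₃
  have ey : y' = flecSpeedY (pd₀ (F 0)) (pd₀ (velocity F)) := by
    unfold flecSpeedY
    rw [eq_div_iff hα]
    linear_combination e₁
  have ex : x' = flecSpeedX (pd₀ (F 0)) (pd₀ (velocity F)) := by
    unfold flecSpeedX
    rw [eq_div_iff h50, ← ey]
    linear_combination e₃
  refine ⟨fun ε q => eqn₂ F r (ε, q), s₂, fun h0 => ?_, hs.mem_branch_neg, ?_, ?_⟩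
  · have e := fderiv_slice s₂.differentiableAt (1, 0)
    rw [dx_eqn₂ hF hs] at e
    apply hβ
    rw [← e]
    have h0' : fderiv ℝ (fun q => eqn₂ F r ((0 : ℝ × (ℝ × ℝ)).1, q)) (0 : ℝ × (ℝ × ℝ)).2 = 0 := h0
    rw [h0']; rfl
  · have := eqn₂_zero hs h03
    rw [← hc0] at this
    exact this
  · rw [(hchain _ s₂).deriv, deps_eqn₂ hF hs, dx_eqn₂ hF hs, dy_eqn₂ hF hs h03, ex, ey]
    intro h0
    apply hV
    unfold crossNum
    linear_combination h0

/-- For generic velocities the biflecnode crosses the other branch. -/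
theorem flecHyperbonode_crosses (J : Jet) : ∃ V : Set Jet, IsOpen V ∧ Dense V ∧
    ∀ F : ℝ → ℝ × ℝ → ℝ, SmoothFamily F → FlecHyperbonodeJet J → jet (F 0) = J →
      jet (velocity F) ∈ V → ∀ s : ℝ, (s = 1 ∨ s = -1) → 0 < s * J.c 1 1 →
      ∃ h b : ℝ → ℝ × ℝ, HyperbonodeBiflecnodeOverlap F s h b ∧ CrossesBranch F (-s) b := by
  refine ⟨{V | crossNum J.c V.c ≠ 0}, ?_, ?_, ?_⟩
  · have hc : Continuous fun V : Jet => crossNum J.c V.c := by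
      have := continuous_jet_c
      unfold crossNum flecSpeedX flecSpeedY
      fun_prop
    exact isOpen_ne_fun hc continuous_const
  · intro V
    let γ : ℝ → Jet := fun t => Function.update V ⟨(0, 3), by norm_num⟩ (V.c 0 3 + t)
    have hγ0 : γ 0 = V := by simp only [γ, add_zero]; exact update_self_eq V _ rfl
    rw [← hγ0]
    refine mem_closure_of_curve (continuous_const.update _ (by fun_prop)) ?_
    filter_upwards [eventually_affine_ne_zero (crossNum J.c V.c) one_ne_zero] with t ht
    convert ht using 1
    simp only [γ, crossNum, flecSpeedX, flecSpeedY, jet_c_update]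
    norm_num
    ring
  · rintro F hF hJ rfl hV s hσ hpos
    obtain ⟨h20, h02, -, -, -⟩ := hJ.1.values
    rw [jet_c _ (i := 1) (j := 1) (by norm_num)] at hpos
    obtain ⟨K, p, r, hs⟩ := exists_familySlopes hF h20 h02 hσ hpos
    obtain ⟨h, b, ho, hz⟩ := exists_hyperbonode_biflecnode hF hσ hs hJ
    refine ⟨h, b, ho, crossesBranch_of_crossNum hF hs hJ ?_ ?_ ho.2.2.2.1 hz⟩
    · rw [← crossNum_jet]; exact hV
    · exact ho.2.1.self_of_nhds.differentiableAt (by simp)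

end FlecHyperbonode

section Elliptic

variable {f : ℝ × ℝ → ℝ} {q : ℝ × ℝ} {F : ℝ → ℝ × ℝ → ℝ}

/-- Real part of the complex asymptotic slopes of a family. -/
noncomputable def slopeRe (F : ℝ → ℝ × ℝ → ℝ) : ℝ × (ℝ × ℝ) → ℝ :=
  fun s => -famPd F 1 1 s / famPd F 0 2 s

/-- Imaginary part of the complex asymptotic slopes of a family. -/
noncomputable def slopeIm (F : ℝ → ℝ × ℝ → ℝ) : ℝ × (ℝ × ℝ) → ℝ :=
  fun s => Real.sqrt (famPd F 2 0 s * famPd F 0 2 s - famPd F 1 1 s ^ 2) / famPd F 0 2 s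

/-- Real part of the cubic form on the complex asymptotic directions. -/
noncomputable def ellRe (F : ℝ → ℝ × ℝ → ℝ) : ℝ × (ℝ × ℝ) → ℝ := fun s =>
  famPd F 3 0 s * 1 + famPd F 2 1 s * (3 * slopeRe F s)
    + famPd F 1 2 s * (3 * (slopeRe F s * slopeRe F s - slopeIm F s * slopeIm F s))
    + famPd F 0 3 s * (slopeRe F s * slopeRe F s * slopeRe F s
      - 3 * (slopeRe F s * (slopeIm F s * slopeIm F s)))

/-- Imaginary part of the cubic form on the complex asymptotic directions. -/
noncomputable def ellIm (F : ℝ → ℝ × ℝ → ℝ) : ℝ × (ℝ × ℝ) → ℝ := fun s =>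
  famPd F 3 0 s * 0 + famPd F 2 1 s * (3 * slopeIm F s)
    + famPd F 1 2 s * (6 * (slopeRe F s * slopeIm F s))
    + famPd F 0 3 s * (3 * (slopeRe F s * slopeRe F s * slopeIm F s)
      - slopeIm F s * slopeIm F s * slopeIm F s)

theorem ellSlope_eq (F : ℝ → ℝ × ℝ → ℝ) (s : ℝ × (ℝ × ℝ)) :
    ellSlope (F s.1) s.2 = (slopeRe F s : ℂ) + Complex.I * (slopeIm F s : ℂ) := by
  unfold ellSlope slopeRe slopeIm famPd
  push_cast
  ring

theorem ellCubic_eq (F : ℝ → ℝ × ℝ → ℝ) (s : ℝ × (ℝ × ℝ)) :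
    ellCubic (F s.1) s.2 = (ellRe F s : ℂ) + Complex.I * (ellIm F s : ℂ) := by
  have hI := Complex.I_sq
  have hI3 : Complex.I ^ 3 = -Complex.I := Complex.I_pow_three
  unfold ellCubic
  rw [ellSlope_eq]
  unfold ellRe ellIm famPd
  push_cast
  linear_combination
    (3 * ((pd 1 2 (F s.1) s.2 : ℝ) : ℂ) * (slopeIm F s : ℂ) ^ 2
      + 3 * ((pd 0 3 (F s.1) s.2 : ℝ) : ℂ) * (slopeRe F s : ℂ) * (slopeIm F s : ℂ) ^ 2) * hI
    + ((pd 0 3 (F s.1) s.2 : ℝ) : ℂ) * (slopeIm F s : ℂ) ^ 3 * hI3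

theorem ellCubic_eq_zero_iff (F : ℝ → ℝ × ℝ → ℝ) (s : ℝ × (ℝ × ℝ)) :
    ellCubic (F s.1) s.2 = 0 ↔ ellRe F s = 0 ∧ ellIm F s = 0 := by
  rw [ellCubic_eq, Complex.ext_iff]
  simp

theorem isNode_iff_of_isElliptic {s : ℝ × (ℝ × ℝ)} (h : IsElliptic (F s.1) s.2) :
    IsNode (F s.1) s.2 ↔ ellRe F s = 0 ∧ ellIm F s = 0 := by
  have hC : famPd F 0 2 s ≠ 0 := by
    intro h0
    unfold famPd at h0
    unfold IsElliptic at h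
    rw [h0] at h
    nlinarith [sq_nonneg (pd 1 1 (F s.1) s.2)]
  have hD : 0 < famPd F 2 0 s * famPd F 0 2 s - famPd F 1 1 s ^ 2 := h
  have hτ : slopeIm F s ≠ 0 := div_ne_zero (Real.sqrt_pos.2 hD).ne' hC
  have hB : famPd F 1 1 s = -(famPd F 0 2 s * slopeRe F s) := by
    unfold slopeRe; field_simp
  have hA : famPd F 2 0 s = famPd F 0 2 s * (slopeRe F s ^ 2 + slopeIm F s ^ 2) := by
    unfold slopeRe slopeIm
    rw [div_pow, div_pow, Real.sq_sqrt hD.le]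
    field_simp
    ring
  have hquad : ∀ u : ℝ × ℝ, quad (F s.1) s.2 u
      = famPd F 2 0 s * u.1 ^ 2 + 2 * famPd F 1 1 s * u.1 * u.2 + famPd F 0 2 s * u.2 ^ 2 :=
    fun u => rfl
  have hcub : ∀ u : ℝ × ℝ, cubic (F s.1) s.2 u = famPd F 3 0 s * u.1 ^ 3
      + 3 * famPd F 2 1 s * u.1 ^ 2 * u.2 + 3 * famPd F 1 2 s * u.1 * u.2 ^ 2
      + famPd F 0 3 s * u.2 ^ 3 := fun u => rfl
  unfold ellRe ellIm
  generalize slopeRe F s = ρ at *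
  generalize slopeIm F s = τ at *
  constructor
  · rintro ⟨a, b, hab⟩
    have e1 := hab (1, 0)
    have e2 := hab (0, 1)
    have e3 := hab (1, 1)
    have e4 := hab (1, -1)
    rw [hcub, hquad, hA, hB] at e1 e2 e3 e4
    simp only at e1 e2 e3 e4
    have c30 : famPd F 3 0 s = a * (famPd F 0 2 s * (ρ ^ 2 + τ ^ 2)) := by linear_combination e1
    have c03 : famPd F 0 3 s = b * famPd F 0 2 s := by linear_combination e2
    have c21 : famPd F 2 1 s = (-2 * a * (famPd F 0 2 s * ρ)
        + b * (famPd F 0 2 s * (ρ ^ 2 + τ ^ 2))) / 3 := by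
      linear_combination e3 / 6 - e4 / 6 - e2 / 3
    have c12 : famPd F 1 2 s = (a * famPd F 0 2 s - 2 * b * (famPd F 0 2 s * ρ)) / 3 := by
      linear_combination e3 / 6 + e4 / 6 - e1 / 3
    rw [c30, c03, c21, c12]
    constructor <;> ring
  · rintro ⟨h1, h2⟩
    set C := famPd F 0 2 s with hCdef
    set b := famPd F 0 3 s / C with hb
    set a := (3 * famPd F 1 2 s + 2 * b * (C * ρ)) / C with ha
    have eb : famPd F 0 3 s = b * C := by rw [hb]; field_simp
    have ea : famPd F 1 2 s = (a * C - 2 * b * (C * ρ)) / 3 := by rw [ha]; field_simp; ring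
    rw [eb, ea] at h1 h2
    have f2 : τ * (3 * famPd F 2 1 s + 2 * a * (C * ρ) - b * (C * (ρ ^ 2 + τ ^ 2))) = 0 := by
      linear_combination h2
    have f2' := (mul_eq_zero.1 f2).resolve_left hτ
    have e21 : famPd F 2 1 s = (-2 * a * (C * ρ) + b * (C * (ρ ^ 2 + τ ^ 2))) / 3 := by
      linear_combination f2' / 3
    rw [e21] at h1
    refine ⟨a, b, fun u => ?_⟩
    rw [hcub, hquad, hA, hB, eb, ea, e21]
    linear_combination u.1 ^ 3 * h1

end Elliptic

section EllipticDerivatives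

/-- A smooth function whose derivatives in the plane variables vanish at the origin. -/
structure Stationary (φ : ℝ × (ℝ × ℝ) → ℝ) : Prop where
  smooth : SmoothNear φ 0
  zero : ∀ v : ℝ × ℝ, lineD (0, v) φ 0 = 0

variable {φ ψ : ℝ × (ℝ × ℝ) → ℝ} {F : ℝ → ℝ × ℝ → ℝ}

theorem Stationary.const (k : ℝ) : Stationary fun _ => k :=
  ⟨SmoothNear.const k, fun _ => lineD_const _ _ _⟩

theorem Stationary.mul (h : Stationary φ) (h' : Stationary ψ) :
    Stationary fun s => φ s * ψ s :=
  ⟨h.smooth.mul h'.smooth, fun v => by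
    rw [lineD_mul _ h.smooth.differentiableAt h'.smooth.differentiableAt, h.zero, h'.zero]; ring⟩

theorem Stationary.sub (h : Stationary φ) (h' : Stationary ψ) :
    Stationary fun s => φ s - ψ s :=
  ⟨h.smooth.sub h'.smooth, fun v => by
    rw [lineD_sub _ h.smooth.differentiableAt h'.smooth.differentiableAt, h.zero, h'.zero]; ring⟩

section Combination

variable {𝕜 E : Type*} [RCLike 𝕜] [NormedAddCommGroup E] [NormedSpace 𝕜 E]
  {c₀ c₁ c₂ c₃ φ₀ φ₁ φ₂ φ₃ : E → 𝕜} {x : E}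

theorem lineD_mul_of_zero (v : E) (h : SmoothNear c₀ x) (h' : SmoothNear φ₀ x) (z : c₀ x = 0) :
    lineD v (fun s => c₀ s * φ₀ s) x = lineD v c₀ x * φ₀ x := by
  rw [lineD_mul v h.differentiableAt h'.differentiableAt, z]; ring

theorem lineD_combination (v : E) (h₀ : SmoothNear c₀ x) (h₁ : SmoothNear c₁ x)
    (h₂ : SmoothNear c₂ x) (h₃ : SmoothNear c₃ x) (k₀ : SmoothNear φ₀ x) (k₁ : SmoothNear φ₁ x)
    (k₂ : SmoothNear φ₂ x) (k₃ : SmoothNear φ₃ x) (z₀ : c₀ x = 0) (z₁ : c₁ x = 0) (z₂ : c₂ x = 0)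
    (z₃ : c₃ x = 0) :
    lineD v (fun s => c₀ s * φ₀ s + c₁ s * φ₁ s + c₂ s * φ₂ s + c₃ s * φ₃ s) x
      = lineD v c₀ x * φ₀ x + lineD v c₁ x * φ₁ x + lineD v c₂ x * φ₂ x + lineD v c₃ x * φ₃ x := by
  rw [lineD_add v (((h₀.mul k₀).add (h₁.mul k₁)).add (h₂.mul k₂)).differentiableAt
      (h₃.mul k₃).differentiableAt,
    lineD_add v ((h₀.mul k₀).add (h₁.mul k₁)).differentiableAt (h₂.mul k₂).differentiableAt,
    lineD_add v (h₀.mul k₀).differentiableAt (h₁.mul k₁).differentiableAt,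
    lineD_mul_of_zero v h₀ k₀ z₀, lineD_mul_of_zero v h₁ k₁ z₁, lineD_mul_of_zero v h₂ k₂ z₂,
    lineD_mul_of_zero v h₃ k₃ z₃]

end Combination

theorem lineD_lineD_mul_stationary {c : ℝ × (ℝ × ℝ) → ℝ} (v w : ℝ × ℝ) (h : SmoothNear c 0)
    (h' : Stationary φ) (z : c 0 = 0) :
    lineD (0, w) (lineD (0, v) (fun s => c s * φ s)) 0
      = lineD (0, w) (lineD (0, v) c) 0 * φ 0 := by
  rw [lineD_lineD_mul _ _ h h'.smooth, h'.zero, h'.zero, z]; ring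

theorem lineD_lineD_combination {c₀ c₁ c₂ c₃ φ₀ φ₁ φ₂ φ₃ : ℝ × (ℝ × ℝ) → ℝ} (v w : ℝ × ℝ)
    (h₀ : SmoothNear c₀ 0) (h₁ : SmoothNear c₁ 0) (h₂ : SmoothNear c₂ 0) (h₃ : SmoothNear c₃ 0)
    (k₀ : Stationary φ₀) (k₁ : Stationary φ₁) (k₂ : Stationary φ₂) (k₃ : Stationary φ₃)
    (z₀ : c₀ 0 = 0) (z₁ : c₁ 0 = 0) (z₂ : c₂ 0 = 0) (z₃ : c₃ 0 = 0) :
    lineD (0, w) (lineD (0, v)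
        (fun s => c₀ s * φ₀ s + c₁ s * φ₁ s + c₂ s * φ₂ s + c₃ s * φ₃ s)) 0
      = lineD (0, w) (lineD (0, v) c₀) 0 * φ₀ 0 + lineD (0, w) (lineD (0, v) c₁) 0 * φ₁ 0
        + lineD (0, w) (lineD (0, v) c₂) 0 * φ₂ 0 + lineD (0, w) (lineD (0, v) c₃) 0 * φ₃ 0 := by
  have m₀ := h₀.mul k₀.smooth
  have m₁ := h₁.mul k₁.smooth
  have m₂ := h₂.mul k₂.smooth
  have m₃ := h₃.mul k₃.smooth
  rw [lineD_lineD_add _ _ ((m₀.add m₁).add m₂) m₃, lineD_lineD_add _ _ (m₀.add m₁) m₂,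
    lineD_lineD_add _ _ m₀ m₁, lineD_lineD_mul_stationary v w h₀ k₀ z₀,
    lineD_lineD_mul_stationary v w h₁ k₁ z₁, lineD_lineD_mul_stationary v w h₂ k₂ z₂,
    lineD_lineD_mul_stationary v w h₃ k₃ z₃]

/-- The values at the origin of the derivatives at an ellipnode in normalized coordinates. -/
structure EllipnodeAt (f : ℝ × ℝ → ℝ) : Prop where
  h20 : pd₀ f 2 0 = pd₀ f 0 2
  h02 : pd₀ f 0 2 ≠ 0
  h11 : pd₀ f 1 1 = 0
  h30 : pd₀ f 3 0 = 0
  h03 : pd₀ f 0 3 = 0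
  h21 : pd₀ f 2 1 = 0
  h12 : pd₀ f 1 2 = 0

theorem EllipnodeJet.ellipnodeAt {f : ℝ × ℝ → ℝ} (h : EllipnodeJet (jet f)) : EllipnodeAt f := by
  obtain ⟨h1, h2, h3, h4, h5, h6, h7⟩ : pd₀ f 2 0 = pd₀ f 0 2 ∧ pd₀ f 0 2 ≠ 0 ∧ pd₀ f 1 1 = 0 ∧
      pd₀ f 3 0 = 0 ∧ pd₀ f 0 3 = 0 ∧ pd₀ f 2 1 = 0 ∧ pd₀ f 1 2 = 0 := by
    simpa [EllipnodeJet, jet_c] using h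
  exact ⟨h1, h2, h3, h4, h5, h6, h7⟩

theorem EllipnodeAt.isElliptic {f : ℝ × ℝ → ℝ} (h : EllipnodeAt f) : IsElliptic f 0 := by
  have e : pd 2 0 f 0 * pd 0 2 f 0 - pd 1 1 f 0 ^ 2 = pd₀ f 0 2 ^ 2 := by
    have h1 : pd 2 0 f 0 = pd₀ f 0 2 := h.h20
    have h2 : pd 1 1 f 0 = 0 := h.h11
    rw [h1, h2]; unfold pd₀; ring
  unfold IsElliptic
  rw [e]
  have := h.h02
  positivity

theorem EllipnodeAt.slopeRe_zero (h : EllipnodeAt (F 0)) : slopeRe F 0 = 0 := by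
  have : famPd F 1 1 0 = 0 := h.h11
  simp [slopeRe, this]

theorem EllipnodeAt.disc_pos (h : EllipnodeAt (F 0)) :
    0 < famPd F 2 0 0 * famPd F 0 2 0 - famPd F 1 1 0 ^ 2 := h.isElliptic

theorem EllipnodeAt.slopeIm_sq (h : EllipnodeAt (F 0)) : slopeIm F 0 * slopeIm F 0 = 1 := by
  have h1 : famPd F 2 0 0 = famPd F 0 2 0 := h.h20
  have h2 : famPd F 1 1 0 = 0 := h.h11
  have h3 : famPd F 0 2 0 ≠ 0 := h.h02
  unfold slopeIm
  rw [div_mul_div_comm, Real.mul_self_sqrt h.disc_pos.le, h1, h2]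
  field_simp
  ring

theorem EllipnodeAt.stationary_famPd (hF : SmoothFamily F) {i j : ℕ}
    (h1 : pd₀ (F 0) (i + 1) j = 0) (h2 : pd₀ (F 0) i (j + 1) = 0) : Stationary (famPd F i j) := by
  refine ⟨hF.smoothNear_famPd i j, fun v => ?_⟩
  rw [lineD_decomp v.1 v.2, (hF.lineD_x i j).eq_of_nhds, (hF.lineD_y i j).eq_of_nhds]
  have h1' : famPd F (i + 1) j 0 = 0 := h1
  have h2' : famPd F i (j + 1) 0 = 0 := h2
  rw [h1', h2']; ring

theorem Stationary.of_mul (hφ : SmoothNear φ 0) (hψ : Stationary ψ)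
    (h : Stationary fun s => φ s * ψ s) (h0 : ψ 0 ≠ 0) : Stationary φ := by
  refine ⟨hφ, fun v => ?_⟩
  have := h.zero v
  rw [lineD_mul _ hφ.differentiableAt hψ.smooth.differentiableAt, hψ.zero, mul_zero,
    add_zero] at this
  exact (mul_eq_zero.1 this).resolve_right h0

theorem Stationary.congr (h : Stationary φ) (e : φ =ᶠ[𝓝 0] ψ) : Stationary ψ :=
  ⟨h.smooth.congr e, fun v => by rw [← (lineD_congr (0, v) e).eq_of_nhds, h.zero]⟩

theorem EllipnodeAt.stationary_slopeRe (hF : SmoothFamily F) (h : EllipnodeAt (F 0)) :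
    Stationary (slopeRe F) := by
  have hB := stationary_famPd hF h.h21 h.h12
  have hC := stationary_famPd hF h.h12 h.h03
  have hC0 : famPd F 0 2 0 ≠ 0 := h.h02
  refine Stationary.of_mul (hB.smooth.neg.div hC.smooth hC0) hC ?_ hC0
  refine ((Stationary.const (-1)).mul hB).congr ?_
  filter_upwards [hC.smooth.continuousAt.eventually_ne hC0] with s hs
  unfold slopeRe
  field_simp

theorem EllipnodeAt.stationary_slopeIm (hF : SmoothFamily F) (h : EllipnodeAt (F 0)) :
    Stationary (slopeIm F) := by
  have hA := stationary_famPd hF h.h30 h.h21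
  have hB := stationary_famPd hF h.h21 h.h12
  have hC := stationary_famPd hF h.h12 h.h03
  have hC0 : famPd F 0 2 0 ≠ 0 := h.h02
  have hD : Stationary fun s =>
      famPd F 2 0 s * famPd F 0 2 s - famPd F 1 1 s * famPd F 1 1 s := (hA.mul hC).sub (hB.mul hB)
  have hD' : Stationary fun s => famPd F 2 0 s * famPd F 0 2 s - famPd F 1 1 s ^ 2 :=
    hD.congr (Eventually.of_forall fun s => by simp only; ring)
  have hS : SmoothNear (slopeIm F) 0 := (hD'.smooth.sqrt h.disc_pos.ne').div hC.smooth hC0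
  have h0 : slopeIm F 0 ≠ 0 := fun h0 => by
    have := h.slopeIm_sq
    rw [h0] at this
    simp at this
  have hsq : Stationary fun s => slopeIm F s * slopeIm F s := by
    refine Stationary.of_mul (hS.mul hS) (hC.mul hC) (hD'.congr ?_) (mul_ne_zero hC0 hC0)
    filter_upwards [hC.smooth.continuousAt.eventually_ne hC0,
      hD'.smooth.continuousAt.eventually (lt_mem_nhds h.disc_pos)] with s h1 h2
    unfold slopeIm
    rw [div_mul_div_comm, Real.mul_self_sqrt h2.le]
    field_simp
  refine ⟨hS, fun v => ?_⟩
  have := hsq.zero v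
  rw [lineD_mul _ hS.differentiableAt hS.differentiableAt] at this
  have h2 : 2 * (lineD (0, v) (slopeIm F) 0 * slopeIm F 0) = 0 := by linarith
  exact (mul_eq_zero.1 ((mul_eq_zero.1 h2).resolve_left two_ne_zero)).resolve_right h0

theorem EllipnodeAt.smooth_ellRe (hF : SmoothFamily F) (h : EllipnodeAt (F 0)) :
    SmoothNear (ellRe F) 0 := by
  have hR := (h.stationary_slopeRe hF).smooth
  have hI := (h.stationary_slopeIm hF).smooth
  have hP := hF.pdFamily.smooth
  exact ((((hP 3 0).mul (SmoothNear.const 1)).add ((hP 2 1).mul ((SmoothNear.const 3).mul hR))).add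
    ((hP 1 2).mul ((SmoothNear.const 3).mul ((hR.mul hR).sub (hI.mul hI))))).add
    ((hP 0 3).mul (((hR.mul hR).mul hR).sub ((SmoothNear.const 3).mul (hR.mul (hI.mul hI)))))

theorem EllipnodeAt.smooth_ellIm (hF : SmoothFamily F) (h : EllipnodeAt (F 0)) :
    SmoothNear (ellIm F) 0 := by
  have hR := (h.stationary_slopeRe hF).smooth
  have hI := (h.stationary_slopeIm hF).smooth
  have hP := hF.pdFamily.smooth
  exact ((((hP 3 0).mul (SmoothNear.const 0)).add ((hP 2 1).mul ((SmoothNear.const 3).mul hI))).add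
    ((hP 1 2).mul ((SmoothNear.const 6).mul (hR.mul hI)))).add
    ((hP 0 3).mul (((SmoothNear.const 3).mul ((hR.mul hR).mul hI)).sub ((hI.mul hI).mul hI)))

theorem EllipnodeAt.lineD_ellRe (hF : SmoothFamily F) (h : EllipnodeAt (F 0))
    (v : ℝ × (ℝ × ℝ)) : lineD v (ellRe F) 0
      = lineD v (famPd F 3 0) 0 - 3 * lineD v (famPd F 1 2) 0 := by
  have hR := (h.stationary_slopeRe hF).smooth
  have hI := (h.stationary_slopeIm hF).smooth
  have hP := hF.pdFamily.smooth
  unfold ellRe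
  rw [lineD_combination v (hP 3 0) (hP 2 1) (hP 1 2) (hP 0 3) (SmoothNear.const 1)
    ((SmoothNear.const 3).mul hR) ((SmoothNear.const 3).mul ((hR.mul hR).sub (hI.mul hI)))
    (((hR.mul hR).mul hR).sub ((SmoothNear.const 3).mul (hR.mul (hI.mul hI))))
    h.h30 h.h21 h.h12 h.h03, h.slopeRe_zero, h.slopeIm_sq]
  ring

theorem EllipnodeAt.lineD_ellIm (hF : SmoothFamily F) (h : EllipnodeAt (F 0))
    (v : ℝ × (ℝ × ℝ)) : lineD v (ellIm F) 0
      = slopeIm F 0 * (3 * lineD v (famPd F 2 1) 0 - lineD v (famPd F 0 3) 0) := by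
  have hR := (h.stationary_slopeRe hF).smooth
  have hI := (h.stationary_slopeIm hF).smooth
  have hP := hF.pdFamily.smooth
  unfold ellIm
  rw [lineD_combination v (hP 3 0) (hP 2 1) (hP 1 2) (hP 0 3) (SmoothNear.const 0)
    ((SmoothNear.const 3).mul hI) ((SmoothNear.const 6).mul (hR.mul hI))
    (((SmoothNear.const 3).mul ((hR.mul hR).mul hI)).sub ((hI.mul hI).mul hI))
    h.h30 h.h21 h.h12 h.h03, h.slopeRe_zero, h.slopeIm_sq]
  ring

theorem EllipnodeAt.lineD_lineD_ellRe (hF : SmoothFamily F) (h : EllipnodeAt (F 0))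
    (v w : ℝ × ℝ) : lineD (0, w) (lineD (0, v) (ellRe F)) 0
      = lineD (0, w) (lineD (0, v) (famPd F 3 0)) 0
        - 3 * lineD (0, w) (lineD (0, v) (famPd F 1 2)) 0 := by
  have hR := h.stationary_slopeRe hF
  have hI := h.stationary_slopeIm hF
  have hP := hF.pdFamily.smooth
  unfold ellRe
  rw [lineD_lineD_combination v w (hP 3 0) (hP 2 1) (hP 1 2) (hP 0 3) (Stationary.const 1)
    ((Stationary.const 3).mul hR) ((Stationary.const 3).mul ((hR.mul hR).sub (hI.mul hI)))
    (((hR.mul hR).mul hR).sub ((Stationary.const 3).mul (hR.mul (hI.mul hI))))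
    h.h30 h.h21 h.h12 h.h03, h.slopeRe_zero, h.slopeIm_sq]
  ring

theorem EllipnodeAt.lineD_lineD_ellIm (hF : SmoothFamily F) (h : EllipnodeAt (F 0))
    (v w : ℝ × ℝ) : lineD (0, w) (lineD (0, v) (ellIm F)) 0
      = slopeIm F 0 * (3 * lineD (0, w) (lineD (0, v) (famPd F 2 1)) 0
        - lineD (0, w) (lineD (0, v) (famPd F 0 3)) 0) := by
  have hR := h.stationary_slopeRe hF
  have hI := h.stationary_slopeIm hF
  have hP := hF.pdFamily.smooth
  unfold ellIm
  rw [lineD_lineD_combination v w (hP 3 0) (hP 2 1) (hP 1 2) (hP 0 3) (Stationary.const 0)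
    ((Stationary.const 3).mul hI) ((Stationary.const 6).mul (hR.mul hI))
    (((Stationary.const 3).mul ((hR.mul hR).mul hI)).sub ((hI.mul hI).mul hI))
    h.h30 h.h21 h.h12 h.h03, h.slopeRe_zero, h.slopeIm_sq]
  ring

end EllipticDerivatives

section ComplexTangents

variable {F : ℝ → ℝ × ℝ → ℝ}

theorem fderiv_ellCubic {s : ℝ × (ℝ × ℝ)} (h₁ : DifferentiableAt ℝ (ellRe F) s)
    (h₂ : DifferentiableAt ℝ (ellIm F) s) (v : ℝ × ℝ) :
    fderiv ℝ (ellCubic (F s.1)) s.2 v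
        = ((lineD (0, v) (ellRe F) s : ℝ) : ℂ) + Complex.I * ((lineD (0, v) (ellIm F) s : ℝ) : ℂ) ∧
    fderiv ℝ (fun p => star (ellCubic (F s.1) p)) s.2 v
        = ((lineD (0, v) (ellRe F) s : ℝ) : ℂ) - Complex.I * ((lineD (0, v) (ellIm F) s : ℝ) : ℂ) := by
  have hs : HasFDerivAt (fun q : ℝ × ℝ => (s.1, q)) (ContinuousLinearMap.inr ℝ ℝ (ℝ × ℝ)) s.2 :=
    hasFDerivAt_prodMk_right s.1 s.2
  have r1 : HasFDerivAt (fun q => ellRe F (s.1, q)) _ s.2 :=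
    HasFDerivAt.comp (g := ellRe F) s.2 h₁.hasFDerivAt hs
  have r2 : HasFDerivAt (fun q => ellIm F (s.1, q)) _ s.2 :=
    HasFDerivAt.comp (g := ellIm F) s.2 h₂.hasFDerivAt hs
  have c1 : HasFDerivAt (fun q => (ellRe F (s.1, q) : ℂ)) _ s.2 :=
    Complex.ofRealCLM.hasFDerivAt.comp s.2 r1
  have c2 : HasFDerivAt (fun q => (ellIm F (s.1, q) : ℂ)) _ s.2 :=
    Complex.ofRealCLM.hasFDerivAt.comp s.2 r2
  have e1 : ellCubic (F s.1)
      = fun q => (ellRe F (s.1, q) : ℂ) + Complex.I * (ellIm F (s.1, q) : ℂ) :=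
    funext fun q => ellCubic_eq F (s.1, q)
  have e2 : (fun p => star (ellCubic (F s.1) p))
      = fun q => (ellRe F (s.1, q) : ℂ) - Complex.I * (ellIm F (s.1, q) : ℂ) := by
    funext q
    rw [e1]
    simp [sub_eq_add_neg]
  constructor
  · rw [e1, (c1.fun_add (c2.const_mul Complex.I)).fderiv]
    simp [lineD]
  · rw [e2, (c1.fun_sub (c2.const_mul Complex.I)).fderiv]
    simp [lineD]

theorem complexDiff_apply (G : ℝ × ℝ → ℂ) (q : ℝ × ℝ) :
    complexDiff G q (1, 0) = fderiv ℝ G q (1, 0) ∧ complexDiff G q (0, 1) = fderiv ℝ G q (0, 1) := by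
  simp [complexDiff]

theorem complexDiff_ne_zero {s : ℝ × (ℝ × ℝ)} (h₁ : DifferentiableAt ℝ (ellRe F) s)
    (h₂ : DifferentiableAt ℝ (ellIm F) s)
    (h : lineD (0, (1, 0)) (ellRe F) s ≠ 0 ∨ lineD (0, (0, 1)) (ellRe F) s ≠ 0 ∨
      lineD (0, (1, 0)) (ellIm F) s ≠ 0 ∨ lineD (0, (0, 1)) (ellIm F) s ≠ 0) :
    complexDiff (ellCubic (F s.1)) s.2 ≠ 0 := by
  intro h0
  have a := complexDiff_apply (ellCubic (F s.1)) s.2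
  rw [h0, (fderiv_ellCubic h₁ h₂ _).1, (fderiv_ellCubic h₁ h₂ _).1] at a
  have b1 := Complex.ext_iff.1 a.1
  have b2 := Complex.ext_iff.1 a.2
  simp at b1 b2
  rcases h with h | h | h | h
  · exact h b1.1.symm
  · exact h b2.1.symm
  · exact h b1.2.symm
  · exact h b2.2.symm

theorem conj_det {s : ℝ × (ℝ × ℝ)} (h₁ : DifferentiableAt ℝ (ellRe F) s)
    (h₂ : DifferentiableAt ℝ (ellIm F) s) :
    complexDiff (ellCubic (F s.1)) s.2 (1, 0)
        * complexDiff (fun p => star (ellCubic (F s.1) p)) s.2 (0, 1)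
      - complexDiff (ellCubic (F s.1)) s.2 (0, 1)
        * complexDiff (fun p => star (ellCubic (F s.1) p)) s.2 (1, 0)
      = -2 * Complex.I * (jac (ellRe F) (ellIm F) s : ℂ) := by
  rw [(complexDiff_apply _ _).1, (complexDiff_apply _ _).2, (complexDiff_apply _ _).1,
    (complexDiff_apply _ _).2, (fderiv_ellCubic h₁ h₂ _).1, (fderiv_ellCubic h₁ h₂ _).1,
    (fderiv_ellCubic h₁ h₂ _).2, (fderiv_ellCubic h₁ h₂ _).2]
  unfold jac
  push_cast
  ring

theorem complexTangent_ne {s : ℝ × (ℝ × ℝ)} (h₁ : DifferentiableAt ℝ (ellRe F) s)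
    (h₂ : DifferentiableAt ℝ (ellIm F) s) (hj : jac (ellRe F) (ellIm F) s ≠ 0) :
    complexTangent (ellCubic (F s.1)) s.2
      ≠ complexTangent (fun p => star (ellCubic (F s.1) p)) s.2 := by
  apply ker_ne_of_det_ne_zero
  rw [conj_det h₁ h₂]
  simpa using hj

theorem linearMap_ne_zero {L : ℂ × ℂ →ₗ[ℂ] ℂ} (h : L ≠ 0) : L (1, 0) ≠ 0 ∨ L (0, 1) ≠ 0 := by
  by_contra! h'
  apply h
  ext <;> simp [h'.1, h'.2]

theorem complexTangent_eq {s : ℝ × (ℝ × ℝ)} (h₁ : DifferentiableAt ℝ (ellRe F) s)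
    (h₂ : DifferentiableAt ℝ (ellIm F) s) (hj : jac (ellRe F) (ellIm F) s = 0)
    (h : complexDiff (ellCubic (F s.1)) s.2 ≠ 0) :
    complexTangent (ellCubic (F s.1)) s.2
      = complexTangent (fun p => star (ellCubic (F s.1) p)) s.2 := by
  have hconj : ∀ v, fderiv ℝ (fun p => star (ellCubic (F s.1) p)) s.2 v
      = star (fderiv ℝ (ellCubic (F s.1)) s.2 v) := by
    intro v
    rw [(fderiv_ellCubic h₁ h₂ v).1, (fderiv_ellCubic h₁ h₂ v).2]
    simp [sub_eq_add_neg]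
  have h' := linearMap_ne_zero h
  refine ker_eq_of_det_eq_zero h' ?_ ?_
  · rw [(complexDiff_apply _ _).1, (complexDiff_apply _ _).2] at h' ⊢
    rw [hconj, hconj]
    exact h'.imp star_ne_zero.2 star_ne_zero.2
  · have := conj_det h₁ h₂
    rw [hj] at this
    simpa [sub_eq_zero] using this

end ComplexTangents

section BiEllipnode

variable {F : ℝ → ℝ × ℝ → ℝ}

theorem BiEllipnodeJet.det_eq_zero {f : ℝ × ℝ → ℝ} (h : BiEllipnodeJet (jet f)) :
    (pd₀ f 4 0 - 3 * pd₀ f 2 2) * (pd₀ f 0 4 - 3 * pd₀ f 2 2)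
      - (pd₀ f 3 1 - 3 * pd₀ f 1 3) * (pd₀ f 1 3 - 3 * pd₀ f 3 1) = 0 := by
  simpa [jet_c] using h.2

namespace EllipnodeAt

theorem dx_ellRe (hF : SmoothFamily F) (h : EllipnodeAt (F 0)) :
    lineD (0, (1, 0)) (ellRe F) 0 = pd₀ (F 0) 4 0 - 3 * pd₀ (F 0) 2 2 := by
  rw [h.lineD_ellRe hF, (hF.lineD_x _ _).eq_of_nhds, (hF.lineD_x _ _).eq_of_nhds]; rfl

theorem dy_ellRe (hF : SmoothFamily F) (h : EllipnodeAt (F 0)) :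
    lineD (0, (0, 1)) (ellRe F) 0 = pd₀ (F 0) 3 1 - 3 * pd₀ (F 0) 1 3 := by
  rw [h.lineD_ellRe hF, (hF.lineD_y _ _).eq_of_nhds, (hF.lineD_y _ _).eq_of_nhds]; rfl

theorem dx_ellIm (hF : SmoothFamily F) (h : EllipnodeAt (F 0)) :
    lineD (0, (1, 0)) (ellIm F) 0
      = slopeIm F 0 * (3 * pd₀ (F 0) 3 1 - pd₀ (F 0) 1 3) := by
  rw [h.lineD_ellIm hF, (hF.lineD_x _ _).eq_of_nhds, (hF.lineD_x _ _).eq_of_nhds]; rfl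

theorem dy_ellIm (hF : SmoothFamily F) (h : EllipnodeAt (F 0)) :
    lineD (0, (0, 1)) (ellIm F) 0
      = slopeIm F 0 * (3 * pd₀ (F 0) 2 2 - pd₀ (F 0) 0 4) := by
  rw [h.lineD_ellIm hF, (hF.lineD_y _ _).eq_of_nhds, (hF.lineD_y _ _).eq_of_nhds]; rfl

theorem slopeIm_ne_zero (h : EllipnodeAt (F 0)) : slopeIm F 0 ≠ 0 := fun h0 => by
  have := h.slopeIm_sq
  rw [h0] at this
  simp at this

theorem jac_eq (hF : SmoothFamily F) (h : EllipnodeAt (F 0)) : jac (ellRe F) (ellIm F) 0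
    = -slopeIm F 0 * ((pd₀ (F 0) 4 0 - 3 * pd₀ (F 0) 2 2) * (pd₀ (F 0) 0 4 - 3 * pd₀ (F 0) 2 2)
      - (pd₀ (F 0) 3 1 - 3 * pd₀ (F 0) 1 3) * (pd₀ (F 0) 1 3 - 3 * pd₀ (F 0) 3 1)) := by
  rw [jac, h.dx_ellRe hF, h.dy_ellRe hF, h.dx_ellIm hF, h.dy_ellIm hF]; ring

theorem ellRe_zero (h : EllipnodeAt (F 0)) : ellRe F 0 = 0 := by
  have h1 : famPd F 3 0 0 = 0 := h.h30
  have h2 : famPd F 2 1 0 = 0 := h.h21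
  have h3 : famPd F 1 2 0 = 0 := h.h12
  have h4 : famPd F 0 3 0 = 0 := h.h03
  simp [ellRe, h1, h2, h3, h4]

theorem ellIm_zero (h : EllipnodeAt (F 0)) : ellIm F 0 = 0 := by
  have h1 : famPd F 3 0 0 = 0 := h.h30
  have h2 : famPd F 2 1 0 = 0 := h.h21
  have h3 : famPd F 1 2 0 = 0 := h.h12
  have h4 : famPd F 0 3 0 = 0 := h.h03
  simp [ellIm, h1, h2, h3, h4]

theorem eventually_isElliptic (hF : SmoothFamily F) (h : EllipnodeAt (F 0)) :
    ∀ᶠ s in 𝓝 (0 : ℝ × (ℝ × ℝ)), IsElliptic (F s.1) s.2 := by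
  have hs : SmoothNear (fun s => famPd F 2 0 s * famPd F 0 2 s - famPd F 1 1 s ^ 2) 0 :=
    ((hF.smoothNear_famPd 2 0).mul (hF.smoothNear_famPd 0 2)).sub
      ((hF.smoothNear_famPd 1 1).pow 2)
  exact hs.continuousAt.eventually (lt_mem_nhds h.disc_pos)

theorem conjBranchesTangentAt (hF : SmoothFamily F) (h : EllipnodeAt (F 0))
    (hdet : (pd₀ (F 0) 4 0 - 3 * pd₀ (F 0) 2 2) * (pd₀ (F 0) 0 4 - 3 * pd₀ (F 0) 2 2)
      - (pd₀ (F 0) 3 1 - 3 * pd₀ (F 0) 1 3) * (pd₀ (F 0) 1 3 - 3 * pd₀ (F 0) 3 1) = 0)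
    (hne : pd₀ (F 0) 4 0 - 3 * pd₀ (F 0) 2 2 ≠ 0 ∨ pd₀ (F 0) 0 4 - 3 * pd₀ (F 0) 2 2 ≠ 0 ∨
      pd₀ (F 0) 3 1 - 3 * pd₀ (F 0) 1 3 ≠ 0 ∨ pd₀ (F 0) 1 3 - 3 * pd₀ (F 0) 3 1 ≠ 0) :
    ConjBranchesTangentAt (F 0) 0 := by
  have d1 := (h.smooth_ellRe hF).differentiableAt
  have d2 := (h.smooth_ellIm hF).differentiableAt
  have hτ := h.slopeIm_ne_zero
  have hcd := complexDiff_ne_zero d1 d2 (by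
    rw [h.dx_ellRe hF, h.dy_ellRe hF, h.dx_ellIm hF, h.dy_ellIm hF]
    rcases hne with h | h | h | h
    · exact Or.inl h
    · exact Or.inr (Or.inr (Or.inr (mul_ne_zero hτ fun h0 => h (by linarith))))
    · exact Or.inr (Or.inl h)
    · exact Or.inr (Or.inr (Or.inl (mul_ne_zero hτ fun h0 => h (by linarith)))))
  have hz : ellCubic (F (0 : ℝ × (ℝ × ℝ)).1) (0 : ℝ × (ℝ × ℝ)).2 = 0 :=
    (ellCubic_eq_zero_iff F 0).2 ⟨h.ellRe_zero, h.ellIm_zero⟩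
  have hj : jac (ellRe F) (ellIm F) 0 = 0 := by rw [h.jac_eq hF, hdet, mul_zero]
  have ht := complexTangent_eq d1 d2 hj hcd
  exact ⟨h.isElliptic, hz, hcd, ht⟩

end EllipnodeAt

/-- At a bi-ellipnode the two complex conjugate branches have the same complex tangent. -/
theorem biEllipnode_tangent {f : ℝ × ℝ → ℝ} (hf : SmoothGerm f) (hJ : BiEllipnodeJet (jet f))
    (hne : (jet f).c 4 0 - 3 * (jet f).c 2 2 ≠ 0 ∨ (jet f).c 0 4 - 3 * (jet f).c 2 2 ≠ 0 ∨
        (jet f).c 3 1 - 3 * (jet f).c 1 3 ≠ 0 ∨ (jet f).c 1 3 - 3 * (jet f).c 3 1 ≠ 0) :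
    IsEllipnode f 0 ∧ ConjBranchesTangentAt f 0 := by
  have h := hJ.1.ellipnodeAt
  have hne' : pd₀ f 4 0 - 3 * pd₀ f 2 2 ≠ 0 ∨ pd₀ f 0 4 - 3 * pd₀ f 2 2 ≠ 0 ∨
      pd₀ f 3 1 - 3 * pd₀ f 1 3 ≠ 0 ∨ pd₀ f 1 3 - 3 * pd₀ f 3 1 ≠ 0 := by
    simpa [jet_c] using hne
  have hnode := (isNode_iff_of_isElliptic (F := fun _ => f) (s := 0) h.isElliptic).2
    ⟨EllipnodeAt.ellRe_zero (F := fun _ => f) h, EllipnodeAt.ellIm_zero (F := fun _ => f) h⟩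
  exact ⟨⟨h.isElliptic, hnode⟩, EllipnodeAt.conjBranchesTangentAt (F := fun _ => f)
    hf.smoothFamily h hJ.det_eq_zero hne'⟩

/-- The derivative, along the kernel of the differential, of the Jacobian of the real and imaginary
parts of the equation of the branch, up to sign. -/
noncomputable def ellFoldNum (c : ℕ → ℕ → ℝ) : ℝ :=
  let gx := c 4 0 - 3 * c 2 2
  let gy := c 3 1 - 3 * c 1 3
  (-gy * c 5 0 + gx * c 4 1 - 3 * (-gy * c 3 2 + gx * c 2 3)) * (3 * c 2 2 - c 0 4)
    + gx * (3 * (-gy * c 3 2 + gx * c 2 3) - (-gy * c 1 4 + gx * c 0 5))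
    - ((-gy * c 4 1 + gx * c 3 2 - 3 * (-gy * c 2 3 + gx * c 1 4)) * (3 * c 3 1 - c 1 3)
    + gy * (3 * (-gy * c 4 1 + gx * c 3 2) - (-gy * c 2 3 + gx * c 1 4)))

/-- The condition on the velocity `V` for the parameter to vary at a double ellipnode. -/
noncomputable def ellSpeedNum (c V : ℕ → ℕ → ℝ) : ℝ :=
  (V 3 0 - 3 * V 1 2) * (3 * c 3 1 - c 1 3) - (c 4 0 - 3 * c 2 2) * (3 * V 2 1 - V 0 3)

theorem SmoothFamily.lineD_x_plane (hF : SmoothFamily F) (a b : ℝ) (i j : ℕ) :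
    lineD (0, (a, b)) (lineD (0, (1, 0)) (famPd F i j)) 0
      = a * pd₀ (F 0) (i + 2) j + b * pd₀ (F 0) (i + 1) (j + 1) := by
  rw [(lineD_congr _ (hF.lineD_x i j)).eq_of_nhds, lineD_decomp a b, (hF.lineD_x _ _).eq_of_nhds,
    (hF.lineD_y _ _).eq_of_nhds]
  rfl

theorem SmoothFamily.lineD_y_plane (hF : SmoothFamily F) (a b : ℝ) (i j : ℕ) :
    lineD (0, (a, b)) (lineD (0, (0, 1)) (famPd F i j)) 0
      = a * pd₀ (F 0) (i + 1) (j + 1) + b * pd₀ (F 0) i (j + 2) := by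
  rw [(lineD_congr _ (hF.lineD_y i j)).eq_of_nhds, lineD_decomp a b, (hF.lineD_x _ _).eq_of_nhds,
    (hF.lineD_y _ _).eq_of_nhds]
  rfl

theorem EllipnodeAt.lineD_jac (hF : SmoothFamily F) (h : EllipnodeAt (F 0)) :
    lineD (0, (-lineD (0, (0, 1)) (ellRe F) 0, lineD (0, (1, 0)) (ellRe F) 0))
      (jac (ellRe F) (ellIm F)) 0 = slopeIm F 0 * ellFoldNum (pd₀ (F 0)) := by
  rw [Flecnodal.lineD_jac (h.smooth_ellRe hF) (h.smooth_ellIm hF)]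
  simp only [h.lineD_lineD_ellRe hF, h.lineD_lineD_ellIm hF]
  rw [h.dx_ellRe hF, h.dy_ellRe hF, h.dx_ellIm hF, h.dy_ellIm hF]
  simp only [hF.lineD_x_plane, hF.lineD_y_plane]
  unfold ellFoldNum
  simp only [Nat.reduceAdd]
  ring

theorem EllipnodeAt.speed_eq (hF : SmoothFamily F) (h : EllipnodeAt (F 0)) :
    lineD (1, 0) (ellRe F) 0 * lineD (0, (1, 0)) (ellIm F) 0
      - lineD (0, (1, 0)) (ellRe F) 0 * lineD (1, 0) (ellIm F) 0
      = slopeIm F 0 * ellSpeedNum (pd₀ (F 0)) (pd₀ (velocity F)) := by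
  rw [h.dx_ellRe hF, h.dx_ellIm hF, h.lineD_ellRe hF, h.lineD_ellIm hF, hF.lineD_eps, hF.lineD_eps,
    hF.lineD_eps, hF.lineD_eps]
  unfold ellSpeedNum pd₀
  ring

/-- The pairs of jets for which the bi-ellipnode transition is guaranteed. -/
def biEllipnodeGeneric : Set (Jet × Jet) :=
  {s | s.1.c 4 0 - 3 * s.1.c 2 2 ≠ 0 ∧ ellFoldNum s.1.c ≠ 0 ∧ ellSpeedNum s.1.c s.2.c ≠ 0}

theorem biEllipnodeTransition_of_generic (hF : SmoothFamily F) (hJ : BiEllipnodeJet (jet (F 0)))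
    (hG : (jet (F 0), jet (velocity F)) ∈ biEllipnodeGeneric) : BiEllipnodeTransition F := by
  have h := hJ.1.ellipnodeAt
  have hτ := h.slopeIm_ne_zero
  obtain ⟨hA, hQ, hR⟩ : pd₀ (F 0) 4 0 - 3 * pd₀ (F 0) 2 2 ≠ 0 ∧ ellFoldNum (pd₀ (F 0)) ≠ 0 ∧
      ellSpeedNum (pd₀ (F 0)) (pd₀ (velocity F)) ≠ 0 := by
    have := hG
    simpa [biEllipnodeGeneric, ellFoldNum, ellSpeedNum, jet_c] using this
  have s₁ := h.smooth_ellRe hF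
  have s₂ := h.smooth_ellIm hF
  obtain ⟨τ, hσ, U, hU, hW⟩ := foldTransition_of_jac s₁ s₂ h.ellRe_zero h.ellIm_zero
    (by rw [h.jac_eq hF, hJ.det_eq_zero, mul_zero]) (by rw [h.dx_ellRe hF]; exact hA)
    (by rw [h.speed_eq hF]; exact mul_ne_zero hτ hR)
    (by rw [h.lineD_jac hF]; exact mul_ne_zero hτ hQ)
  have hloc : ∀ᶠ s in 𝓝 (0 : ℝ × (ℝ × ℝ)),
      (IsEllipnode (F s.1) s.2 ↔ ellRe F s = 0 ∧ ellIm F s = 0) ∧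
      ((ellRe F s = 0 ∧ ellIm F s = 0) → jac (ellRe F) (ellIm F) s ≠ 0 →
        ConjBranchesTransverseAt (F s.1) s.2) := by
    filter_upwards [h.eventually_isElliptic hF, s₁.eventually_differentiableAt,
      s₂.eventually_differentiableAt] with s he d1 d2
    refine ⟨⟨fun hn => (isNode_iff_of_isElliptic he).1 hn.2,
      fun hz => ⟨he, (isNode_iff_of_isElliptic he).2 hz⟩⟩, fun hz hj => ⟨he,
      (ellCubic_eq_zero_iff F s).2 hz, complexDiff_ne_zero d1 d2 ?_, complexTangent_ne d1 d2 hj⟩⟩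
    by_contra! h0
    apply hj
    rw [jac, h0.1, h0.2.1]; ring
  rw [nhds_prod_eq, Prod.zero_eq_mk] at hloc
  obtain ⟨pa, hpa, pb, hpb, hab⟩ := eventually_prod_iff.1 hloc
  refine ⟨τ, hσ, U ∩ {q | pb q}, inter_mem hU hpb, fun W hWn hWU => ?_⟩
  filter_upwards [hW W hWn (hWU.trans Set.inter_subset_left), hpa] with ε ⟨c1, c2, c3⟩ hε
  have hq : ∀ q ∈ W, _ := fun q hq => hab hε (hWU hq).2
  have hset : {q ∈ W | IsEllipnode (F ε) q}
      = {q ∈ W | ellRe F (ε, q) = 0 ∧ ellIm F (ε, q) = 0} := by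
    ext q
    simp only [Set.mem_ofPred_eq]
    exact and_congr_right fun h => (hq q h).1
  refine ⟨?_, ?_, ?_⟩
  · rw [hset]; exact c1
  · rintro rfl
    rw [hset]
    exact ⟨c2 rfl, h.conjBranchesTangentAt hF hJ.det_eq_zero (Or.inl hA)⟩
  · intro hpos
    obtain ⟨q₁, q₂, hne, he, hd1, hd2⟩ := c3 hpos
    have m1 : q₁ ∈ {q ∈ W | ellRe F (ε, q) = 0 ∧ ellIm F (ε, q) = 0} := by rw [he]; simp
    have m2 : q₂ ∈ {q ∈ W | ellRe F (ε, q) = 0 ∧ ellIm F (ε, q) = 0} := by rw [he]; simp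
    exact ⟨q₁, q₂, hne, hset.trans he, (hq q₁ m1.1).2 m1.2 hd1, (hq q₂ m2.1).2 m2.2 hd2⟩

theorem isOpen_biEllipnodeGeneric : IsOpen biEllipnodeGeneric := by
  have c1 : ∀ i j, Continuous fun s : Jet × Jet => s.1.c i j :=
    fun i j => (continuous_jet_c i j).comp continuous_fst
  have c2 : ∀ i j, Continuous fun s : Jet × Jet => s.2.c i j :=
    fun i j => (continuous_jet_c i j).comp continuous_snd
  refine (isOpen_ne_fun (by fun_prop) continuous_const).inter
    ((isOpen_ne_fun ?_ continuous_const).inter (isOpen_ne_fun ?_ continuous_const))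
  · simp only [ellFoldNum]; fun_prop
  · unfold ellSpeedNum; fun_prop

theorem biEllipnodeJet_mem_closure {J : Jet} (hJ : BiEllipnodeJet J) (V : Jet) :
    (J, V) ∈ closure {s : Jet × Jet | BiEllipnodeJet s.1 ∧ s.1.c 4 0 - 3 * s.1.c 2 2 ≠ 0} := by
  obtain ⟨⟨h1, h2, h3, h4, h5, h6, h7⟩, hdet⟩ := hJ
  obtain ⟨l, m, x, y, e1, e2, e3, e4⟩ : ∃ l m x y : ℝ, J.c 4 0 - 3 * J.c 2 2 = l * x ∧
      J.c 3 1 - 3 * J.c 1 3 = l * y ∧ J.c 1 3 - 3 * J.c 3 1 = m * x ∧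
      J.c 0 4 - 3 * J.c 2 2 = m * y := by
    apply exists_outer_product
    linear_combination hdet
  let γ : ℝ → Jet := fun t => Function.update (Function.update (Function.update (Function.update J
    ⟨(4, 0), by norm_num⟩ (3 * J.c 2 2 + (l + t) * (x + t)))
    ⟨(3, 1), by norm_num⟩ (-((l + t) * y + 3 * (m * (x + t))) / 8))
    ⟨(1, 3), by norm_num⟩ (-(m * (x + t) + 3 * ((l + t) * y)) / 8))
    ⟨(0, 4), by norm_num⟩ (3 * J.c 2 2 + m * y)
  have hγ : Continuous γ := by
    refine (((continuous_const.update _ ?_).update _ ?_).update _ ?_).update _ ?_ <;> fun_prop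
  have hγ0 : γ 0 = J := by
    simp only [γ, add_zero]
    rw [← e1, ← e2, ← e3, ← e4, update_self_eq J, update_self_eq J, update_self_eq J,
      update_self_eq J] <;> ring
  have hc : ∀ t, γ t ∈ {J' : Jet | BiEllipnodeJet J'} := by
    intro t
    simp only [BiEllipnodeJet, EllipnodeJet, γ, jet_c_update, Set.mem_ofPred_eq]
    norm_num
    refine ⟨⟨h1, h2, h3, h4, h5, h6, h7⟩, ?_⟩
    ring
  have key : (γ 0, V) ∈ closure {s : Jet × Jet | BiEllipnodeJet s.1 ∧
      s.1.c 4 0 - 3 * s.1.c 2 2 ≠ 0} := by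
    refine mem_closure_of_curve (γ := fun t => (γ t, V)) (by fun_prop) ?_
    filter_upwards [eventually_affine_ne_zero l one_ne_zero, eventually_affine_ne_zero x one_ne_zero]
      with t b1 b3
    rw [one_mul] at b1 b3
    refine ⟨hc t, ?_⟩
    simp only [γ, jet_c_update]
    norm_num
    exact ⟨b1, b3⟩
  rwa [hγ0] at key

theorem biEllipnodeGeneric_dense : {s : Jet × Jet | BiEllipnodeJet s.1} ⊆
    closure (biEllipnodeGeneric ∩ {s : Jet × Jet | BiEllipnodeJet s.1}) := by
  set A₁ := {s : Jet × Jet | BiEllipnodeJet s.1 ∧ s.1.c 4 0 - 3 * s.1.c 2 2 ≠ 0} with hA₁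
  set A₂ := {s : Jet × Jet | s ∈ A₁ ∧ ellFoldNum s.1.c ≠ 0} with hA₂
  have h01 : {s : Jet × Jet | BiEllipnodeJet s.1} ⊆ closure A₁ :=
    fun s hs => biEllipnodeJet_mem_closure hs s.2
  have h12 : A₁ ⊆ closure A₂ := by
    rintro ⟨J, V⟩ ⟨hJ, hA⟩
    let γ : ℝ → Jet := fun t => Function.update J ⟨(0, 5), by norm_num⟩ (J.c 0 5 + t)
    have hγ0 : γ 0 = J := by simp only [γ, add_zero]; exact update_self_eq J _ rfl
    have key : (γ 0, V) ∈ closure A₂ := by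
      refine mem_closure_of_curve (γ := fun t => (γ t, V)) ?_ ?_
      · have : Continuous γ := continuous_const.update _ (by fun_prop)
        fun_prop
      filter_upwards [eventually_affine_ne_zero (ellFoldNum J.c)
        (neg_ne_zero.2 (pow_ne_zero 2 hA))] with t ht
      refine ⟨⟨?_, ?_⟩, ?_⟩
      · simpa [γ, BiEllipnodeJet, EllipnodeJet, jet_c_update] using hJ
      · simpa [γ, jet_c_update] using hA
      · convert ht using 1
        simp only [γ, ellFoldNum, jet_c_update]
        norm_num
        ring
    rwa [hγ0] at key
  have h23 : A₂ ⊆ closure (biEllipnodeGeneric ∩ {s : Jet × Jet | BiEllipnodeJet s.1}) := by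
    rintro ⟨J, V⟩ ⟨⟨hJ, hA⟩, hQ⟩
    let γ : ℝ → Jet := fun t => Function.update V ⟨(0, 3), by norm_num⟩ (V.c 0 3 + t)
    have hγ0 : γ 0 = V := by simp only [γ, add_zero]; exact update_self_eq V _ rfl
    have key : (J, γ 0) ∈ closure (biEllipnodeGeneric ∩
        {s : Jet × Jet | BiEllipnodeJet s.1}) := by
      refine mem_closure_of_curve (γ := fun t => (J, γ t)) ?_ ?_
      · have : Continuous γ := continuous_const.update _ (by fun_prop)
        fun_prop
      filter_upwards [eventually_affine_ne_zero (ellSpeedNum J.c V.c) hA] with t ht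
      refine ⟨⟨hA, hQ, ?_⟩, hJ⟩
      convert ht using 1
      simp only [γ, ellSpeedNum, jet_c_update]
      norm_num
      ring
    rwa [hγ0] at key
  exact h01.trans (closure_minimal (h12.trans (closure_minimal h23 isClosed_closure))
    isClosed_closure)

theorem biEllipnode_generic : ForGenericFamily BiEllipnodeJet BiEllipnodeTransition :=
  ⟨biEllipnodeGeneric, isOpen_biEllipnodeGeneric, biEllipnodeGeneric_dense,
    fun _ hF hJ hG => biEllipnodeTransition_of_generic hF hJ hG⟩

end BiEllipnode

section Complexification

/-- A holomorphic function extending a real one has derivatives along real directions that extend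
those of the real function. -/
theorem eventually_lineD_complexification {Φ : ℂ × ℂ → ℂ} {f : ℝ × ℝ → ℝ} (hΦ : SmoothNear Φ 0)
    (hf : SmoothNear f 0) (h : ∀ᶠ q in 𝓝 (0 : ℝ × ℝ), Φ ((q.1 : ℂ), (q.2 : ℂ)) = (f q : ℂ))
    (v : ℝ × ℝ) : ∀ᶠ q in 𝓝 (0 : ℝ × ℝ),
      lineD ((v.1 : ℂ), (v.2 : ℂ)) Φ ((q.1 : ℂ), (q.2 : ℂ)) = ((lineD v f q : ℝ) : ℂ) := by
  have t : Tendsto (fun p : ℝ × ℝ => ((p.1 : ℂ), (p.2 : ℂ))) (𝓝 0) (𝓝 0) :=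
    (by fun_prop : Continuous fun p : ℝ × ℝ => ((p.1 : ℂ), (p.2 : ℂ))).tendsto' _ _ (by simp)
  filter_upwards [t.eventually hΦ.eventually_differentiableAt, hf.eventually_differentiableAt,
    eventually_eventually_nhds.2 h] with q h1 h2 h3
  let ι : ℝ × ℝ →L[ℝ] ℂ × ℂ := Complex.ofRealCLM.prodMap Complex.ofRealCLM
  have a1 : HasFDerivAt (fun p : ℝ × ℝ => Φ ((p.1 : ℂ), (p.2 : ℂ))) _ q :=
    (h1.hasFDerivAt.restrictScalars ℝ).comp q (ι.hasFDerivAt (x := q))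
  have a2 : HasFDerivAt (fun p : ℝ × ℝ => (f p : ℂ)) _ q :=
    Complex.ofRealCLM.hasFDerivAt.comp q h2.hasFDerivAt
  have := congrArg (fun L => L v) (a1.unique (a2.congr_of_eventuallyEq h3))
  simpa [lineD, ι, Prod.map] using this

theorem lineD_iterate_complexification {Φ : ℂ × ℂ → ℂ} {f : ℝ × ℝ → ℝ} (hΦ : SmoothNear Φ 0)
    (hf : SmoothNear f 0) (h : ∀ᶠ q in 𝓝 (0 : ℝ × ℝ), Φ ((q.1 : ℂ), (q.2 : ℂ)) = (f q : ℂ))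
    (v : ℝ × ℝ) (n : ℕ) : ∀ᶠ q in 𝓝 (0 : ℝ × ℝ),
      (lineD ((v.1 : ℂ), (v.2 : ℂ)))^[n] Φ ((q.1 : ℂ), (q.2 : ℂ)) = (((lineD v)^[n] f q : ℝ) : ℂ) := by
  induction n with
  | zero => exact h
  | succ n ih =>
    simp only [Function.iterate_succ_apply']
    exact eventually_lineD_complexification (hΦ.lineD_iterate _ n) (hf.lineD_iterate _ n) ih v

theorem pd_complexification {Φ : ℂ × ℂ → ℂ} {f : ℝ × ℝ → ℝ} (hΦ : SmoothNear Φ 0)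
    (hf : SmoothNear f 0) (h : ∀ᶠ q in 𝓝 (0 : ℝ × ℝ), Φ ((q.1 : ℂ), (q.2 : ℂ)) = (f q : ℂ))
    (i j : ℕ) : pd i j Φ 0 = (pd₀ f i j : ℂ) := by
  have := (lineD_iterate_complexification (hΦ.lineD_iterate _ j) (hf.lineD_iterate _ j)
    (lineD_iterate_complexification hΦ hf h (0, 1) j) (1, 0) i).self_of_nhds
  simp only [Complex.ofReal_zero, Complex.ofReal_one, Prod.fst_zero, Prod.snd_zero] at this
  exact this

/-- The partial derivatives of `Φ`, as functions of a parameter and the point. -/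
noncomputable def holPd (Φ : ℂ × ℂ → ℂ) (i j : ℕ) : ℂ × (ℂ × ℂ) → ℂ := fun s => pd i j Φ s.2

variable {Φ : ℂ × ℂ → ℂ}

theorem smoothNear_snd (hΦ : SmoothNear Φ 0) :
    SmoothNear (fun s : ℂ × (ℂ × ℂ) => Φ s.2) 0 := by
  have : Tendsto (fun s : ℂ × (ℂ × ℂ) => s.2) (𝓝 0) (𝓝 0) := continuous_snd.tendsto' _ _ rfl
  filter_upwards [this.eventually hΦ] with s hs
  exact ContDiffAt.comp (g := Φ) s hs contDiffAt_snd

theorem holPd_eq (hΦ : SmoothNear Φ 0) (i j : ℕ) :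
    holPd Φ i j =ᶠ[𝓝 0] ptl i j (fun s => Φ s.2) :=
  eventually_pd_eq_ptl (F := fun _ => Φ) (smoothNear_snd hΦ) (Eventually.of_forall fun _ => rfl) i j

theorem smoothNear_holPd (hΦ : SmoothNear Φ 0) (i j : ℕ) : SmoothNear (holPd Φ i j) 0 :=
  ((smoothNear_snd hΦ).ptl i j).congr (holPd_eq hΦ i j).symm

theorem lineD_x_holPd (hΦ : SmoothNear Φ 0) (i j : ℕ) :
    lineD (0, (1, 0)) (holPd Φ i j) 0 = pd (i + 1) j Φ 0 := by
  rw [(lineD_congr _ (holPd_eq hΦ i j)).eq_of_nhds, lineD_x_ptl]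
  exact (holPd_eq hΦ _ _).symm.eq_of_nhds

theorem lineD_y_holPd (hΦ : SmoothNear Φ 0) (i j : ℕ) :
    lineD (0, (0, 1)) (holPd Φ i j) 0 = pd i (j + 1) Φ 0 := by
  rw [(lineD_congr _ (holPd_eq hΦ i j)).eq_of_nhds, ((smoothNear_snd hΦ).lineD_y_ptl i j).eq_of_nhds]
  exact (holPd_eq hΦ _ _).symm.eq_of_nhds

theorem SmoothNear.cexp {E : Type*} [NormedAddCommGroup E] [NormedSpace ℂ E] {g : E → ℂ} {x : E}
    (hg : SmoothNear g x) : SmoothNear (fun s => Complex.exp (g s)) x := hg.mono fun _ h => h.cexp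

theorem SmoothNear.clog {E : Type*} [NormedAddCommGroup E] [NormedSpace ℂ E] {g : E → ℂ} {x : E}
    (hg : SmoothNear g x) (h0 : g x = 1) : SmoothNear (fun s => Complex.log (g s)) x := by
  have : ∀ᶠ s in 𝓝 x, g s ∈ Complex.slitPlane := hg.continuousAt.eventually
    (Complex.isOpen_slitPlane.mem_nhds (by rw [h0]; exact Complex.one_mem_slitPlane))
  filter_upwards [hg, this] with s h1 h2
  exact (Complex.contDiffAt_log h2).comp s h1

/-- A smooth square root near a point where the function is a nonzero square. -/
theorem SmoothNear.exists_sq {E : Type*} [NormedAddCommGroup E] [NormedSpace ℂ E] {D : E → ℂ} {x : E}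
    {a : ℂ} (hD : SmoothNear D x) (h0 : D x = a ^ 2) (ha : a ≠ 0) :
    ∃ R : E → ℂ, SmoothNear R x ∧ R x = a ∧ ∀ᶠ s in 𝓝 x, R s ^ 2 = D s := by
  have hd : SmoothNear (fun s => D s / a ^ 2) x := hD.div (SmoothNear.const _) (pow_ne_zero 2 ha)
  have h1 : D x / a ^ 2 = 1 := by rw [h0, div_self (pow_ne_zero 2 ha)]
  refine ⟨fun s => a * Complex.exp (Complex.log (D s / a ^ 2) / 2), (SmoothNear.const a).mul
    ((hd.clog h1).div (SmoothNear.const 2) two_ne_zero).cexp, by simp [h1], ?_⟩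
  filter_upwards [hD.continuousAt.eventually_ne (by rw [h0]; exact pow_ne_zero 2 ha)] with s hs
  rw [mul_pow, ← Complex.exp_nat_mul]
  have : ((2 : ℕ) : ℂ) * (Complex.log (D s / a ^ 2) / 2) = Complex.log (D s / a ^ 2) := by
    push_cast; ring
  rw [this, Complex.exp_log (div_ne_zero hs (pow_ne_zero 2 ha))]
  field_simp

/-- The asymptotic slopes near an ellipnode depend holomorphically on the point. -/
theorem exists_holomorphic_slope {f : ℝ × ℝ → ℝ} (h : EllipnodeAt f) (hΦ : SmoothNear Φ 0)
    (hpd : ∀ i j, pd i j Φ 0 = (pd₀ f i j : ℂ)) {τ : ℝ} (hτ : τ = 1 ∨ τ = -1) :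
    ∃ p : ℂ × (ℂ × ℂ) → ℂ, SmoothNear p 0 ∧ p 0 = τ * Complex.I ∧
      ∀ᶠ s in 𝓝 (0 : ℂ × (ℂ × ℂ)), s.2 ∈ complexBranch τ Φ ↔ cubic Φ s.2 (1, p s) = 0 := by
  have sP := smoothNear_holPd hΦ
  have e20 : holPd Φ 2 0 0 = (pd₀ f 0 2 : ℂ) := by rw [← h.h20]; exact hpd 2 0
  have e02 : holPd Φ 0 2 0 = (pd₀ f 0 2 : ℂ) := hpd 0 2
  have e11 : holPd Φ 1 1 0 = 0 := (hpd 1 1).trans (by rw [h.h11, Complex.ofReal_zero])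
  have hc : (pd₀ f 0 2 : ℂ) ≠ 0 := Complex.ofReal_ne_zero.2 h.h02
  obtain ⟨R, sR, R0, hR⟩ := (((sP 2 0).mul (sP 0 2)).sub ((sP 1 1).pow 2)).exists_sq
    (a := (pd₀ f 0 2 : ℂ)) (by rw [e20, e02, e11]; ring) hc
  have sp : ∀ k : ℂ, SmoothNear (fun s => (k * R s - holPd Φ 1 1 s) / holPd Φ 0 2 s) 0 := fun k =>
    (((SmoothNear.const k).mul sR).sub (sP 1 1)).div (sP 0 2) (by rw [e02]; exact hc)
  have p0 : ∀ k : ℂ, (k * R 0 - holPd Φ 1 1 0) / holPd Φ 0 2 0 = k := fun k => by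
    rw [R0, e11, e02, sub_zero, mul_div_cancel_right₀ _ hc]
  have hττ : τ * τ = 1 := by rcases hτ with h | h <;> simp [h]
  have hcont : ∀ k : ℂ, ContinuousAt (fun s => τ *
      ((k * R s - holPd Φ 1 1 s) / holPd Φ 0 2 s).im) 0 := fun k =>
    continuousAt_const.mul (Complex.continuous_im.continuousAt.comp (sp k).continuousAt)
  have hpos : ∀ᶠ s in 𝓝 (0 : ℂ × (ℂ × ℂ)),
      0 < τ * ((τ * Complex.I * R s - holPd Φ 1 1 s) / holPd Φ 0 2 s).im := by
    refine (hcont _).eventually (lt_mem_nhds ?_)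
    simp only [p0]
    simp [hττ]
  have hneg : ∀ᶠ s in 𝓝 (0 : ℂ × (ℂ × ℂ)),
      τ * ((-(τ * Complex.I) * R s - holPd Φ 1 1 s) / holPd Φ 0 2 s).im < 0 := by
    refine (hcont _).eventually (gt_mem_nhds ?_)
    simp only [p0]
    simp [hττ]
  have hττ' : (τ : ℂ) * τ = 1 := by exact_mod_cast hττ
  refine ⟨_, sp (τ * Complex.I), p0 _, ?_⟩
  filter_upwards [hpos, hneg, hR,
    (sP 0 2).continuousAt.eventually_ne (by rw [e02]; exact hc)] with s h1 h2 h3 h4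
  have hquad : ∀ p : ℂ, quad Φ s.2 (1, p) = 0 ↔
      p = (τ * Complex.I * R s - holPd Φ 1 1 s) / holPd Φ 0 2 s ∨
      p = (-(τ * Complex.I) * R s - holPd Φ 1 1 s) / holPd Φ 0 2 s := by
    intro p
    have : holPd Φ 0 2 s * quad Φ s.2 (1, p)
        = (p * holPd Φ 0 2 s - (τ * Complex.I * R s - holPd Φ 1 1 s))
          * (p * holPd Φ 0 2 s - (-(τ * Complex.I) * R s - holPd Φ 1 1 s)) := by
      unfold quad
      change holPd Φ 0 2 s * (holPd Φ 2 0 s * 1 ^ 2 + 2 * holPd Φ 1 1 s * 1 * p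
        + holPd Φ 0 2 s * p ^ 2) = _
      linear_combination -h3 + R s ^ 2 * (τ * τ) * Complex.I_sq - R s ^ 2 * hττ'
    rw [eq_div_iff h4, eq_div_iff h4, ← sub_eq_zero (b := _ - _), ← sub_eq_zero (b := _ - _),
      ← mul_eq_zero, ← this, mul_eq_zero, or_iff_right h4]
  constructor
  · rintro ⟨p, hp, hq, hcub⟩
    rcases (hquad p).1 hq with rfl | rfl
    · exact hcub
    · exact absurd hp h2.not_gt
  · exact fun hcub => ⟨_, h1, (hquad _).2 (Or.inl rfl), hcub⟩

/-- At a bi-ellipnode of a real analytic surface, the two conjugate flecnodal branches of the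
complexification are smooth holomorphic curves tangent to each other. -/
theorem biEllipnode_complex_tangent {f : ℝ × ℝ → ℝ} (hf : SmoothGerm f)
    (hJ : BiEllipnodeJet (jet f))
    (hne : (jet f).c 4 0 - 3 * (jet f).c 2 2 ≠ 0 ∨ (jet f).c 0 4 - 3 * (jet f).c 2 2 ≠ 0 ∨
        (jet f).c 3 1 - 3 * (jet f).c 1 3 ≠ 0 ∨ (jet f).c 1 3 - 3 * (jet f).c 3 1 ≠ 0)
    (hΦ : AnalyticAt ℂ Φ 0)
    (hΦf : ∀ᶠ q in 𝓝 (0 : ℝ × ℝ), Φ ((q.1 : ℂ), (q.2 : ℂ)) = (f q : ℂ)) :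
    TangentAt (complexBranch 1 Φ) (complexBranch (-1) Φ) 0 := by
  have hs : SmoothNear Φ 0 := hΦ.eventually_analyticAt.mono fun _ h => h.contDiffAt
  have hpd := pd_complexification hs hf hΦf
  have h := hJ.1.ellipnodeAt
  have sP := smoothNear_holPd hs
  have z : ∀ i j, pd₀ f i j = 0 → holPd Φ i j 0 = 0 := fun i j h0 =>
    (hpd i j).trans (by rw [h0, Complex.ofReal_zero])
  have key : ∀ τ : ℝ, τ = 1 ∨ τ = -1 → ∃ g : ℂ × (ℂ × ℂ) → ℂ, SmoothNear g 0 ∧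
      (∀ᶠ s in 𝓝 (0 : ℂ × (ℂ × ℂ)), s.2 ∈ complexBranch τ Φ ↔ g s = 0) ∧ g 0 = 0 ∧
      lineD (0, (1, 0)) g 0 = ((pd₀ f 4 0 - 3 * pd₀ f 2 2 : ℝ) : ℂ)
        - τ * Complex.I * ((pd₀ f 1 3 - 3 * pd₀ f 3 1 : ℝ) : ℂ) ∧
      lineD (0, (0, 1)) g 0 = ((pd₀ f 3 1 - 3 * pd₀ f 1 3 : ℝ) : ℂ)
        - τ * Complex.I * ((pd₀ f 0 4 - 3 * pd₀ f 2 2 : ℝ) : ℂ) := by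
    intro τ hτ
    obtain ⟨p, sp, p0, hp⟩ := exists_holomorphic_slope h hs hpd hτ
    have hττ : (τ : ℂ) * τ = 1 := by rcases hτ with h | h <;> simp [h]
    have hp2 : p 0 * p 0 = -1 := by
      rw [p0]; linear_combination (τ : ℂ) * τ * Complex.I_sq - hττ
    have hg : ∀ v, lineD v (fun s => holPd Φ 3 0 s * 1 + holPd Φ 2 1 s * (3 * p s)
        + holPd Φ 1 2 s * (3 * (p s * p s)) + holPd Φ 0 3 s * (p s * p s * p s)) 0
        = lineD v (holPd Φ 3 0) 0 - 3 * lineD v (holPd Φ 1 2) 0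
          + τ * Complex.I * (3 * lineD v (holPd Φ 2 1) 0 - lineD v (holPd Φ 0 3) 0) := by
      intro v
      rw [lineD_combination v (sP 3 0) (sP 2 1) (sP 1 2) (sP 0 3) (SmoothNear.const 1)
        ((SmoothNear.const 3).mul sp) ((SmoothNear.const 3).mul (sp.mul sp))
        ((sp.mul sp).mul sp) (z _ _ h.h30) (z _ _ h.h21) (z _ _ h.h12) (z _ _ h.h03), hp2, p0]
      ring
    refine ⟨_, ((((sP 3 0).mul (SmoothNear.const 1)).add ((sP 2 1).mul
      ((SmoothNear.const 3).mul sp))).add ((sP 1 2).mul ((SmoothNear.const 3).mul (sp.mul sp)))).add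
      ((sP 0 3).mul ((sp.mul sp).mul sp)), ?_, ?_, ?_, ?_⟩
    · filter_upwards [hp] with s hs
      rw [hs]
      refine Eq.congr_left ?_
      unfold cubic holPd
      ring
    · simp only [z _ _ h.h30, z _ _ h.h21, z _ _ h.h12, z _ _ h.h03, zero_mul, add_zero]
    · rw [hg]
      simp only [lineD_x_holPd hs, hpd]
      push_cast
      ring
    · rw [hg]
      simp only [lineD_y_holPd hs, hpd]
      push_cast
      ring
  obtain ⟨g₁, s₁, c₁, z₁, x₁, y₁⟩ := key 1 (Or.inl rfl)
  obtain ⟨g₂, s₂, c₂, z₂, x₂, y₂⟩ := key (-1) (Or.inr rfl)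
  have hne' : pd₀ f 4 0 - 3 * pd₀ f 2 2 ≠ 0 ∨ pd₀ f 0 4 - 3 * pd₀ f 2 2 ≠ 0 ∨
      pd₀ f 3 1 - 3 * pd₀ f 1 3 ≠ 0 ∨ pd₀ f 1 3 - 3 * pd₀ f 3 1 ≠ 0 := by
    simpa [jet_c] using hne
  have hnz : ∀ τ : ℝ, τ ≠ 0 →
      ((pd₀ f 4 0 - 3 * pd₀ f 2 2 : ℝ) : ℂ)
        - τ * Complex.I * ((pd₀ f 1 3 - 3 * pd₀ f 3 1 : ℝ) : ℂ) ≠ 0 ∨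
      ((pd₀ f 3 1 - 3 * pd₀ f 1 3 : ℝ) : ℂ)
        - τ * Complex.I * ((pd₀ f 0 4 - 3 * pd₀ f 2 2 : ℝ) : ℂ) ≠ 0 := by
    intro τ hτ
    generalize pd₀ f 4 0 - 3 * pd₀ f 2 2 = A at hne' ⊢
    generalize pd₀ f 0 4 - 3 * pd₀ f 2 2 = B at hne' ⊢
    generalize pd₀ f 3 1 - 3 * pd₀ f 1 3 = C at hne' ⊢
    generalize pd₀ f 1 3 - 3 * pd₀ f 3 1 = D at hne' ⊢
    by_contra! h0
    simp only [Complex.ext_iff] at h0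
    simp [hτ] at h0
    tauto
  have hdet : ((pd₀ f 4 0 - 3 * pd₀ f 2 2 : ℝ) : ℂ) * ((pd₀ f 0 4 - 3 * pd₀ f 2 2 : ℝ) : ℂ)
      - ((pd₀ f 3 1 - 3 * pd₀ f 1 3 : ℝ) : ℂ) * ((pd₀ f 1 3 - 3 * pd₀ f 3 1 : ℝ) : ℂ) = 0 := by
    exact_mod_cast hJ.det_eq_zero
  refine tangentAt_zero (C₁ := fun _ => complexBranch 1 Φ) (C₂ := fun _ => complexBranch (-1) Φ)
    s₁ s₂ c₁ c₂ (by rw [x₁, y₁]; exact hnz 1 one_ne_zero)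
    (by rw [x₂, y₂]; exact hnz (-1) (by norm_num)) z₁ z₂ ?_
  rw [x₁, y₁, x₂, y₂]
  simp only [Complex.ofReal_neg, Complex.ofReal_one]
  linear_combination 2 * Complex.I * hdet

end Complexification

end Flecnodal

open Flecnodal in
theorem theorem4 :
    -- (a) bi-hyperbonode: tangency at the moment of the transition
    (∀ f : ℝ × ℝ → ℝ, SmoothGerm f → BiHyperbonodeJet (jet f) →
      ((jet f).c 4 0 ≠ 0 ∨ (jet f).u ≠ 0) → ((jet f).c 0 4 ≠ 0 ∨ (jet f).v ≠ 0) →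
      IsHyperbonode f 0 ∧ TangentAt (leftBranch f) (rightBranch f) 0) ∧
    -- (a) in generic families two hyperbonodes are born or die
    ForGenericFamily BiHyperbonodeJet BiHyperbonodeTransition ∧
    -- (b) flec-hyperbonode: overlap of a biflecnode and a hyperbonode, in every family
    (∀ F : ℝ → ℝ × ℝ → ℝ, SmoothFamily F → FlecHyperbonodeJet (jet (F 0)) →
      ∀ s : ℝ, (s = 1 ∨ s = -1) → 0 < s * (jet (F 0)).c 1 1 →
      ∃ h b : ℝ → ℝ × ℝ, HyperbonodeBiflecnodeOverlap F s h b) ∧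
    -- (b) for generic velocities the biflecnode crosses the other branch
    (∀ J : Jet, FlecHyperbonodeJet J → ∃ V : Set Jet, IsOpen V ∧ Dense V ∧
      ∀ F : ℝ → ℝ × ℝ → ℝ, SmoothFamily F → jet (F 0) = J → jet (velocity F) ∈ V →
      ∀ s : ℝ, (s = 1 ∨ s = -1) → 0 < s * J.c 1 1 →
      ∃ h b : ℝ → ℝ × ℝ, HyperbonodeBiflecnodeOverlap F s h b ∧ CrossesBranch F (-s) b) ∧
    -- (c) bi-ellipnode: tangency at the moment of the transition
    (∀ f : ℝ × ℝ → ℝ, SmoothGerm f → BiEllipnodeJet (jet f) →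
      ((jet f).c 4 0 - 3 * (jet f).c 2 2 ≠ 0 ∨ (jet f).c 0 4 - 3 * (jet f).c 2 2 ≠ 0 ∨
        (jet f).c 3 1 - 3 * (jet f).c 1 3 ≠ 0 ∨ (jet f).c 1 3 - 3 * (jet f).c 3 1 ≠ 0) →
      IsEllipnode f 0 ∧ ConjBranchesTangentAt f 0 ∧
      -- if `f` is real analytic: tangency of the two conjugate curves in the complex plane
      ∀ Φ : ℂ × ℂ → ℂ, AnalyticAt ℂ Φ 0 →
        (∀ᶠ q in nhds (0 : ℝ × ℝ), Φ ((q.1 : ℂ), (q.2 : ℂ)) = (f q : ℂ)) →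
        TangentAt (complexBranch 1 Φ) (complexBranch (-1) Φ) 0) ∧
    -- (c) in generic families two ellipnodes are born or die
    ForGenericFamily BiEllipnodeJet BiEllipnodeTransition := by
  refine ⟨fun f hf hJ h1 h2 => biHyperbonode_tangent hf hJ h1 h2, biHyperbonode_generic,
    fun F hF hJ s hs hpos => flecHyperbonode_overlap hF hJ hs hpos, fun J hJ => ?_,
    fun f hf hJ hne => ⟨(biEllipnode_tangent hf hJ hne).1, (biEllipnode_tangent hf hJ hne).2,
      fun Φ hΦ hΦf => biEllipnode_complex_tangent hf hJ hne hΦ hΦf⟩, biEllipnode_generic⟩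
  obtain ⟨V, hV, hd, h⟩ := flecHyperbonode_crosses J
  exact ⟨V, hV, hd, fun F hF h0 hv => h F hF hJ h0 hv⟩
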